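/- Let $\Omega\subset\mathbb R^2$ be a convex polygonal domain, $\zeta\in[W^{1,\infty}(\Omega)]^2$ (with its continuous representative on $\overline\Omega$), $0\le\gamma\in W^{1,\infty}(\Omega)$, and assume $\gamma-\frac12\nabla\cdot\zeta\ge\gamma_0$ a.e. in $\Omega$ for a constant $\gamma_0>0$. Let $\varepsilon>0$. Let $\mathcal T_h$ be a conforming triangulation of $\Omega$ with numbered triangles $T$ of diameters $h_T$, which is locally quasi-uniform in the sense that every $T$ contains a disc of diameter $\rho h_T$, where $\rho>0$ is fixed. Let $\mathcal E_h^I$, $\mathcal E_h^B$ be the sets of interior and boundary edges, $\mathcal E_h=\mathcal E_h^I\cup\mathcal E_h^B$, $h_e$ the length of $e$. An interior edge is $e=\partial T^+\cap\partial T^-$, where $T^+$ has the larger number, and a boundary edge lies on $\partial T^+\cap\partial\Omega$; in both cases $\mathbf n=(n^{(1)},n^{(2)})$ is the unit normal on $e$ pointing out of $T^+$. Put $[v]=v^+-v^-$, $\{v\}=\frac12(v^++v^-)$ on interior edges and $[v]=v^+$ on boundary edges, where $v^\pm=v|_{T^\pm}$. Write $(v,w)_{\mathcal T_h}=\sum_T\int_T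 vw\,dx$ and $\langle v,w\rangle_{\mathcal S}=\sum_{e\in\mathcal S}\int_e vw\,ds$, and let $$V_h=\{v\in L_2(\Omega): v|_T\in\mathbb P_1(T)\ \ \forall T\in\mathcal T_h\}.$$ For $v$ continuous on each closed triangle, on $e\in\mathcal E_h^I$ let $\mathcal Q_i^\pm(v)=v^\pm$ if $n^{(i)}>0$, $\mathcal Q_i^\pm(v)=v^\mp$ if $n^{(i)}<0$, $\mathcal Q_i^\pm(v)=\{v\}$ if $n^{(i)}=0$, and on $e\in\mathcal E_h^B$ let $\mathcal Q_i^\pm(v)=v^+$. Define $\partial^\pm_{h,x_i}v,\ \partial^{\pm,0}_{h,x_i}v\in V_h$ by $$(\partial^\pm_{h,x_i}v,\varphi)_{\mathcal T_h}=\langle\mathcal Q_i^\pm(v)n^{(i)},[\varphi]\rangle_{\mathcal E_h}-(v,\partial_{x_i}\varphi)_{\mathcal T_h},\qquad(\partial^{\pm,0}_{h,x_i}v,\varphi)_{\mathcal T_h}=\langle\mathcal Q_i^\pm(v)n^{(i)},[\varphi]\rangle_{\mathcal E_h^I}-(v,\partial_{x_i}\varphi)_{\mathcal T_h}$$ for all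 $\varphi\in V_h$, and $\nabla^\pm_{h,0}v=(\partial^{\pm,0}_{h,x_1}v,\partial^{\pm,0}_{h,x_2}v)$, $\overline{\mathrm{div}}_h\mathbf v=\frac12\sum_{i=1}^2(\partial^+_{h,x_i}v^{(i)}+\partial^-_{h,x_i}v^{(i)})$. Let $\partial\Omega^-$ be the part of $\partial\Omega$ where $\zeta\cdot\mathbf n<0$. For penalty parameters $\sigma_e\ge0$ $(e\in\mathcal E_h)$ define $$a_h^d(v,w)=\tfrac12\big[(\nabla^+_{h,0}v,\nabla^+_{h,0}w)_{\mathcal T_h}+(\nabla^-_{h,0}v,\nabla^-_{h,0}w)_{\mathcal T_h}\big]+\big\langle\tfrac{\sigma_e}{h_e}[v],[w]\big\rangle_{\mathcal E_h},$$ $$a_h^{upw}(v,w)=(\overline{\mathrm{div}}_h(\zeta v),w)_{\mathcal T_h}+((\gamma-\nabla\cdot\zeta)v,w)_{L_2(\Omega)}+\int_{\partial\Omega^-}|\zeta\cdot\mathbf n|\,vw\,ds+\big\langle\tfrac12|\zeta\cdot\mathbf n|[v],[w]\big\rangle_{\mathcal E_h^I},$$ $a_h=\varepsilon a_h^d+a_h^{upw}$,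 and $$\|v\|_d^2=\tfrac12\big(\|\nabla^+_{h,0}v\|_{L_2(\Omega)}^2+\|\nabla^-_{h,0}v\|_{L_2(\Omega)}^2\big)+\sum_{e\in\mathcal E_h}\tfrac{\sigma_e}{h_e}\|[v]\|_{L_2(e)}^2,$$ $$\|v\|_{upw}^2=\|v\|_{L_2(\Omega)}^2+\int_{\partial\Omega}\tfrac12|\zeta\cdot\mathbf n|v^2\,ds+\sum_{e\in\mathcal E_h^I}\int_e\tfrac12|\zeta\cdot\mathbf n|[v]^2\,ds,$$ $$\|v\|_{h\sharp}^2=\varepsilon\|v\|_d^2+\|v\|_{upw}^2+\sum_{T\in\mathcal T_h}h_T\|\zeta\cdot\nabla v\|_{L_2(T)}^2.$$ Let $\sigma_{\min}>0$ and $\sigma_{\max}$ be constants, and suppose that $0\le\sigma_e\le\sigma_{\max}$ for all $e\in\mathcal E_h$ and that either every triangle of $\mathcal T_h$ has at most one boundary edge, or $\sigma_e\ge\sigma_{\min}$ for all $e\in\mathcal E_h$. Then there is a constant $C>0$, depending only on $\Omega,\zeta,\gamma,\gamma_0,\rho,\sigma_{\min},\sigma_{\max}$, and in particular independent of $\varepsilon$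 and of the mesh, such that $$\sup_{w_h\in V_h\setminus\{0\}}\frac{a_h(v_h,w_h)}{\|w_h\|_{h\sharp}}\ \ge\ C\,\|v_h\|_{h\sharp}\qquad\forall v_h\in V_h.$$ -/

import Mathlib

open MeasureTheory Set
open scoped ContDiff

namespace DWDG

/-- The Euclidean plane. -/
abbrev Plane : Type := EuclideanSpace ℝ (Fin 2)

/-- The coordinate unit vectors. -/
noncomputable abbrev unitVec (i : Fin 2) : Plane := EuclideanSpace.single i (1 : ℝ)

/-- A convex polygonal domain: the nonempty interior of the convex hull of finitely many points. -/
def IsConvexPolygon (Ω : Set Plane) : Prop :=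
  Ω.Nonempty ∧ ∃ s : Finset Plane, Ω = interior (convexHull ℝ (s : Set Plane))

/-! ### The space `W^{1,∞}(Ω)` and weak divergences -/

/-- `g` is the weak partial derivative `∂u/∂x_i` on `Ω` (tested with `C_c^∞(Ω)`). -/
def IsWeakPartial (Ω : Set Plane) (i : Fin 2) (u g : Plane → ℝ) : Prop :=
  ∀ φ : Plane → ℝ, ContDiff ℝ ∞ φ → HasCompactSupport φ → tsupport φ ⊆ Ω →
    ∫ x in Ω, u x * fderiv ℝ φ x (unitVec i) = - ∫ x in Ω, g x * φ x

/-- `u` has a weak partial derivative `∂u/∂x_i` in `L^∞(Ω)`. -/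
def HasBddWeakPartial (Ω : Set Plane) (i : Fin 2) (u : Plane → ℝ) : Prop :=
  ∃ g : Plane → ℝ, MemLp g ⊤ (volume.restrict Ω) ∧ IsWeakPartial Ω i u g

/-- `u ∈ W^{1,∞}(Ω)`. -/
def MemW1Inf (Ω : Set Plane) (u : Plane → ℝ) : Prop :=
  MemLp u ⊤ (volume.restrict Ω) ∧ ∀ i, HasBddWeakPartial Ω i u

open Classical in
/-- The weak partial derivative of a function of class `W^{1,∞}(Ω)`
(determined almost everywhere on `Ω`). -/
noncomputable def weakPartial (Ω : Set Plane) (i : Fin 2) (u : Plane → ℝ) : Plane → ℝ :=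
  if h : HasBddWeakPartial Ω i u then h.choose else 0

/-- The divergence `∇ · ζ` of a vector field of class `W^{1,∞}(Ω)`. -/
noncomputable def weakDiv (Ω : Set Plane) (ζ : Plane → Plane) (x : Plane) : ℝ :=
  ∑ i, weakPartial Ω i (fun y => ζ y i) x

/-! ### Triangulations -/

/-- A (conforming) simplicial triangulation of `Ω`. The triangles are numbered by `Fin n`
(the global numbering), and the vertices of every triangle by `Fin 3`. -/
structure Triangulation (Ω : Set Plane) where
  /-- number of triangles -/
  n : ℕ
  /-- vertices of the triangles -/
  vtx : Fin n → Fin 3 → Plane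
  indep : ∀ j, AffineIndependent ℝ (vtx j)
  distinct : Function.Injective fun j => range (vtx j)
  conforming : ∀ j j', convexHull ℝ (range (vtx j)) ∩ convexHull ℝ (range (vtx j')) =
    convexHull ℝ (range (vtx j) ∩ range (vtx j'))
  cover : ⋃ j, convexHull ℝ (range (vtx j)) = closure Ω

/-- The integral of `f` with respect to arc length over the segment from `a` to `b`. -/
noncomputable def segIntegral (a b : Plane) (f : Plane → ℝ) : ℝ :=
  dist a b * ∫ t in (0 : ℝ)..1, f (AffineMap.lineMap a b t)

/-- The two winds `+` and `-` of the discrete derivatives. -/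
inductive Wind : Type
  | plus
  | minus

namespace Triangulation

variable {Ω : Set Plane} (M : Triangulation Ω)

/-- The closed triangle number `j`. -/
def tri (j : Fin M.n) : Set Plane := convexHull ℝ (range (M.vtx j))

/-- The diameter `h_T` of a triangle. -/
noncomputable def diamT (j : Fin M.n) : ℝ := Metric.diam (M.tri j)

/-- `(j, k)` stands for the edge of triangle `j` opposite to its vertex `k`, seen from `j`. -/
abbrev Side : Type := Fin M.n × Fin 3

/-- The end points of a side. -/
def pt₁ (p : M.Side) : Plane := M.vtx p.1 (p.2 + 1)

/-- The end points of a side. -/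
def pt₂ (p : M.Side) : Plane := M.vtx p.1 (p.2 + 2)

/-- The edge of a side, given by its unordered pair of end points. -/
def edge (p : M.Side) : Sym2 Plane := s(M.pt₁ p, M.pt₂ p)

/-- The length `h_e` of an edge. -/
noncomputable def len (p : M.Side) : ℝ := dist (M.pt₁ p) (M.pt₂ p)

/-- `∫_e f ds`. -/
noncomputable def edgeInt (p : M.Side) (f : Plane → ℝ) : ℝ := segIntegral (M.pt₁ p) (M.pt₂ p) f

/-- The unit normal of the edge pointing out of the triangle `p.1`: the normalized component
orthogonal to the edge of the vector from the opposite vertex to the edge. -/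
noncomputable def normal (p : M.Side) : Plane :=
  let t : Plane := M.pt₂ p - M.pt₁ p
  let d : Plane := M.pt₁ p - M.vtx p.1 p.2
  let m : Plane := d - (inner ℝ t d / ‖t‖ ^ 2) • t
  ‖m‖⁻¹ • m

open Classical in
/-- The interior edges `e = ∂T⁺ ∩ ∂T⁻`; `p.1` is the side of `T⁺`, the triangle with the larger
number, and `p.2` is the side of `T⁻`. -/
noncomputable def intEdges : Finset (M.Side × M.Side) :=
  Finset.univ.filter fun p => p.2.1 < p.1.1 ∧ M.edge p.1 = M.edge p.2

open Classical in
/-- The boundary edges: those contained in `∂Ω`. -/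
noncomputable def bdryEdges : Finset M.Side :=
  Finset.univ.filter fun p => segment ℝ (M.pt₁ p) (M.pt₂ p) ⊆ frontier Ω

/-- Local quasi-uniformity (nondegeneracy): every triangle `T` contains a disc of diameter at
least `ρ h_T`. -/
def ShapeRegular (ρ : ℝ) : Prop :=
  ∀ j, ∃ c, Metric.closedBall c (ρ * M.diamT j / 2) ⊆ M.tri j

/-- Every triangle has at most one boundary edge. -/
def AtMostOneBoundaryEdge : Prop :=
  ∀ p ∈ M.bdryEdges, ∀ q ∈ M.bdryEdges, p.1 = q.1 → p = q

/-! ### Broken functions, jumps, averages and traces -/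

/-- Broken functions: a function on every triangle `T`, of which only the values on `T` matter.
On a common edge they have one value from either side. -/
abbrev Broken : Type := Fin M.n → Plane → ℝ

/-- The DG space `V_h`: an affine function on every triangle. -/
abbrev Vh : Type := Fin M.n → (Plane →ᵃ[ℝ] ℝ)

variable {M}

/-- Elements of `V_h` as broken functions. -/
noncomputable def Vh.fn (v : M.Vh) : M.Broken := fun j x => v j x

/-- The (elementwise) derivative `∂v/∂x_i` of `v ∈ V_h`. -/
noncomputable def Vh.dx (i : Fin 2) (v : M.Vh) : M.Broken := fun j _ => (v j).linear (unitVec i)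

/-- The inner product `(u, w)_{𝒯_h}`. -/
noncomputable def l2 (u w : M.Broken) : ℝ := ∑ j, ∫ x in M.tri j, u j x * w j x

/-- The jump on an interior edge. -/
noncomputable def jump (u : M.Broken) (p : M.Side × M.Side) (x : Plane) : ℝ := u p.1.1 x - u p.2.1 x

/-- The average on an interior edge. -/
noncomputable def avg (u : M.Broken) (p : M.Side × M.Side) (x : Plane) : ℝ :=
  (u p.1.1 x + u p.2.1 x) / 2

/-- The trace operators `𝒬_i^±` on an interior edge, with `n_e` the normal pointing out of `T⁺`. -/
noncomputable def trace (s : Wind) (i : Fin 2) (u : M.Broken) (p : M.Side × M.Side)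
    (x : Plane) : ℝ :=
  match s with
  | Wind.plus =>
    if 0 < M.normal p.1 i then u p.1.1 x
    else if M.normal p.1 i < 0 then u p.2.1 x else avg u p x
  | Wind.minus =>
    if 0 < M.normal p.1 i then u p.2.1 x
    else if M.normal p.1 i < 0 then u p.1.1 x else avg u p x

/-! ### Discrete differential operators -/

/-- `⟨𝒬_i^±(u) n^{(i)}, [φ]⟩_{ℰ_h^I} - (u, ∂_{x_i} φ)_{𝒯_h}`. -/
noncomputable def partialFunctional₀ (s : Wind) (i : Fin 2) (u : M.Broken) (φ : M.Vh) : ℝ :=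
  ∑ p ∈ M.intEdges,
      M.edgeInt p.1 (fun x => trace s i u p x * M.normal p.1 i * jump φ.fn p x)
    - l2 u (φ.dx i)

/-- `⟨𝒬_i^±(u) n^{(i)}, [φ]⟩_{ℰ_h} - (u, ∂_{x_i} φ)_{𝒯_h}`. -/
noncomputable def partialFunctional (s : Wind) (i : Fin 2) (u : M.Broken) (φ : M.Vh) : ℝ :=
  ∑ p ∈ M.intEdges,
      M.edgeInt p.1 (fun x => trace s i u p x * M.normal p.1 i * jump φ.fn p x)
    + ∑ p ∈ M.bdryEdges, M.edgeInt p (fun x => u p.1 x * M.normal p i * φ.fn p.1 x)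
    - l2 u (φ.dx i)

theorem tri_isCompact (j : Fin M.n) : IsCompact (M.tri j) :=
  (finite_range _).isCompact_convexHull ℝ

theorem tri_interior_nonempty (j : Fin M.n) : (interior (M.tri j)).Nonempty := by
  rw [tri, interior_convexHull_nonempty_iff_affineSpan_eq_top]
  exact (M.indep j).affineSpan_eq_top_iff_card_eq_finrank_add_one.2 (by simp)

theorem fn_continuous (v : M.Vh) (j : Fin M.n) : Continuous (v.fn j) :=
  AffineMap.continuous_of_finiteDimensional (v j)

theorem l2_integrableOn {u w : M.Broken} (hu : ∀ j, ContinuousOn (u j) (M.tri j))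
    (hw : ∀ j, ContinuousOn (w j) (M.tri j)) (j : Fin M.n) :
    IntegrableOn (fun x => u j x * w j x) (M.tri j) :=
  ((hu j).mul (hw j)).integrableOn_compact (tri_isCompact j)

theorem l2_add_right {u w w' : M.Broken} (hu : ∀ j, ContinuousOn (u j) (M.tri j))
    (hw : ∀ j, ContinuousOn (w j) (M.tri j)) (hw' : ∀ j, ContinuousOn (w' j) (M.tri j)) :
    l2 u (w + w') = l2 u w + l2 u w' := by
  simp only [l2, ← Finset.sum_add_distrib]
  refine Finset.sum_congr rfl fun j _ => ?_
  rw [← integral_add (l2_integrableOn hu hw j) (l2_integrableOn hu hw' j)]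
  simp [mul_add]

theorem l2_smul_right (c : ℝ) (u w : M.Broken) : l2 u (c • w) = c * l2 u w := by
  simp only [l2, Finset.mul_sum]
  refine Finset.sum_congr rfl fun j _ => ?_
  rw [← integral_const_mul]
  congr 1
  ext x
  simp only [Pi.smul_apply, smul_eq_mul]
  ring

theorem l2_comm (u w : M.Broken) : l2 u w = l2 w u := by
  simp [l2, mul_comm]

theorem fn_add (v w : M.Vh) : Vh.fn (v + w) = v.fn + w.fn := rfl

theorem fn_smul (c : ℝ) (v : M.Vh) : Vh.fn (c • v) = c • v.fn := rfl

/-- The `L²` inner product is positive definite on `V_h`. -/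
theorem eq_zero_of_l2_self {v : M.Vh} (h : l2 v.fn v.fn = 0) : v = 0 := by
  have hnn : ∀ j, 0 ≤ ∫ x in M.tri j, v.fn j x * v.fn j x := fun j =>
    integral_nonneg fun x => mul_self_nonneg _
  funext j
  have h0 : ∫ x in M.tri j, v.fn j x * v.fn j x = 0 :=
    (Finset.sum_eq_zero_iff_of_nonneg fun j _ => hnn j).1 h j (Finset.mem_univ j)
  have hint := l2_integrableOn (fun j => (fn_continuous v j).continuousOn)
    (fun j => (fn_continuous v j).continuousOn) j
  rw [setIntegral_eq_zero_iff_of_nonneg_ae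
    (Filter.Eventually.of_forall fun x => mul_self_nonneg _) hint] at h0
  have h1 : (fun x => v.fn j x) =ᵐ[volume.restrict (interior (M.tri j))] fun _ => 0 := by
    filter_upwards [ae_restrict_of_ae_restrict_of_subset interior_subset h0] with x hx
    simpa using hx
  have h2 : EqOn (fun x => v.fn j x) (fun _ => 0) (interior (M.tri j)) :=
    Measure.eqOn_open_of_ae_eq h1 isOpen_interior (fn_continuous v j).continuousOn
      continuousOn_const
  have h3 : affineSpan ℝ (interior (M.tri j)) = ⊤ :=
    isOpen_interior.affineSpan_eq_top (tri_interior_nonempty j)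
  exact AffineMap.ext_on h3 fun x hx => h2 hx

/-- The `L²` inner product as a bilinear form on `V_h`. -/
noncomputable def l2Form (M : Triangulation Ω) : M.Vh →ₗ[ℝ] M.Vh →ₗ[ℝ] ℝ :=
  have hc : ∀ (v : M.Vh) (j), ContinuousOn (v.fn j) (M.tri j) :=
    fun v j => (fn_continuous v j).continuousOn
  LinearMap.mk₂ ℝ (fun v w => l2 v.fn w.fn)
    (fun u v w => by
      rw [l2_comm, fn_add, l2_add_right (hc w) (hc u) (hc v), l2_comm, l2_comm w.fn])
    (fun c v w => by rw [l2_comm, fn_smul, l2_smul_right, l2_comm, smul_eq_mul])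
    (fun u v w => by rw [fn_add, l2_add_right (hc u) (hc v) (hc w)])
    (fun c v w => by rw [fn_smul, l2_smul_right, smul_eq_mul])

theorem existsUnique_represents (F : M.Vh →ₗ[ℝ] ℝ) :
    ∃! d : M.Vh, ∀ φ : M.Vh, l2 d.fn φ.fn = F φ := by
  have hinj : Function.Injective (l2Form M) := by
    rw [← LinearMap.ker_eq_bot, LinearMap.ker_eq_bot']
    intro v hv
    exact eq_zero_of_l2_self (by simpa [l2Form] using LinearMap.congr_fun hv v)
  have hsurj : Function.Surjective (l2Form M) :=
    (LinearMap.injective_iff_surjective_of_finrank_eq_finrank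
      (Subspace.dual_finrank_eq (K := ℝ) (V := M.Vh)).symm).1 hinj
  obtain ⟨d, hd⟩ := hsurj F
  refine ⟨d, fun φ => by rw [← hd]; rfl, fun e he => hinj ?_⟩
  rw [hd]
  exact LinearMap.ext fun φ => he φ

open Classical in
/-- The element `d` of `V_h` with `(d, φ)_{𝒯_h} = F φ` for all `φ ∈ V_h`. It exists and is unique
for every linear `F`, see `existsUnique_represents`. -/
noncomputable def represent (F : M.Vh → ℝ) : M.Vh :=
  if h : ∃ d : M.Vh, ∀ φ : M.Vh, l2 d.fn φ.fn = F φ then h.choose else 0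

theorem represent_spec (F : M.Vh →ₗ[ℝ] ℝ) (φ : M.Vh) : l2 (represent F).fn φ.fn = F φ := by
  have h := (existsUnique_represents F).exists
  rw [represent, dif_pos h]
  exact h.choose_spec φ

/-- The discrete partial derivatives `∂_{h,x_i}^{±,0}` (with boundary datum `0`). -/
noncomputable def partial₀ (s : Wind) (i : Fin 2) (u : M.Broken) : M.Vh :=
  represent (partialFunctional₀ s i u)

/-- The discrete partial derivatives `∂_{h,x_i}^±`. -/
noncomputable def discPartial (s : Wind) (i : Fin 2) (u : M.Broken) : M.Vh :=
  represent (partialFunctional s i u)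

theorem edgeInt_add {p : M.Side} {f g : Plane → ℝ}
    (hf : ContinuousOn f (segment ℝ (M.pt₁ p) (M.pt₂ p)))
    (hg : ContinuousOn g (segment ℝ (M.pt₁ p) (M.pt₂ p))) :
    M.edgeInt p (fun x => f x + g x) = M.edgeInt p f + M.edgeInt p g := by
  have key : ∀ f : Plane → ℝ, ContinuousOn f (segment ℝ (M.pt₁ p) (M.pt₂ p)) →
      IntervalIntegrable (fun t : ℝ => f (AffineMap.lineMap (M.pt₁ p) (M.pt₂ p) t))
        volume 0 1 := by
    intro f hf
    refine ContinuousOn.intervalIntegrable ?_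
    rw [uIcc_of_le zero_le_one]
    refine hf.comp AffineMap.lineMap_continuous.continuousOn fun t ht => ?_
    rw [segment_eq_image_lineMap]
    exact mem_image_of_mem _ ht
  simp only [edgeInt, segIntegral]
  rw [intervalIntegral.integral_add (key f hf) (key g hg), mul_add]

theorem edgeInt_smul (p : M.Side) (c : ℝ) (f : Plane → ℝ) :
    M.edgeInt p (fun x => c * f x) = c * M.edgeInt p f := by
  simp only [edgeInt, segIntegral]
  rw [intervalIntegral.integral_const_mul]
  ring

theorem segment_subset_tri (p : M.Side) : segment ℝ (M.pt₁ p) (M.pt₂ p) ⊆ M.tri p.1 :=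
  (convex_convexHull ℝ _).segment_subset (subset_convexHull ℝ _ (mem_range_self _))
    (subset_convexHull ℝ _ (mem_range_self _))

theorem segment_subset_tri' {p : M.Side × M.Side} (hp : p ∈ M.intEdges) :
    segment ℝ (M.pt₁ p.1) (M.pt₂ p.1) ⊆ M.tri p.2.1 := by
  have h : M.edge p.1 = M.edge p.2 := (Finset.mem_filter.1 hp).2.2
  rcases Sym2.eq_iff.1 h with ⟨h1, h2⟩ | ⟨h1, h2⟩
  · rw [h1, h2]
    exact segment_subset_tri p.2
  · rw [h1, h2, segment_symm]
    exact segment_subset_tri p.2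

theorem trace_continuousOn {u : M.Broken} (hu : ∀ j, ContinuousOn (u j) (M.tri j)) (s : Wind)
    (i : Fin 2) {p : M.Side × M.Side} (hp : p ∈ M.intEdges) :
    ContinuousOn (trace s i u p) (segment ℝ (M.pt₁ p.1) (M.pt₂ p.1)) := by
  have h1 := (hu p.1.1).mono (segment_subset_tri p.1)
  have h2 := (hu p.2.1).mono (segment_subset_tri' hp)
  have h3 : ContinuousOn (avg u p) (segment ℝ (M.pt₁ p.1) (M.pt₂ p.1)) :=
    (h1.add h2).div_const 2
  cases s <;> unfold trace <;> dsimp only <;> split_ifs <;> assumption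

theorem isLinearMap_sum_edgeInt {ι : Type*} (S : Finset ι) (side : ι → M.Side)
    (g : ι → Plane → ℝ) (L : ι → M.Vh → Plane → ℝ)
    (hg : ∀ p ∈ S, ContinuousOn (g p) (segment ℝ (M.pt₁ (side p)) (M.pt₂ (side p))))
    (hL : ∀ p φ, Continuous (L p φ)) (hadd : ∀ p φ ψ x, L p (φ + ψ) x = L p φ x + L p ψ x)
    (hsmul : ∀ p (c : ℝ) φ x, L p (c • φ) x = c * L p φ x) :
    IsLinearMap ℝ fun φ : M.Vh => ∑ p ∈ S, M.edgeInt (side p) (fun x => g p x * L p φ x) := by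
  constructor
  · intro φ ψ
    rw [← Finset.sum_add_distrib]
    refine Finset.sum_congr rfl fun p hp => ?_
    refine Eq.trans ?_ (edgeInt_add (f := fun x => g p x * L p φ x) (g := fun x => g p x * L p ψ x)
      ((hg p hp).mul (hL p φ).continuousOn) ((hg p hp).mul (hL p ψ).continuousOn))
    simp only [hadd, mul_add]
  · intro c φ
    rw [smul_eq_mul, Finset.mul_sum]
    refine Finset.sum_congr rfl fun p _ => ?_
    rw [← edgeInt_smul]
    simp only [hsmul]
    congr 1
    ext x
    ring

theorem isLinearMap_l2_dx {u : M.Broken} (hu : ∀ j, ContinuousOn (u j) (M.tri j)) (i : Fin 2) :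
    IsLinearMap ℝ fun φ : M.Vh => l2 u (φ.dx i) := by
  constructor
  · intro φ ψ
    exact l2_add_right hu (fun _ => continuousOn_const) (fun _ => continuousOn_const)
  · intro c φ
    exact l2_smul_right c u (φ.dx i)

theorem isLinearMap_jumps {u : M.Broken} (hu : ∀ j, ContinuousOn (u j) (M.tri j)) (s : Wind)
    (i : Fin 2) : IsLinearMap ℝ fun φ : M.Vh => ∑ p ∈ M.intEdges,
      M.edgeInt p.1 (fun x => trace s i u p x * M.normal p.1 i * jump φ.fn p x) := by
  refine isLinearMap_sum_edgeInt M.intEdges (fun p => p.1)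
    (fun p x => trace s i u p x * M.normal p.1 i) (fun p φ => jump φ.fn p)
    (fun p hp => (trace_continuousOn hu s i hp).mul continuousOn_const)
    (fun p φ => (fn_continuous φ _).sub (fn_continuous φ _)) (fun p φ ψ x => ?_)
    (fun p c φ x => ?_)
  · simp only [jump, fn_add, Pi.add_apply]
    ring
  · simp only [jump, fn_smul, Pi.smul_apply, smul_eq_mul]
    ring

/-- The defining relation of `∂_{h,x_i}^{±,0} u`. -/
theorem partial₀_spec {u : M.Broken} (hu : ∀ j, ContinuousOn (u j) (M.tri j)) (s : Wind)
    (i : Fin 2) (φ : M.Vh) : l2 (partial₀ s i u).fn φ.fn = partialFunctional₀ s i u φ :=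
  represent_spec ((isLinearMap_jumps hu s i).mk' _ - (isLinearMap_l2_dx hu i).mk' _) φ

/-- The defining relation of `∂_{h,x_i}^± u`. -/
theorem discPartial_spec {u : M.Broken} (hu : ∀ j, ContinuousOn (u j) (M.tri j)) (s : Wind)
    (i : Fin 2) (φ : M.Vh) : l2 (discPartial s i u).fn φ.fn = partialFunctional s i u φ := by
  have hb : IsLinearMap ℝ fun φ : M.Vh => ∑ p ∈ M.bdryEdges,
      M.edgeInt p (fun x => u p.1 x * M.normal p i * φ.fn p.1 x) :=
    isLinearMap_sum_edgeInt M.bdryEdges id (fun p x => u p.1 x * M.normal p i)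
      (fun p φ => φ.fn p.1)
      (fun p _ => ((hu p.1).mono (segment_subset_tri p)).mul continuousOn_const)
      (fun p φ => fn_continuous φ _) (fun p φ ψ x => rfl) (fun p c φ x => rfl)
  exact represent_spec ((isLinearMap_jumps hu s i).mk' _ + hb.mk' _
    - (isLinearMap_l2_dx hu i).mk' _) φ

/-- The discrete divergences `div_h^±`. -/
noncomputable def discDiv (s : Wind) (u : Fin 2 → M.Broken) : M.Vh :=
  ∑ i, discPartial s i (u i)

/-- The averaged discrete divergence. -/
noncomputable def avgDiv (u : Fin 2 → M.Broken) : M.Vh :=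
  (1 / 2 : ℝ) • (discDiv Wind.plus u + discDiv Wind.minus u)

/-! ### Bilinear forms -/

/-- `(∇_{h,0}^± v, ∇_{h,0}^± w)_{𝒯_h}`. -/
noncomputable def gradForm (s : Wind) (v w : M.Vh) : ℝ :=
  ∑ i, l2 (partial₀ s i v.fn).fn (partial₀ s i w.fn).fn

/-- `⟨(σ_e / h_e) [v], [w]⟩_{ℰ_h}`. -/
noncomputable def penalty (σ : Sym2 Plane → ℝ) (v w : M.Vh) : ℝ :=
  ∑ p ∈ M.intEdges,
      M.edgeInt p.1 (fun x => σ (M.edge p.1) / M.len p.1 * jump v.fn p x * jump w.fn p x)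
    + ∑ p ∈ M.bdryEdges,
      M.edgeInt p (fun x => σ (M.edge p) / M.len p * v.fn p.1 x * w.fn p.1 x)

/-- The diffusive form `a_h^d`. -/
noncomputable def formD (σ : Sym2 Plane → ℝ) (v w : M.Vh) : ℝ :=
  1 / 2 * (gradForm Wind.plus v w + gradForm Wind.minus v w) + penalty σ v w

/-- `∫_{∂Ω⁻} |ζ·n| v w ds`, where `∂Ω⁻` is the part of `∂Ω` on which `ζ·n < 0`. -/
noncomputable def inflow (ζ : Plane → Plane) (v w : M.Vh) : ℝ :=
  ∑ p ∈ M.bdryEdges, M.edgeInt p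
    ({x | inner ℝ (ζ x) (M.normal p) < 0}.indicator
      fun x => |inner ℝ (ζ x) (M.normal p)| * v.fn p.1 x * w.fn p.1 x)

/-- The advection-reaction form `a_h^{ar}`. -/
noncomputable def formAR (ζ : Plane → Plane) (γ : Plane → ℝ) (v w : M.Vh) : ℝ :=
  l2 (avgDiv fun i j x => ζ x i * v.fn j x).fn w.fn
    + l2 (fun j x => (γ x - weakDiv Ω ζ x) * v.fn j x) w.fn
    + inflow ζ v w

/-- `⟨½ |ζ·n| [v], [w]⟩_{ℰ_h^I}`. -/
noncomputable def upwind (ζ : Plane → Plane) (v w : M.Vh) : ℝ :=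
  ∑ p ∈ M.intEdges, M.edgeInt p.1
    (fun x => 1 / 2 * |inner ℝ (ζ x) (M.normal p.1)| * jump v.fn p x * jump w.fn p x)

/-- The upwind form `a_h^{upw}`. -/
noncomputable def formUpw (ζ : Plane → Plane) (γ : Plane → ℝ) (v w : M.Vh) : ℝ :=
  formAR ζ γ v w + upwind ζ v w

/-- The full form `a_h = ε a_h^d + a_h^{upw}`. -/
noncomputable def formA (ε : ℝ) (σ : Sym2 Plane → ℝ) (ζ : Plane → Plane) (γ : Plane → ℝ)
    (v w : M.Vh) : ℝ :=
  ε * formD σ v w + formUpw ζ γ v w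

/-! ### Norms -/

/-- `‖v‖_d²`. -/
noncomputable def normDSq (σ : Sym2 Plane → ℝ) (v : M.Vh) : ℝ :=
  1 / 2 * ((∑ i, l2 (partial₀ Wind.plus i v.fn).fn (partial₀ Wind.plus i v.fn).fn)
      + ∑ i, l2 (partial₀ Wind.minus i v.fn).fn (partial₀ Wind.minus i v.fn).fn)
    + (∑ p ∈ M.intEdges, σ (M.edge p.1) / M.len p.1 * M.edgeInt p.1 (fun x => jump v.fn p x ^ 2)
      + ∑ p ∈ M.bdryEdges, σ (M.edge p) / M.len p * M.edgeInt p (fun x => v.fn p.1 x ^ 2))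

/-- `‖v‖_{ar}² = ‖v‖_{L²(Ω)}² + ∫_{∂Ω} ½ |ζ·n| v² ds`. -/
noncomputable def normARSq (ζ : Plane → Plane) (v : M.Vh) : ℝ :=
  l2 v.fn v.fn + ∑ p ∈ M.bdryEdges, M.edgeInt p
    (fun x => 1 / 2 * |inner ℝ (ζ x) (M.normal p)| * v.fn p.1 x ^ 2)

/-- `‖v‖_{upw}²`. -/
noncomputable def normUpwSq (ζ : Plane → Plane) (v : M.Vh) : ℝ :=
  normARSq ζ v + ∑ p ∈ M.intEdges, M.edgeInt p.1
    (fun x => 1 / 2 * |inner ℝ (ζ x) (M.normal p.1)| * jump v.fn p x ^ 2)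

/-- `‖v‖_h² = ε ‖v‖_d² + ‖v‖_{upw}²`. -/
noncomputable def normHSq (ε : ℝ) (σ : Sym2 Plane → ℝ) (ζ : Plane → Plane) (v : M.Vh) : ℝ :=
  ε * normDSq σ v + normUpwSq ζ v

/-- `‖v‖_{h♯}`, where `‖v‖_{h♯}² = ‖v‖_h² + ∑_T h_T ‖ζ·∇v‖_{L²(T)}²`. -/
noncomputable def normSharp (ε : ℝ) (σ : Sym2 Plane → ℝ) (ζ : Plane → Plane) (v : M.Vh) : ℝ :=
  Real.sqrt (normHSq ε σ ζ v +
    ∑ j, M.diamT j * ∫ x in M.tri j, (∑ i, ζ x i * v.dx i j x) ^ 2)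

end Triangulation

end DWDG

/-! The bound comes from one explicit test function w = v + δz, where z is piecewise constant, equal
on T to h_T (ζ·∇v) with ζ frozen at a vertex. Testing with v itself gives at least ε‖v‖_d² + min(γ₀,
1)‖v‖_upw² (`formD_self`, `le_formUpw_self`), which misses only the streamline term S = Σ h_T
‖ζ·∇v‖². Testing with z restores it: a_h^upw(v, z) ≥ S/2 - C‖v‖_upw². For a small δ depending only
on the data the sum dominates a multiple of ‖v‖_{h♯}², while ‖w‖_{h♯} ≤ C‖v‖_{h♯}.

Upwind part. The two one-sided traces average to {v}, so the averaged divergence is the DG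
divergence with central flux. Elementwise integration by parts leaves (ζ·∇v, w) + (γv, w) and edge
terms that pair jumps of v (traces on inflow edges) with traces of w (`formUpw_eq`). For w = z the
volume term is S up to the error of freezing ζ, which the Lipschitz bound and the inverse inequality
turn into C‖v‖². Young's inequality absorbs the reaction and edge terms. Being constant on
triangles, z has no streamline term of its own.

Diffusive part. The requirement is ‖z‖_d ≤ C‖v‖_d, free of ε and of the mesh size. For piecewise
constants ‖z‖_d² ≤ C Σ z_T², and z_T² ≤ C|T||∇v|² on T, so the broken gradient has to be bounded by
‖v‖_d (`exists_sum_grad_le`). With penalties bounded below this is direct, because the discrete and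
the broken gradient differ by jumps. Without them it rests on having both winds. On T, the
derivative ∂_i^{±,0}v tested with g is ∂_i v ∫g minus jump integrals over the sides that the wind
sees: boundary sides, and interior sides with ±n_i < 0. The barycentric coordinate λ_m vanishes on
side m, and of three interior sides two have n_i of the same weak sign. One of the winds sees
neither, so ∂_i v is a multiple of a moment of a discrete derivative. A boundary side is seen by
both winds; if there is only one, its unknown moment is the same number for i = 1 and i = 2, and the
geometry of the normals eliminates it (`abs_le_of_boundary_moments`).

Foundations. On a convex domain a W^{1,∞} function is Lipschitz, by mollification, and has a
Lipschitz extension whose a.e. derivatives are the weak ones (`exists_lipschitz_extension`). The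
divergence theorem on a triangle is Fubini and the fundamental theorem of calculus along lines. Sums
over sides become sums over edges because, by conformity, a side either lies on ∂Ω or is shared with
exactly one other triangle (`sum_sides`). -/

namespace DWDG

/-! ### Affine coordinates on a triangle and exact integrals -/

/-- The affine basis formed by the vertices of a nondegenerate triangle. -/
noncomputable def triBasis (x : Fin 3 → Plane) (hx : AffineIndependent ℝ x) :
    AffineBasis (Fin 3) ℝ Plane :=
  ⟨x, hx, hx.affineSpan_eq_top_iff_card_eq_finrank_add_one.2 (by simp)⟩

/-- The signed double area of a triangle. -/
noncomputable def crossArea (x : Fin 3 → Plane) : ℝ :=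
  (x 1 - x 0) 0 * (x 2 - x 0) 1 - (x 1 - x 0) 1 * (x 2 - x 0) 0

/-- A vanishing determinant makes the rows of the adjugate matrix linear relations between the two
edge vectors. Independence kills their coefficients, so both edge vectors vanish, which again
contradicts independence. -/
theorem crossArea_ne_zero {x : Fin 3 → Plane} (hx : AffineIndependent ℝ x) : crossArea x ≠ 0 := by
  intro h
  have key : ∀ a b : ℝ, a • (x 1 - x 0) + b • (x 2 - x 0) = 0 → a = 0 ∧ b = 0 := by
    intro a b hab
    have h1 := affineIndependent_iff.1 hx Finset.univ ![-a - b, a, b]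
      (by simp [Fin.sum_univ_three]; ring) (by
        simp only [Fin.sum_univ_three, Matrix.cons_val_zero, Matrix.cons_val_one, Matrix.cons_val]
        rw [← hab]; module)
    exact ⟨h1 1 (by simp), h1 2 (by simp)⟩
  unfold crossArea at h
  have h1 := key ((x 2 - x 0) 1) (-(x 1 - x 0) 1) (by
    ext i
    fin_cases i
    · simp at h ⊢; linarith
    · simp; ring)
  have h2 := key ((x 2 - x 0) 0) (-(x 1 - x 0) 0) (by
    ext i
    fin_cases i
    · simp; ring
    · simp at h ⊢; linarith)
  have h3 := key 1 0 (by
    ext i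
    fin_cases i
    · have := h2.2; simp at this ⊢; linarith
    · have := h1.2; simp at this ⊢; linarith)
  exact one_ne_zero h3.1

/-- The linear map of the plane with columns `x 1 - x 0` and `x 2 - x 0`. -/
noncomputable def edgeMap (x : Fin 3 → Plane) : Plane →ₗ[ℝ] Plane :=
  Matrix.toLin (EuclideanSpace.basisFun (Fin 2) ℝ).toBasis (EuclideanSpace.basisFun (Fin 2) ℝ).toBasis
    !![(x 1 - x 0) 0, (x 2 - x 0) 0; (x 1 - x 0) 1, (x 2 - x 0) 1]

theorem det_edgeMap (x : Fin 3 → Plane) : LinearMap.det (edgeMap x) = crossArea x := by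
  rw [edgeMap, LinearMap.det_toLin, Matrix.det_fin_two_of, crossArea]
  ring

theorem edgeMap_apply (x : Fin 3 → Plane) (s t : ℝ) :
    edgeMap x (!₂[s, t]) = s • (x 1 - x 0) + t • (x 2 - x 0) := by
  ext i
  fin_cases i <;> simp [edgeMap, Matrix.toLin_apply, Matrix.mulVec, dotProduct, Fin.sum_univ_two] <;> ring

/-- The measurable equivalence between `ℝ × ℝ` and the plane. -/
noncomputable def pairEquiv : ℝ × ℝ ≃ᵐ Plane :=
  MeasurableEquiv.finTwoArrow.symm.trans (MeasurableEquiv.toLp 2 (Fin 2 → ℝ))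

theorem measurePreserving_pairEquiv : MeasurePreserving pairEquiv volume volume :=
  (PiLp.volume_preserving_toLp (Fin 2)).comp
    ((volume_preserving_finTwoArrow ℝ).symm MeasurableEquiv.finTwoArrow)

theorem pairEquiv_apply (p : ℝ × ℝ) : pairEquiv p = !₂[p.1, p.2] := rfl

/-- The parametrization of the plane by two barycentric coordinates. -/
noncomputable def triParam (x : Fin 3 → Plane) (p : ℝ × ℝ) : Plane :=
  x 0 + (p.1 • (x 1 - x 0) + p.2 • (x 2 - x 0))

/-- The linear equivalence underlying `edgeMap`. -/
noncomputable def edgeEquiv {x : Fin 3 → Plane} (hx : AffineIndependent ℝ x) : Plane ≃L[ℝ] Plane :=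
  (LinearEquiv.ofIsUnitDet (f := edgeMap x)
    (v := (EuclideanSpace.basisFun (Fin 2) ℝ).toBasis) (v' := (EuclideanSpace.basisFun (Fin 2) ℝ).toBasis)
    (by rw [LinearMap.det_toMatrix, det_edgeMap]
        exact (crossArea_ne_zero hx).isUnit)).toContinuousLinearEquiv

theorem edgeEquiv_apply {x : Fin 3 → Plane} (hx : AffineIndependent ℝ x) (y : Plane) :
    edgeEquiv hx y = edgeMap x y := rfl

theorem triParam_eq {x : Fin 3 → Plane} (hx : AffineIndependent ℝ x) :
    triParam x = fun p => x 0 + edgeEquiv hx (pairEquiv p) := by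
  ext p : 1
  rw [edgeEquiv_apply, pairEquiv_apply, edgeMap_apply, triParam]

theorem measurableEmbedding_triParam {x : Fin 3 → Plane} (hx : AffineIndependent ℝ x) :
    MeasurableEmbedding (triParam x) := by
  rw [triParam_eq hx]
  exact (measurableEmbedding_addLeft (x 0)).comp
    ((edgeEquiv hx).toHomeomorph.measurableEmbedding.comp pairEquiv.measurableEmbedding)

theorem map_triParam {x : Fin 3 → Plane} (hx : AffineIndependent ℝ x) :
    Measure.map (triParam x) volume = ENNReal.ofReal |(crossArea x)⁻¹| • volume := by
  have h1 : Measure.map (edgeMap x) (volume : Measure Plane) =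
      ENNReal.ofReal |(crossArea x)⁻¹| • volume := by
    rw [← det_edgeMap]
    exact Measure.map_linearMap_addHaar_eq_smul_addHaar _ (by
      rw [det_edgeMap]; exact crossArea_ne_zero hx)
  have h2 : triParam x = (fun y => x 0 + y) ∘ (edgeMap x) ∘ pairEquiv := triParam_eq hx
  have h3 : Measurable (edgeMap x) := (edgeEquiv hx).continuous.measurable
  rw [h2, ← Measure.map_map (measurable_const_add _) (h3.comp pairEquiv.measurable),
    ← Measure.map_map h3 pairEquiv.measurable, measurePreserving_pairEquiv.map_eq, h1,
    Measure.map_smul, (measurePreserving_add_left volume (x 0)).map_eq]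

theorem integral_comp_triParam {x : Fin 3 → Plane} (hx : AffineIndependent ℝ x) (F : Plane → ℝ) :
    |crossArea x| * ∫ p : ℝ × ℝ, F (triParam x p) = ∫ y, F y := by
  have h := (measurableEmbedding_triParam hx).integral_map (μ := volume) F
  rw [← h, map_triParam hx, integral_smul_measure, ENNReal.toReal_ofReal (abs_nonneg _), abs_inv,
    smul_eq_mul, ← mul_assoc, mul_inv_cancel₀ (abs_ne_zero.2 (crossArea_ne_zero hx)), one_mul]

theorem integrable_comp_triParam {x : Fin 3 → Plane} (hx : AffineIndependent ℝ x) {F : Plane → ℝ}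
    (hF : Integrable F) : Integrable fun p => F (triParam x p) := by
  have h := (measurableEmbedding_triParam hx).integrable_map_iff (μ := volume) (g := F)
  rw [map_triParam hx] at h
  exact h.1 (hF.smul_measure ENNReal.ofReal_ne_top)

theorem triParam_mem_iff {x : Fin 3 → Plane} (hx : AffineIndependent ℝ x) (s t : ℝ) :
    triParam x (s, t) ∈ convexHull ℝ (range x) ↔ 0 ≤ s ∧ 0 ≤ t ∧ t ≤ 1 - s := by
  have h0 : triParam x (s, t) = Finset.affineCombination ℝ Finset.univ (triBasis x hx)
      ![1 - s - t, s, t] := by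
    rw [Finset.affineCombination_eq_linear_combination _ _ _ (by
      simp [Fin.sum_univ_three]; ring)]
    simp only [Fin.sum_univ_three, Matrix.cons_val_zero, Matrix.cons_val_one, Matrix.cons_val]
    change triParam x (s, t) = (1 - s - t) • x 0 + s • x 1 + t • x 2
    simp only [triParam]
    module
  have h1 : ∀ k, (triBasis x hx).coord k (triParam x (s, t)) = ![1 - s - t, s, t] k := fun k => by
    rw [h0]
    exact AffineBasis.coord_apply_combination_of_mem _ (Finset.mem_univ k)
      (by simp [Fin.sum_univ_three]; ring)
  have h2 := (triBasis x hx).convexHull_eq_nonneg_coord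
  change convexHull ℝ (range x) = _ at h2
  rw [h2, mem_ofPred_eq, Fin.forall_fin_succ, Fin.forall_fin_two]
  change 0 ≤ _ ∧ 0 ≤ (triBasis x hx).coord 1 _ ∧ 0 ≤ (triBasis x hx).coord 2 _ ↔ _
  rw [h1, h1, h1]
  simp only [Matrix.cons_val_zero, Matrix.cons_val_one, Matrix.cons_val]
  constructor
  · rintro ⟨h1, h2, h3⟩; exact ⟨h2, h3, by linarith⟩
  · rintro ⟨h1, h2, h3⟩; exact ⟨by linarith, h1, h2⟩

theorem measurableSet_convexHull_range (x : Fin 3 → Plane) :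
    MeasurableSet (convexHull ℝ (range x)) :=
  ((finite_range x).isCompact_convexHull ℝ).isClosed.measurableSet

/-- Integrals over triangles as iterated integrals. -/
theorem setIntegral_triangle {x : Fin 3 → Plane} (hx : AffineIndependent ℝ x) {F : Plane → ℝ}
    (hF : IntegrableOn F (convexHull ℝ (range x))) :
    ∫ y in convexHull ℝ (range x), F y =
      |crossArea x| * ∫ s in (0 : ℝ)..1, ∫ t in (0 : ℝ)..(1 - s), F (triParam x (s, t)) := by
  have hm := measurableSet_convexHull_range x
  rw [← integral_indicator hm, ← integral_comp_triParam hx, Measure.volume_eq_prod, integral_prod _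
    (integrable_comp_triParam hx ((integrable_indicator_iff hm).2 hF))]
  congr 1
  rw [intervalIntegral.integral_of_le zero_le_one, ← integral_Icc_eq_integral_Ioc,
    ← integral_indicator measurableSet_Icc]
  congr 1
  ext s
  by_cases hs : s ∈ Icc (0 : ℝ) 1
  · rw [indicator_of_mem hs, intervalIntegral.integral_of_le (by linarith [hs.2]),
      ← integral_Icc_eq_integral_Ioc, ← integral_indicator measurableSet_Icc]
    congr 1
    ext t
    by_cases ht : t ∈ Icc 0 (1 - s)
    · rw [indicator_of_mem ht, indicator_of_mem ((triParam_mem_iff hx s t).2 ⟨hs.1, ht.1, ht.2⟩)]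
    · rw [indicator_of_notMem ht, indicator_of_notMem fun h => ht
        ((triParam_mem_iff hx s t).1 h).2]
  · rw [indicator_of_notMem hs]
    refine (integral_congr_ae (Filter.Eventually.of_forall fun t => ?_)).trans (integral_zero _ _)
    refine indicator_of_notMem (fun h => hs ?_) _
    obtain ⟨h1, h2, h3⟩ := (triParam_mem_iff hx s t).1 h
    exact ⟨h1, by linarith⟩

theorem affine_triParam (v : Plane →ᵃ[ℝ] ℝ) (x : Fin 3 → Plane) (s t : ℝ) :
    v (triParam x (s, t)) = v (x 0) + (s * (v (x 1) - v (x 0)) + t * (v (x 2) - v (x 0))) := by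
  have h : triParam x (s, t) = (s • (x 1 - x 0) + t • (x 2 - x 0)) +ᵥ x 0 := by
    simp only [triParam, vadd_eq_add]; abel
  have h1 : ∀ k, v.linear (x k - x 0) = v (x k) - v (x 0) := fun k => by
    rw [← vsub_eq_sub, AffineMap.linearMap_vsub]; rfl
  rw [h, AffineMap.map_vadd, map_add, map_smul, map_smul, h1, h1, vadd_eq_add, smul_eq_mul,
    smul_eq_mul, add_comm]

theorem continuous_affine (v : Plane →ᵃ[ℝ] ℝ) : Continuous v :=
  AffineMap.continuous_of_finiteDimensional v

theorem isCompact_triangle (x : Fin 3 → Plane) : IsCompact (convexHull ℝ (range x)) :=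
  (finite_range x).isCompact_convexHull ℝ

theorem integral_cubic (a b c d r : ℝ) :
    ∫ t in (0 : ℝ)..r, (a + b * t + c * t ^ 2 + d * t ^ 3) =
      a * r + b * r ^ 2 / 2 + c * r ^ 3 / 3 + d * r ^ 4 / 4 := by
  have h := intervalIntegral.integral_eq_sub_of_hasDerivAt (a := 0) (b := r)
    (f := fun t => a * t + b / 2 * t ^ 2 + c / 3 * t ^ 3 + d / 4 * t ^ 4)
    (f' := fun t => a + b * t + c * t ^ 2 + d * t ^ 3) (fun t _ => by
      refine (((((hasDerivAt_id' t).const_mul a).fun_add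
        (((hasDerivAt_id' t).fun_pow 2).const_mul (b / 2))).fun_add
        (((hasDerivAt_id' t).fun_pow 3).const_mul (c / 3))).fun_add
        (((hasDerivAt_id' t).fun_pow 4).const_mul (d / 4))).congr_deriv ?_
      norm_num
      ring) ((by fun_prop : Continuous _).intervalIntegrable _ _)
  rw [h]
  ring

/-- This is the P₁ mass matrix: the weight is one twelfth of the area. Both iterated integrals are
polynomial, of degree at most three in the variable of integration. -/
theorem integral_affine_sq_triangle {x : Fin 3 → Plane} (hx : AffineIndependent ℝ x)
    (v : Plane →ᵃ[ℝ] ℝ) :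
    ∫ y in convexHull ℝ (range x), v y ^ 2 =
      |crossArea x| / 24 * (v (x 0) ^ 2 + v (x 1) ^ 2 + v (x 2) ^ 2
        + (v (x 0) + v (x 1) + v (x 2)) ^ 2) := by
  rw [setIntegral_triangle hx (F := fun y => v y ^ 2)
    (((continuous_affine v).pow 2).continuousOn.integrableOn_compact (isCompact_triangle x))]
  simp only [affine_triParam]
  obtain ⟨a, ha⟩ : ∃ a, v (x 0) = a := ⟨_, rfl⟩
  obtain ⟨b, hb⟩ : ∃ b, v (x 1) = a + b := ⟨v (x 1) - a, by ring⟩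
  obtain ⟨c, hc⟩ : ∃ c, v (x 2) = a + c := ⟨v (x 2) - a, by ring⟩
  have h1 : ∀ s : ℝ, ∫ t in (0 : ℝ)..(1 - s), (a + (s * b + t * c)) ^ 2 =
      (a + b * s) ^ 2 * (1 - s) + (a + b * s) * c * (1 - s) ^ 2 + c ^ 2 * (1 - s) ^ 3 / 3 := by
    intro s
    have h := integral_cubic ((a + b * s) ^ 2) (2 * (a + b * s) * c) (c ^ 2) 0 (1 - s)
    rw [show (a + b * s) ^ 2 * (1 - s) + (a + b * s) * c * (1 - s) ^ 2 + c ^ 2 * (1 - s) ^ 3 / 3 =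
      (a + b * s) ^ 2 * (1 - s) + 2 * (a + b * s) * c * (1 - s) ^ 2 / 2 + c ^ 2 * (1 - s) ^ 3 / 3
        + 0 * (1 - s) ^ 4 / 4 by ring, ← h]
    congr 1
    ext t
    ring
  have h2 : ∫ s in (0 : ℝ)..1, ((a + b * s) ^ 2 * (1 - s) + (a + b * s) * c * (1 - s) ^ 2
      + c ^ 2 * (1 - s) ^ 3 / 3) = a ^ 2 / 2 + a * b / 3 + b ^ 2 / 12 + a * c / 3 + b * c / 12
        + c ^ 2 / 12 := by
    have h := integral_cubic (a ^ 2 + a * c + c ^ 2 / 3)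
      (2 * a * b - a ^ 2 + b * c - 2 * a * c - c ^ 2)
      (b ^ 2 - 2 * a * b + a * c - 2 * b * c + c ^ 2) (b * c - b ^ 2 - c ^ 2 / 3) 1
    rw [show a ^ 2 / 2 + a * b / 3 + b ^ 2 / 12 + a * c / 3 + b * c / 12 + c ^ 2 / 12 =
      (a ^ 2 + a * c + c ^ 2 / 3) * 1 + (2 * a * b - a ^ 2 + b * c - 2 * a * c - c ^ 2) * 1 ^ 2 / 2
      + (b ^ 2 - 2 * a * b + a * c - 2 * b * c + c ^ 2) * 1 ^ 3 / 3
      + (b * c - b ^ 2 - c ^ 2 / 3) * 1 ^ 4 / 4 by ring, ← h]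
    congr 1
    ext t
    ring
  simp only [ha, hb, hc, add_sub_cancel_left, h1, h2]
  ring

/-- Polarization of the quadratic formula: v = ((v + 1)² - (v - 1)²) / 4. -/
theorem integral_affine_triangle {x : Fin 3 → Plane} (hx : AffineIndependent ℝ x)
    (v : Plane →ᵃ[ℝ] ℝ) :
    ∫ y in convexHull ℝ (range x), v y =
      |crossArea x| / 6 * (v (x 0) + v (x 1) + v (x 2)) := by
  have h1 := integral_affine_sq_triangle hx (v + AffineMap.const ℝ Plane (1 : ℝ))
  have h2 := integral_affine_sq_triangle hx (v - AffineMap.const ℝ Plane (1 : ℝ))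
  have h3 := integral_sub (μ := volume.restrict (convexHull ℝ (range x)))
    (((continuous_affine (v + AffineMap.const ℝ Plane (1 : ℝ))).pow 2).continuousOn.integrableOn_compact
      (isCompact_triangle x))
    (((continuous_affine (v - AffineMap.const ℝ Plane (1 : ℝ))).pow 2).continuousOn.integrableOn_compact
      (isCompact_triangle x))
  simp only [Pi.pow_apply] at h3
  rw [h1, h2] at h3
  have h4 : ∀ y, v y = 1 / 4 * ((v + AffineMap.const ℝ Plane (1 : ℝ)) y ^ 2 -
      (v - AffineMap.const ℝ Plane (1 : ℝ)) y ^ 2) := fun y => by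
    simp only [AffineMap.coe_add, AffineMap.coe_sub, Pi.add_apply, Pi.sub_apply,
      AffineMap.const_apply]
    ring
  rw [funext h4, integral_const_mul, h3]
  simp only [AffineMap.coe_add, AffineMap.coe_sub, Pi.add_apply, Pi.sub_apply,
      AffineMap.const_apply]
  ring

theorem volume_real_triangle {x : Fin 3 → Plane} (hx : AffineIndependent ℝ x) :
    volume.real (convexHull ℝ (range x)) = |crossArea x| / 2 := by
  have h := integral_affine_triangle hx (AffineMap.const ℝ Plane (1 : ℝ))
  simp only [AffineMap.const_apply, integral_const, measureReal_restrict_apply_univ, smul_eq_mul,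
    mul_one] at h
  rw [h]
  ring

/-! ### The divergence theorem on a triangle for Lipschitz functions -/

/-- The mean of `F` over the edge of a triangle opposite to the vertex `x k`. -/
noncomputable def edgeMean (x : Fin 3 → Plane) (k : Fin 3) (F : Plane → ℝ) : ℝ :=
  ∫ t in (0 : ℝ)..1, F (AffineMap.lineMap (x (k + 1)) (x (k + 2)) t)

theorem integrableOn_fderiv_apply {K : NNReal} {F : Plane → ℝ} (hF : LipschitzWith K F) (a : Plane)
    {s : Set Plane} (hs : IsCompact s) : IntegrableOn (fun y => fderiv ℝ F y a) s := by
  refine Measure.integrableOn_of_bounded (M := K * ‖a‖) hs.measure_lt_top.ne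
    (measurable_fderiv_apply_const ℝ F a).aestronglyMeasurable ?_
  refine Filter.Eventually.of_forall fun y => ?_
  exact ((fderiv ℝ F y).le_opNorm a).trans
    (mul_le_mul_of_nonneg_right (norm_fderiv_le_of_lipschitz ℝ hF) (norm_nonneg a))

theorem ae_fderiv_apply_eq_lineDeriv {K : NNReal} {F : Plane → ℝ} (hF : LipschitzWith K F)
    (a : Plane) : (fun y => fderiv ℝ F y a) =ᵐ[volume] fun y => lineDeriv ℝ F y a := by
  filter_upwards [hF.ae_differentiableAt] with y hy
  exact hy.lineDeriv_eq_fderiv.symm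

/-- Along a line a Lipschitz function is absolutely continuous, so the fundamental theorem of
calculus holds although the derivative exists only almost everywhere. -/
theorem integral_lineDeriv_segment {K : NNReal} {F : Plane → ℝ} (hF : LipschitzWith K F)
    (p a : Plane) (r : ℝ) :
    ∫ t in (0 : ℝ)..r, lineDeriv ℝ F (p + t • a) a = F (p + r • a) - F p := by
  have h1 : ∀ t : ℝ, lineDeriv ℝ F (p + t • a) a = deriv (fun t : ℝ => F (p + t • a)) t := by
    intro t
    have h := deriv_comp_const_add (fun t : ℝ => F (p + t • a)) t 0
    rw [add_zero] at h
    rw [← h, lineDeriv]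
    simp only [add_smul, add_assoc]
  have h2 : LipschitzWith (K * ‖a‖₊) fun t : ℝ => F (p + t • a) := by
    refine hF.comp (LipschitzWith.of_dist_le_mul fun s t => ?_)
    rw [dist_add_left, dist_eq_norm, ← sub_smul, norm_smul, mul_comm, dist_eq_norm]
    rfl
  simp only [h1]
  rw [AbsolutelyContinuousOnInterval.integral_deriv_eq_sub
    h2.lipschitzOnWith.absolutelyContinuousOnInterval]
  simp

/-- Fubini with inner integration parallel to the edge from vertex 0 to vertex 2. The line with
parameter s enters through the edge opposite to vertex 2, at parameter s, and leaves through the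
edge opposite to vertex 0, at parameter 1 - s. The inner integral is thus a difference of two edge
values, and integration in s produces the edge means. -/
theorem integral_fderiv_edge {x : Fin 3 → Plane} (hx : AffineIndependent ℝ x) {K : NNReal}
    {F : Plane → ℝ} (hF : LipschitzWith K F) :
    ∫ y in convexHull ℝ (range x), fderiv ℝ F y (x 2 - x 0) =
      |crossArea x| * (edgeMean x 0 F - edgeMean x 2 F) := by
  have hae := ae_fderiv_apply_eq_lineDeriv hF (x 2 - x 0)
  rw [setIntegral_congr_ae (measurableSet_convexHull_range x) (hae.mono fun y h _ => h),
    setIntegral_triangle hx ((integrableOn_fderiv_apply hF _ (isCompact_triangle x)).congr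
      (ae_restrict_of_ae hae))]
  congr 1
  have h1 : ∀ s : ℝ, ∫ t in (0 : ℝ)..(1 - s), lineDeriv ℝ F (triParam x (s, t)) (x 2 - x 0) =
      F (AffineMap.lineMap (x 1) (x 2) (1 - s)) - F (AffineMap.lineMap (x 0) (x 1) s) := by
    intro s
    have h2 : ∀ t : ℝ, triParam x (s, t) = x 0 + s • (x 1 - x 0) + t • (x 2 - x 0) := fun t => by
      simp only [triParam, add_assoc]
    simp only [h2, integral_lineDeriv_segment hF]
    rw [AffineMap.lineMap_apply_module', AffineMap.lineMap_apply_module']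
    congr 2
    · module
    · module
  simp only [h1]
  have hc : ∀ k l, Continuous fun s : ℝ => F (AffineMap.lineMap (x k) (x l) s) := fun k l =>
    hF.continuous.comp AffineMap.lineMap_continuous
  rw [intervalIntegral.integral_sub
    ((Continuous.comp' (hc 1 2) (by fun_prop : Continuous fun s : ℝ => 1 - s)).intervalIntegrable _ _)
    ((hc 0 1).intervalIntegrable _ _),
    intervalIntegral.integral_comp_sub_left
      (fun s => F (AffineMap.lineMap (x 1) (x 2) s)) 1, sub_self, sub_zero]
  rfl

theorem integral_lineMap_symm (a b : Plane) (F : Plane → ℝ) :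
    ∫ t in (0 : ℝ)..1, F (AffineMap.lineMap a b t) = ∫ t in (0 : ℝ)..1, F (AffineMap.lineMap b a t) := by
  have h := intervalIntegral.integral_comp_sub_left (a := 0) (b := 1)
    (fun s => F (AffineMap.lineMap b a s)) 1
  rw [sub_self, sub_zero] at h
  rw [← h]
  simp only [AffineMap.lineMap_apply_one_sub]

/-- Exchanging the vertices 1 and 2 reverses the parametrization of the edges and flips the sign of
the area; neither affects the means or |`crossArea`|. -/
theorem integral_fderiv_edge' {x : Fin 3 → Plane} (hx : AffineIndependent ℝ x) {K : NNReal}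
    {F : Plane → ℝ} (hF : LipschitzWith K F) :
    ∫ y in convexHull ℝ (range x), fderiv ℝ F y (x 1 - x 0) =
      |crossArea x| * (edgeMean x 0 F - edgeMean x 1 F) := by
  have h := integral_fderiv_edge (x := x ∘ Equiv.swap 1 2)
    (hx.comp_embedding (Equiv.swap 1 2).toEmbedding) hF
  rw [(Equiv.swap (1 : Fin 3) 2).surjective.range_comp] at h
  have e0 : (x ∘ Equiv.swap 1 2) 0 = x 0 := rfl
  have e1 : (x ∘ Equiv.swap 1 2) 1 = x 2 := rfl
  have e2 : (x ∘ Equiv.swap 1 2) 2 = x 1 := rfl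
  have e3 : |crossArea (x ∘ Equiv.swap 1 2)| = |crossArea x| := by
    rw [← abs_neg]
    congr 1
    simp only [crossArea, e0, e1, e2]
    ring
  rw [e0, e2, e3] at h
  rw [h]
  congr 2
  · exact integral_lineMap_symm _ _ _
  · exact integral_lineMap_symm _ _ _

/-- The divergence theorem on a triangle, for Lipschitz functions. -/
theorem integral_fderiv_triangle {x : Fin 3 → Plane} (hx : AffineIndependent ℝ x) {K : NNReal}
    {F : Plane → ℝ} (hF : LipschitzWith K F) (a : Plane) :
    ∫ y in convexHull ℝ (range x), fderiv ℝ F y a =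
      - |crossArea x| * ∑ k, ((triBasis x hx).coord k).linear a * edgeMean x k F := by
  have hl : ∀ k i j, ((triBasis x hx).coord k).linear (x i - x j) =
      (if k = i then 1 else 0) - (if k = j then 1 else 0) := fun k i j => by
    rw [← (triBasis x hx).coord_apply, ← (triBasis x hx).coord_apply, ← vsub_eq_sub,
      AffineMap.linearMap_vsub]
    rfl
  -- Both sides are linear in a, and the two edge vectors at vertex 0 span the plane, so the two
  -- edge directions suffice.
  obtain ⟨s, t, ha⟩ : ∃ s t : ℝ, a = s • (x 1 - x 0) + t • (x 2 - x 0) := by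
    obtain ⟨y, rfl⟩ := (edgeEquiv hx).surjective a
    exact ⟨y 0, y 1, by rw [edgeEquiv_apply, ← edgeMap_apply]; congr 1; ext i; fin_cases i <;> rfl⟩
  have hi := fun a => integrableOn_fderiv_apply hF a (isCompact_triangle x)
  rw [ha]
  simp only [map_add, map_smul]
  rw [integral_add (f := fun y => s • fderiv ℝ F y (x 1 - x 0))
      (g := fun y => t • fderiv ℝ F y (x 2 - x 0)) ((hi _).smul s) ((hi _).smul t), integral_smul, integral_smul,
    integral_fderiv_edge hx hF, integral_fderiv_edge' hx hF]
  simp only [Fin.sum_univ_three, hl, smul_eq_mul]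
  simp
  ring

/-! ### Gradients of barycentric coordinates and edge normals -/

section Gradient

variable {x : Fin 3 → Plane} (hx : AffineIndependent ℝ x)

/-- The gradient of the barycentric coordinate number `k` of a triangle. -/
noncomputable def baryGrad (k : Fin 3) : Plane :=
  !₂[((triBasis x hx).coord k).linear (unitVec 0), ((triBasis x hx).coord k).linear (unitVec 1)]

theorem baryGrad_apply (k : Fin 3) (i : Fin 2) :
    baryGrad hx k i = ((triBasis x hx).coord k).linear (unitVec i) := by
  fin_cases i <;> rfl

theorem linear_eq_sum (L : Plane →ₗ[ℝ] ℝ) (y : Plane) : L y = ∑ i, y i * L (unitVec i) := by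
  have h : y = ∑ i, y i • unitVec i := by
    ext j; fin_cases j <;> simp [Fin.sum_univ_two]
  conv_lhs => rw [h]
  simp

theorem inner_baryGrad (k : Fin 3) (y : Plane) :
    inner ℝ (baryGrad hx k) y = ((triBasis x hx).coord k).linear y := by
  rw [linear_eq_sum, PiLp.inner_apply]
  simp [baryGrad_apply]

theorem inner_baryGrad_sub (k : Fin 3) (y z : Plane) :
    inner ℝ (baryGrad hx k) (y - z) = (triBasis x hx).coord k y - (triBasis x hx).coord k z := by
  rw [inner_baryGrad, ← vsub_eq_sub, AffineMap.linearMap_vsub, vsub_eq_sub]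

theorem coord_vertex (k i : Fin 3) : (triBasis x hx).coord k (x i) = if k = i then 1 else 0 :=
  (triBasis x hx).coord_apply k i

theorem crossArea_rotate (x : Fin 3 → Plane) (k : Fin 3) :
    crossArea x = (x (k + 1) - x k) 0 * (x (k + 2) - x (k + 1)) 1
      - (x (k + 1) - x k) 1 * (x (k + 2) - x (k + 1)) 0 := by
  fin_cases k <;> simp [crossArea] <;> ring

theorem normSq_plane (y : Plane) : ‖y‖ ^ 2 = y 0 ^ 2 + y 1 ^ 2 := by
  rw [EuclideanSpace.norm_sq_eq, Fin.sum_univ_two]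
  simp

theorem inner_plane (y z : Plane) : inner ℝ y z = y 0 * z 0 + y 1 * z 1 := by
  rw [PiLp.inner_apply, Fin.sum_univ_two]
  simp [mul_comm]

/-- The gradient is orthogonal to the edge on which the coordinate vanishes and has product -1 with
the vector from the apex to that edge. Cramer's rule solves these two equations. -/
theorem crossArea_mul_baryGrad (k : Fin 3) :
    crossArea x * baryGrad hx k 0 = - (x (k + 2) - x (k + 1)) 1 ∧
      crossArea x * baryGrad hx k 1 = (x (k + 2) - x (k + 1)) 0 := by
  have hk : k ≠ k + 1 ∧ k ≠ k + 2 := by fin_cases k <;> decide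
  have hgt : inner ℝ (baryGrad hx k) (x (k + 2) - x (k + 1)) = 0 := by
    rw [inner_baryGrad_sub, coord_vertex, coord_vertex, if_neg hk.1, if_neg hk.2, sub_zero]
  have hgd : inner ℝ (baryGrad hx k) (x (k + 1) - x k) = -1 := by
    rw [inner_baryGrad_sub, coord_vertex, coord_vertex, if_neg hk.1, if_pos rfl, zero_sub]
  rw [inner_plane] at hgt hgd
  rw [crossArea_rotate x k]
  constructor
  · linear_combination (-(x (k + 1) - x k) 1) * hgt + (x (k + 2) - x (k + 1)) 1 * hgd
  · linear_combination (x (k + 1) - x k) 0 * hgt - (x (k + 2) - x (k + 1)) 0 * hgd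

/-- The length times the outer normal of an edge, in terms of the barycentric coordinates. -/
theorem length_smul_normal (k : Fin 3) :
    let t : Plane := x (k + 2) - x (k + 1)
    let d : Plane := x (k + 1) - x k
    let m : Plane := d - (inner ℝ t d / ‖t‖ ^ 2) • t
    ‖m‖ ≠ 0 ∧ ‖t‖ • ‖m‖⁻¹ • m = - |crossArea x| • baryGrad hx k := by
  intro t d m
  have hk : k ≠ k + 1 ∧ k ≠ k + 2 ∧ k + 1 ≠ k + 2 := by fin_cases k <;> decide
  have ht : t ≠ 0 := sub_ne_zero.2 fun h => hk.2.2 (hx.injective h.symm)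
  have ht' : 0 < ‖t‖ ^ 2 := by positivity
  have hc : crossArea x = d 0 * t 1 - d 1 * t 0 := crossArea_rotate x k
  have hc0 := crossArea_ne_zero hx
  have hm0 : ‖t‖ ^ 2 * m 0 = crossArea x * t 1 := by
    have : m 0 = d 0 - inner ℝ t d / ‖t‖ ^ 2 * t 0 := rfl
    rw [this, mul_sub, ← mul_assoc, mul_div_cancel₀ _ ht'.ne', normSq_plane, inner_plane, hc]
    ring
  have hm1 : ‖t‖ ^ 2 * m 1 = - crossArea x * t 0 := by
    have : m 1 = d 1 - inner ℝ t d / ‖t‖ ^ 2 * t 1 := rfl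
    rw [this, mul_sub, ← mul_assoc, mul_div_cancel₀ _ ht'.ne', normSq_plane, inner_plane, hc]
    ring
  -- The vector m is the height over the edge t, so the product of the lengths is twice the area.
  have hmt : ‖t‖ * ‖m‖ = |crossArea x| := by
    rw [← sq_eq_sq₀ (by positivity) (abs_nonneg _), sq_abs, mul_pow]
    have : ‖t‖ ^ 2 * (‖t‖ ^ 2 * ‖m‖ ^ 2) = ‖t‖ ^ 2 * crossArea x ^ 2 := by
      rw [normSq_plane m]
      calc _ = (‖t‖ ^ 2 * m 0) ^ 2 + (‖t‖ ^ 2 * m 1) ^ 2 := by ring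
        _ = _ := by rw [hm0, hm1, normSq_plane t]; ring
    exact mul_left_cancel₀ ht'.ne' this
  have hmne : ‖m‖ ≠ 0 := fun h => by
    rw [h, mul_zero] at hmt
    exact hc0 (abs_eq_zero.1 hmt.symm)
  refine ⟨hmne, ?_⟩
  obtain ⟨hg0, hg1⟩ : crossArea x * baryGrad hx k 0 = - t 1 ∧ crossArea x * baryGrad hx k 1 = t 0 :=
    crossArea_mul_baryGrad hx k
  have key : ‖t‖ ^ 2 • m = - (crossArea x ^ 2) • baryGrad hx k := by
    ext i
    fin_cases i
    · change ‖t‖ ^ 2 * m 0 = - (crossArea x ^ 2) * baryGrad hx k 0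
      linear_combination hm0 + crossArea x * hg0
    · change ‖t‖ ^ 2 * m 1 = - (crossArea x ^ 2) * baryGrad hx k 1
      linear_combination hm1 + crossArea x * hg1
  have hne : ‖t‖ * ‖m‖ ≠ 0 := mul_ne_zero (norm_ne_zero_iff.2 ht) hmne
  have h1 : (‖t‖ * ‖m‖) • (‖t‖ • ‖m‖⁻¹ • m) = ‖t‖ ^ 2 • m := by
    rw [smul_smul, smul_smul]
    congr 1
    field_simp
  have h2 : (‖t‖ * ‖m‖) • (- |crossArea x| • baryGrad hx k) = ‖t‖ ^ 2 • m := by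
    rw [key, hmt, smul_smul]
    congr 1
    rw [mul_neg, abs_mul_abs_self, sq]
  exact smul_right_injective Plane hne (h1.trans h2.symm)

theorem baryGrad_ne_zero (k : Fin 3) : baryGrad hx k ≠ 0 := fun h => by
  have hk : k ≠ k + 1 := by fin_cases k <;> decide
  have := inner_baryGrad_sub hx k (x k) (x (k + 1))
  rw [coord_vertex, coord_vertex, if_neg hk, if_pos rfl, h, inner_zero_left] at this
  norm_num at this

theorem sum_baryGrad : ∑ k, baryGrad hx k = 0 := by
  have h : ∀ y z : Plane, inner ℝ (∑ k, baryGrad hx k) (y - z) = 0 := fun y z => by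
    rw [sum_inner]
    simp only [inner_baryGrad_sub, Finset.sum_sub_distrib]
    rw [AffineBasis.sum_coord_apply_eq_one, AffineBasis.sum_coord_apply_eq_one, sub_self]
  have h0 := h (∑ k, baryGrad hx k) 0
  rw [sub_zero] at h0
  exact inner_self_eq_zero.1 h0

theorem coord_mem_Icc {y : Plane} (hy : y ∈ convexHull ℝ (range x)) (k : Fin 3) :
    (triBasis x hx).coord k y ∈ Icc (0 : ℝ) 1 := by
  have h2 := (triBasis x hx).convexHull_eq_nonneg_coord
  change convexHull ℝ (range x) = _ at h2
  rw [h2] at hy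
  refine ⟨hy k, ?_⟩
  rw [← (triBasis x hx).sum_coord_apply_eq_one y]
  exact Finset.single_le_sum (fun k _ => hy k) (Finset.mem_univ k)

/-- Along the diameter of the disc in the direction of the gradient the coordinate grows by the
length of the gradient times 2r, yet it stays in [0, 1]. -/
theorem norm_baryGrad_mul_le {c : Plane} {r : ℝ} (hr : 0 ≤ r)
    (h : Metric.closedBall c r ⊆ convexHull ℝ (range x)) (k : Fin 3) :
    ‖baryGrad hx k‖ * (2 * r) ≤ 1 := by
  set g := baryGrad hx k
  have hg : 0 < ‖g‖ := norm_pos_iff.2 (baryGrad_ne_zero hx k)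
  have hn : ‖(r / ‖g‖) • g‖ = r := by
    rw [norm_smul, Real.norm_of_nonneg (by positivity), div_mul_cancel₀ _ hg.ne']
  have h1 : c + (r / ‖g‖) • g ∈ Metric.closedBall c r := by
    simp [Metric.mem_closedBall, hn]
  have h2 : c - (r / ‖g‖) • g ∈ Metric.closedBall c r := by
    simp [Metric.mem_closedBall, hn]
  have h3 := inner_baryGrad_sub hx k (c + (r / ‖g‖) • g) (c - (r / ‖g‖) • g)
  have h4 : c + (r / ‖g‖) • g - (c - (r / ‖g‖) • g) = (2 * (r / ‖g‖)) • g := by module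
  rw [h4, inner_smul_right, real_inner_self_eq_norm_sq] at h3
  have h5 := (coord_mem_Icc hx (h h1) k).2
  have h6 := (coord_mem_Icc hx (h h2) k).1
  have h7 : 2 * (r / ‖g‖) * ‖g‖ ^ 2 = ‖g‖ * (2 * r) := by field_simp
  linarith

theorem affine_eq_sum_coord (v : Plane →ᵃ[ℝ] ℝ) (y : Plane) :
    v y = ∑ k, (triBasis x hx).coord k y * v (x k) := by
  have h := (triBasis x hx).linear_combination_coord_eq_self y
  have h2 : y = Finset.affineCombination ℝ Finset.univ (triBasis x hx)
      fun k => (triBasis x hx).coord k y := by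
    rw [Finset.affineCombination_eq_linear_combination _ _ _
      ((triBasis x hx).sum_coord_apply_eq_one y), h]
  conv_lhs => rw [h2]
  rw [Finset.map_affineCombination _ _ _ ((triBasis x hx).sum_coord_apply_eq_one y),
    Finset.affineCombination_eq_linear_combination _ _ _
      ((triBasis x hx).sum_coord_apply_eq_one y)]
  rfl

end Gradient

/-! ### Size and shape of the triangles of a mesh -/

namespace Triangulation

variable {Ω : Set Plane} (M : Triangulation Ω)

/-- The barycentric coordinate vanishing on a side. -/
noncomputable def bary (p : M.Side) : Plane →ᵃ[ℝ] ℝ := (triBasis _ (M.indep p.1)).coord p.2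

/-- The gradient of the barycentric coordinate vanishing on a side. -/
noncomputable def grad (p : M.Side) : Plane := baryGrad (M.indep p.1) p.2

/-- The area of a triangle. -/
noncomputable def area (j : Fin M.n) : ℝ := |crossArea (M.vtx j)| / 2

theorem area_pos (j : Fin M.n) : 0 < M.area j :=
  half_pos (abs_pos.2 (crossArea_ne_zero (M.indep j)))

theorem volume_real_tri (j : Fin M.n) : volume.real (M.tri j) = M.area j :=
  volume_real_triangle (M.indep j)

theorem bary_vtx (j : Fin M.n) (k i : Fin 3) :
    M.bary (j, k) (M.vtx j i) = if k = i then 1 else 0 := coord_vertex (M.indep j) k i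

theorem ne_add_one (k : Fin 3) : k ≠ k + 1 := by fin_cases k <;> decide

theorem ne_add_two (k : Fin 3) : k ≠ k + 2 := by fin_cases k <;> decide

theorem add_one_ne_add_two (k : Fin 3) : k + 1 ≠ k + 2 := by fin_cases k <;> decide

theorem bary_pt₁ (p : M.Side) : M.bary p (M.pt₁ p) = 0 := by
  rw [← Prod.mk.eta (p := p), pt₁, bary_vtx, if_neg (ne_add_one _)]

theorem bary_pt₂ (p : M.Side) : M.bary p (M.pt₂ p) = 0 := by
  rw [← Prod.mk.eta (p := p), pt₂, bary_vtx, if_neg (ne_add_two _)]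

theorem len_eq_norm (p : M.Side) : M.len p = ‖M.pt₂ p - M.pt₁ p‖ := by
  rw [len, dist_comm, dist_eq_norm]

theorem len_smul_normal (p : M.Side) : M.len p • M.normal p = -(2 * M.area p.1) • M.grad p := by
  rw [len_eq_norm, area, mul_div_cancel₀ _ two_ne_zero]
  exact (length_smul_normal (M.indep p.1) p.2).2

theorem len_mul_normal (p : M.Side) (i : Fin 2) :
    M.len p * M.normal p i = -(2 * M.area p.1) * M.grad p i :=
  congrArg (fun y : Plane => y i) (M.len_smul_normal p)

theorem norm_normal (p : M.Side) : ‖M.normal p‖ = 1 := by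
  have h := (length_smul_normal (M.indep p.1) p.2).1
  unfold normal
  rw [norm_smul, norm_inv, norm_norm]
  exact inv_mul_cancel₀ h

theorem len_eq (p : M.Side) : M.len p = 2 * M.area p.1 * ‖M.grad p‖ := by
  have h := congrArg norm (M.len_smul_normal p)
  rw [norm_smul, norm_smul, norm_normal, mul_one, norm_neg,
    Real.norm_of_nonneg (by linarith [M.area_pos p.1] : 0 ≤ 2 * M.area p.1)] at h
  rwa [Real.norm_of_nonneg (by rw [len]; exact dist_nonneg)] at h

theorem len_pos (p : M.Side) : 0 < M.len p := by
  rw [len_eq]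
  have := M.area_pos p.1
  have : 0 < ‖M.grad p‖ := norm_pos_iff.2 (baryGrad_ne_zero _ _)
  positivity

theorem edgeInt_eq (p : M.Side) (F : Plane → ℝ) :
    M.edgeInt p F = M.len p * edgeMean (M.vtx p.1) p.2 F := rfl

theorem isBounded_tri (j : Fin M.n) : Bornology.IsBounded (M.tri j) := (tri_isCompact j).isBounded

theorem vtx_mem (j : Fin M.n) (k : Fin 3) : M.vtx j k ∈ M.tri j :=
  subset_convexHull ℝ _ (mem_range_self k)

theorem dist_le_diamT {j : Fin M.n} {y z : Plane} (hy : y ∈ M.tri j) (hz : z ∈ M.tri j) :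
    dist y z ≤ M.diamT j := Metric.dist_le_diam_of_mem (M.isBounded_tri j) hy hz

theorem len_le_diamT (p : M.Side) : M.len p ≤ M.diamT p.1 :=
  M.dist_le_diamT (M.vtx_mem _ _) (M.vtx_mem _ _)

theorem diamT_pos (j : Fin M.n) : 0 < M.diamT j :=
  (M.len_pos (j, 0)).trans_le (M.len_le_diamT (j, 0))

theorem sum_grad (j : Fin M.n) : ∑ k, M.grad (j, k) = 0 := sum_baryGrad (M.indep j)

variable {M}

theorem ShapeRegular.norm_grad_mul_le {ρ : ℝ} (hρ : 0 < ρ) (h : M.ShapeRegular ρ) (p : M.Side) :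
    ‖M.grad p‖ * (ρ * M.diamT p.1) ≤ 1 := by
  obtain ⟨c, hc⟩ := h p.1
  have h0 := M.diamT_pos p.1
  have := norm_baryGrad_mul_le (M.indep p.1) (by positivity) hc p.2
  rwa [mul_div_cancel₀ _ two_ne_zero] at this

theorem ShapeRegular.mul_len_le {ρ : ℝ} (hρ : 0 < ρ) (h : M.ShapeRegular ρ) (p : M.Side) :
    ρ * M.diamT p.1 * M.len p ≤ 2 * M.area p.1 := by
  rw [len_eq]
  have h1 := h.norm_grad_mul_le hρ p
  have h2 := M.area_pos p.1
  nlinarith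

/-- The coordinate of one end point falls from 1 to 0 along the edge, so the edge length is at least
the reciprocal of the norm of its gradient, which shape regularity bounds. -/
theorem ShapeRegular.le_len {ρ : ℝ} (hρ : 0 < ρ) (h : M.ShapeRegular ρ) (p : M.Side) :
    ρ * M.diamT p.1 ≤ M.len p := by
  have h1 := h.norm_grad_mul_le hρ (p.1, p.2 + 1)
  have h2 := inner_baryGrad_sub (M.indep p.1) (p.2 + 1) (M.pt₁ p) (M.pt₂ p)
  rw [pt₁, pt₂, coord_vertex, coord_vertex, if_pos rfl, if_neg (add_one_ne_add_two _), sub_zero] at h2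
  have h3 := real_inner_le_norm (baryGrad (M.indep p.1) (p.2 + 1)) (M.pt₁ p - M.pt₂ p)
  rw [pt₁, pt₂, h2, ← pt₁, ← pt₂, norm_sub_rev, ← len_eq_norm] at h3
  have h4 := M.len_pos p
  have h5 := M.diamT_pos p.1
  change ‖baryGrad (M.indep p.1) (p.2 + 1)‖ * (ρ * M.diamT p.1) ≤ 1 at h1
  nlinarith [mul_pos hρ h5]

theorem ShapeRegular.sq_le_area {ρ : ℝ} (hρ : 0 < ρ) (h : M.ShapeRegular ρ) (j : Fin M.n) :
    ρ ^ 2 * M.diamT j ^ 2 ≤ 2 * M.area j := by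
  have h1 := h.mul_len_le hρ (j, 0)
  have h2 := h.le_len hρ (j, 0)
  have h3 := M.diamT_pos j
  simp only at h1 h2
  nlinarith [mul_pos hρ h3]

/-! ### Adjacent triangles -/

theorem side_eq_of_edge_eq {p q : M.Side} (h1 : p.1 = q.1) (he : M.edge p = M.edge q) : p = q := by
  obtain ⟨j, k⟩ := p
  obtain ⟨j', k'⟩ := q
  obtain rfl : j = j' := h1
  have hi := (M.indep j).injective
  have : ∀ a b c d : Fin 3, s(M.vtx j a, M.vtx j b) = s(M.vtx j c, M.vtx j d) →
      (a = c ∧ b = d) ∨ (a = d ∧ b = c) := fun a b c d h => by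
    rcases Sym2.eq_iff.1 h with h | h
    · exact Or.inl ⟨hi h.1, hi h.2⟩
    · exact Or.inr ⟨hi h.1, hi h.2⟩
  have h2 := this _ _ _ _ he
  simp only at h2
  congr 1
  revert h2
  clear he this
  revert k k'
  decide

theorem bary_eq_zero_of_edge_eq {p q : M.Side} (he : M.edge p = M.edge q) :
    M.bary q (M.pt₁ p) = 0 ∧ M.bary q (M.pt₂ p) = 0 := by
  rcases Sym2.eq_iff.1 he with ⟨h1, h2⟩ | ⟨h1, h2⟩
  · rw [h1, h2]; exact ⟨M.bary_pt₁ q, M.bary_pt₂ q⟩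
  · rw [h1, h2]; exact ⟨M.bary_pt₂ q, M.bary_pt₁ q⟩

theorem fin3_cases (k i : Fin 3) : i = k ∨ i = k + 1 ∨ i = k + 2 := by
  revert k i; decide

theorem sum_fin3 (k : Fin 3) (f : Fin 3 → ℝ) : ∑ i, f i = f k + f (k + 1) + f (k + 2) := by
  fin_cases k <;> simp [Fin.sum_univ_three] <;> ring

theorem eq_of_range_subset {j j' : Fin M.n} (h : range (M.vtx j) ⊆ range (M.vtx j')) : j = j' := by
  classical
  refine M.distinct ?_
  have h1 : ∀ j, range (M.vtx j) = ((Finset.univ.image (M.vtx j) : Finset Plane) : Set Plane) := by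
    simp
  change range (M.vtx j) = range (M.vtx j')
  rw [h1, h1] at h ⊢
  rw [Finset.coe_inj]
  refine Finset.eq_of_subset_of_card_le (Finset.coe_subset.1 h) ?_
  rw [Finset.card_image_of_injective _ (M.indep j).injective,
    Finset.card_image_of_injective _ (M.indep j').injective]

/-- Both coordinates are affine and vanish on the line of the common edge, hence are proportional;
the factor is read off at the apex of q, where the coordinate of q is 1. -/
theorem bary_eq_mul {p q : M.Side} (he : M.edge p = M.edge q) (y : Plane) :
    M.bary p y = M.bary p (M.vtx q.1 q.2) * M.bary q y := by
  have h := affine_eq_sum_coord (M.indep q.1) (M.bary p) y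
  have h0 := bary_eq_zero_of_edge_eq he.symm
  rw [sum_fin3 q.2] at h
  change _ = _ + _ * M.bary p (M.pt₁ q) + _ * M.bary p (M.pt₂ q) at h
  rw [h0.1, h0.2, mul_zero, mul_zero, add_zero, add_zero] at h
  rw [h, mul_comm]
  rfl

theorem mem_tri_iff (j : Fin M.n) (y : Plane) : y ∈ M.tri j ↔ ∀ k, 0 ≤ M.bary (j, k) y := by
  have h2 := (triBasis _ (M.indep j)).convexHull_eq_nonneg_coord
  change M.tri j = _ at h2
  rw [h2]
  rfl

/-- Two triangles with a common edge lie on opposite sides of it. -/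
theorem bary_neg_of_edge_eq {p q : M.Side} (hne : p ≠ q) (he : M.edge p = M.edge q) :
    M.bary p (M.vtx q.1 q.2) < 0 := by
  by_contra! hcon
  have hj : p.1 ≠ q.1 := fun h => hne (side_eq_of_edge_eq h he)
  have hk1 := bary_eq_mul he (M.vtx p.1 p.2)
  have hk2 : M.bary p (M.vtx p.1 p.2) = 1 := by
    rw [← Prod.mk.eta (p := p), bary_vtx, if_pos rfl]
  obtain ⟨a, ha⟩ : ∃ a, M.bary (p.1, p.2 + 1) (M.vtx q.1 q.2) = a := ⟨_, rfl⟩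
  obtain ⟨b, hb⟩ : ∃ b, M.bary (p.1, p.2 + 2) (M.vtx q.1 q.2) = b := ⟨_, rfl⟩
  -- The point y below lies slightly off the midpoint of the edge, towards the apex of q. This τ
  -- makes (1 - τ)/2 = τ(|a| + |b|), so the two other coordinates of y in p stay nonnegative. If the
  -- apexes were on the same side, y would lie in both triangles.
  obtain ⟨τ, hτ⟩ : ∃ τ : ℝ, τ = 1 / (1 + 2 * |a| + 2 * |b|) := ⟨_, rfl⟩
  have hτ0 : 0 < τ := by rw [hτ]; positivity
  have hτ1 : τ * (1 + 2 * |a| + 2 * |b|) = 1 := by rw [hτ]; field_simp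
  obtain ⟨y, hy⟩ : ∃ y : Plane, y = ((1 - τ) / 2) • M.pt₁ p + ((1 - τ) / 2) • M.pt₂ p
    + τ • M.vtx q.1 q.2 := ⟨_, rfl⟩
  have hv : ∀ v : Plane →ᵃ[ℝ] ℝ, v y = (1 - τ) / 2 * v (M.pt₁ p) + (1 - τ) / 2 * v (M.pt₂ p)
      + τ * v (M.vtx q.1 q.2) := by
    intro v
    have h1 : ∀ z, v z = v.linear z + v 0 := fun z => by
      rw [v.decomp']; simp
    rw [h1, h1 (M.pt₁ p), h1 (M.pt₂ p), h1 (M.vtx q.1 q.2), hy]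
    simp only [map_add, map_smul, smul_eq_mul]
    ring
  have hτ2 : 0 ≤ 1 - τ := by nlinarith [abs_nonneg a, abs_nonneg b]
  have hyp : y ∈ M.tri p.1 := by
    rw [mem_tri_iff]
    intro i
    rcases fin3_cases p.2 i with rfl | rfl | rfl
    · rw [hv]
      have h1 := M.bary_pt₁ p
      have h2 := M.bary_pt₂ p
      rw [← Prod.mk.eta (p := p)] at h1 h2 hcon
      rw [h1, h2]
      have := mul_nonneg hτ0.le hcon
      linarith
    · rw [hv, ha, pt₁, pt₂, bary_vtx, bary_vtx, if_pos rfl, if_neg (add_one_ne_add_two _)]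
      nlinarith [neg_abs_le a, abs_nonneg b]
    · rw [hv, hb, pt₁, pt₂, bary_vtx, bary_vtx, if_pos rfl, if_neg (add_one_ne_add_two _).symm]
      nlinarith [neg_abs_le b, abs_nonneg a]
  have hpt : M.pt₁ p ∈ range (M.vtx q.1) ∧ M.pt₂ p ∈ range (M.vtx q.1) := by
    rcases Sym2.eq_iff.1 he with ⟨h1, h2⟩ | ⟨h1, h2⟩
    · rw [h1, h2]; exact ⟨mem_range_self _, mem_range_self _⟩
    · rw [h1, h2]; exact ⟨mem_range_self _, mem_range_self _⟩
  have hyq : y ∈ M.tri q.1 := by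
    rw [mem_tri_iff]
    intro i
    have h1 : ∀ z ∈ range (M.vtx q.1), 0 ≤ M.bary (q.1, i) z := fun z hz =>
      (M.mem_tri_iff q.1 z).1 (subset_convexHull ℝ _ hz) i
    rw [hv]
    have h2 := h1 _ hpt.1
    have h3 := h1 _ hpt.2
    have h4 := h1 _ (mem_range_self q.2)
    positivity
  -- The apex of p is not a vertex of q, as otherwise the triangles would have the same vertices.
  -- The shared vertices therefore lie on the edge, and by conformity so does y.
  have hz : ∀ z ∈ range (M.vtx p.1) ∩ range (M.vtx q.1), M.bary p z = 0 := by
    rintro _ ⟨⟨i, rfl⟩, hi⟩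
    rcases fin3_cases p.2 i with rfl | rfl | rfl
    · refine absurd (eq_of_range_subset ?_) hj
      rintro _ ⟨i, rfl⟩
      rcases fin3_cases p.2 i with rfl | rfl | rfl
      exacts [hi, hpt.1, hpt.2]
    · exact M.bary_pt₁ p
    · exact M.bary_pt₂ p
  have hzc : M.bary p y = 0 := by
    have h1 : y ∈ convexHull ℝ (range (M.vtx p.1) ∩ range (M.vtx q.1)) := by
      rw [← M.conforming]; exact ⟨hyp, hyq⟩
    have h2 : Convex ℝ {z | M.bary p z = 0} := (convex_singleton (0 : ℝ)).affine_preimage (M.bary p)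
    exact convexHull_min hz h2 h1
  rw [hv, bary_pt₁, bary_pt₂] at hzc
  have h0 : M.bary p (M.vtx q.1 q.2) = 0 := by
    rcases mul_eq_zero.1 (by linarith : τ * M.bary p (M.vtx q.1 q.2) = 0) with h | h
    · exact absurd h hτ0.ne'
    · exact h
  rw [h0, zero_mul, hk2] at hk1
  exact one_ne_zero hk1

/-- An edge belongs to at most two triangles. -/
theorem edge_unique {p q r : M.Side} (hpq : p ≠ q) (hpr : p ≠ r) (he : M.edge p = M.edge q)
    (he' : M.edge p = M.edge r) : q = r := by
  by_contra hqr
  -- With three sides on one edge, the apex of r would be opposite to that of p, but also on the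
  -- same side as p, being opposite to the opposite of p: the product of two negative factors is
  -- positive.
  have h1 := bary_neg_of_edge_eq hpq he
  have h2 := bary_neg_of_edge_eq hpr he'
  have h3 := bary_neg_of_edge_eq hqr (he.symm.trans he')
  have h4 := bary_eq_mul he (M.vtx r.1 r.2)
  nlinarith

end Triangulation

/-! ### Interior and boundary edges of a convex polygon -/

theorem IsConvexPolygon.isOpen {Ω : Set Plane} (h : IsConvexPolygon Ω) : IsOpen Ω := by
  obtain ⟨-, s, rfl⟩ := h; exact isOpen_interior

theorem IsConvexPolygon.convex {Ω : Set Plane} (h : IsConvexPolygon Ω) : Convex ℝ Ω := by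
  obtain ⟨-, s, rfl⟩ := h; exact (convex_convexHull ℝ _).interior

theorem IsConvexPolygon.isBounded {Ω : Set Plane} (h : IsConvexPolygon Ω) :
    Bornology.IsBounded Ω := by
  obtain ⟨-, s, rfl⟩ := h
  exact (s.finite_toSet.isCompact_convexHull ℝ).isBounded.subset interior_subset

theorem IsConvexPolygon.interior_closure {Ω : Set Plane} (h : IsConvexPolygon Ω) :
    interior (closure Ω) = Ω := by
  rw [h.convex.interior_closure_eq_interior_of_nonempty_interior
    (by rw [h.isOpen.interior_eq]; exact h.1), h.isOpen.interior_eq]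

namespace Triangulation

variable {Ω : Set Plane} {M : Triangulation Ω}

theorem tri_subset_closure (j : Fin M.n) : M.tri j ⊆ closure Ω := by
  rw [← M.cover]; exact subset_iUnion (fun j => convexHull ℝ (range (M.vtx j))) j

theorem continuous_bary (p : M.Side) : Continuous (M.bary p) :=
  AffineMap.continuous_of_finiteDimensional _

theorem bary_lineMap (q : M.Side) (a b : Plane) (t : ℝ) :
    M.bary q (AffineMap.lineMap a b t) = (1 - t) * M.bary q a + t * M.bary q b := by
  rw [AffineMap.apply_lineMap, AffineMap.lineMap_apply_ring]

theorem mem_bdryEdges {p : M.Side} :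
    p ∈ M.bdryEdges ↔ segment ℝ (M.pt₁ p) (M.pt₂ p) ⊆ frontier Ω := by
  simp [bdryEdges]

/-- A shared edge is not contained in the boundary. -/
theorem notMem_bdryEdges_of_edge_eq (hΩ : IsConvexPolygon Ω) {p q : M.Side} (hne : p ≠ q)
    (he : M.edge p = M.edge q) : p ∉ M.bdryEdges := by
  intro hp
  have hseg : segment ℝ (M.pt₁ p) (M.pt₂ p) ⊆ frontier Ω := mem_bdryEdges.1 hp
  obtain ⟨m, hm⟩ : ∃ m, m = AffineMap.lineMap (M.pt₁ p) (M.pt₂ p) (1 / 2 : ℝ) := ⟨_, rfl⟩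
  have hmseg : m ∈ segment ℝ (M.pt₁ p) (M.pt₂ p) := by
    rw [segment_eq_image_lineMap, hm]
    exact mem_image_of_mem _ (by norm_num)
  have hpos : ∀ r : M.Side, M.edge p = M.edge r →
      0 < M.bary (r.1, r.2 + 1) m ∧ 0 < M.bary (r.1, r.2 + 2) m := by
    intro r hr
    have h1 : M.bary (r.1, r.2 + 1) (M.pt₁ r) = 1 := by rw [pt₁, bary_vtx, if_pos rfl]
    have h2 : M.bary (r.1, r.2 + 1) (M.pt₂ r) = 0 := by
      rw [pt₂, bary_vtx, if_neg (add_one_ne_add_two _)]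
    have h3 : M.bary (r.1, r.2 + 2) (M.pt₁ r) = 0 := by
      rw [pt₁, bary_vtx, if_neg (add_one_ne_add_two _).symm]
    have h4 : M.bary (r.1, r.2 + 2) (M.pt₂ r) = 1 := by rw [pt₂, bary_vtx, if_pos rfl]
    rw [hm, bary_lineMap, bary_lineMap]
    rcases Sym2.eq_iff.1 hr with ⟨h5, h6⟩ | ⟨h5, h6⟩ <;> rw [h5, h6, h1, h2, h3, h4] <;> norm_num
  -- Near the midpoint all other coordinates are positive in both triangles, and those vanishing on
  -- the edge have opposite signs. The two triangles thus cover a neighbourhood of m, which makes m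
  -- an interior point of the closure of Ω.
  have hev : ∀ᶠ y in nhds m, y ∈ M.tri p.1 ∪ M.tri q.1 := by
    have h1 := hpos p rfl
    have h2 := hpos q he
    have hc : ∀ r : M.Side, 0 < M.bary r m → ∀ᶠ y in nhds m, 0 < M.bary r y := fun r hr =>
      (continuous_bary r).continuousAt.eventually (lt_mem_nhds hr)
    filter_upwards [hc _ h1.1, hc _ h1.2, hc _ h2.1, hc _ h2.2] with y y1 y2 y3 y4
    rcases le_total 0 (M.bary p y) with h | h
    · left
      rw [mem_tri_iff]
      intro i
      rcases fin3_cases p.2 i with rfl | rfl | rfl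
      exacts [h, y1.le, y2.le]
    · right
      rw [mem_tri_iff]
      intro i
      rcases fin3_cases q.2 i with rfl | rfl | rfl
      · have h3 := bary_neg_of_edge_eq hne he
        rw [bary_eq_mul he] at h
        by_contra! hcon
        have : M.bary q y < 0 := hcon
        nlinarith
      · exact y3.le
      · exact y4.le
  have hint : m ∈ interior (closure Ω) := by
    rw [mem_interior_iff_mem_nhds]
    filter_upwards [hev] with y hy
    exact union_subset (tri_subset_closure _) (tri_subset_closure _) hy
  rw [hΩ.interior_closure] at hint
  have := hseg hmseg
  rw [hΩ.isOpen.frontier_eq] at this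
  exact this.2 hint

/-- An edge which is not contained in the boundary is shared. -/
theorem exists_edge_eq_of_notMem_bdryEdges (hΩ : IsConvexPolygon Ω) {p : M.Side}
    (hp : p ∉ M.bdryEdges) : ∃ q, p ≠ q ∧ M.edge p = M.edge q := by
  have hseg : ¬ segment ℝ (M.pt₁ p) (M.pt₂ p) ⊆ frontier Ω := fun h =>
    hp (mem_bdryEdges.2 h)
  obtain ⟨x₀, hx₀, hx₀'⟩ := not_subset.1 hseg
  have hx₀Ω : x₀ ∈ Ω := by
    by_contra h
    refine hx₀' ?_
    rw [hΩ.isOpen.frontier_eq]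
    exact ⟨tri_subset_closure p.1 (segment_subset_tri p hx₀), h⟩
  rw [segment_eq_image_lineMap] at hx₀
  obtain ⟨t₀, ht₀, rfl⟩ := hx₀
  -- The point of Ω found on the edge may be an end point. Openness of Ω moves it into the relative
  -- interior, where both end points have positive weight.
  obtain ⟨t, ht, htΩ⟩ : ∃ t ∈ Ioo (0 : ℝ) 1, AffineMap.lineMap (M.pt₁ p) (M.pt₂ p) t ∈ Ω := by
    have h1 : t₀ ∈ closure (Ioo (0 : ℝ) 1) := by rwa [closure_Ioo zero_ne_one]
    have h2 : IsOpen ((AffineMap.lineMap (M.pt₁ p) (M.pt₂ p) : ℝ → Plane) ⁻¹' Ω) :=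
      hΩ.isOpen.preimage AffineMap.lineMap_continuous
    obtain ⟨t, h3, h4⟩ := mem_closure_iff.1 h1 _ h2 hx₀Ω
    exact ⟨t, h4, h3⟩
  obtain ⟨x, hx⟩ : ∃ x : Plane, x = AffineMap.lineMap (M.pt₁ p) (M.pt₂ p) t := ⟨_, rfl⟩
  rw [← hx] at htΩ
  have hxp : x ∈ M.tri p.1 := by
    refine segment_subset_tri p ?_
    rw [segment_eq_image_lineMap, hx]
    exact mem_image_of_mem _ ⟨ht.1.le, ht.2.le⟩
  have hS : IsClosed (⋃ j ∈ {j | j ≠ p.1}, M.tri j) :=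
    (toFinite _).isClosed_biUnion fun j _ => (tri_isCompact j).isClosed
  -- Points just beyond the edge are in Ω but not in the triangle, so other triangles cover them;
  -- the finite union of these is closed and contains the limit x.
  have hxS : x ∈ ⋃ j ∈ {j | j ≠ p.1}, M.tri j := by
    have hlim : Filter.Tendsto (fun τ : ℝ => AffineMap.lineMap x (M.vtx p.1 p.2) (-τ) : ℝ → Plane)
        (nhdsWithin 0 (Ioi 0)) (nhds x) := by
      have : Continuous fun τ : ℝ => (AffineMap.lineMap x (M.vtx p.1 p.2) (-τ) : Plane) :=
        AffineMap.lineMap_continuous.comp continuous_neg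
      have h := this.tendsto 0
      simp only [neg_zero, AffineMap.lineMap_apply_zero] at h
      exact h.mono_left nhdsWithin_le_nhds
    refine hS.mem_of_tendsto hlim ?_
    filter_upwards [hlim.eventually (hΩ.isOpen.mem_nhds htΩ), self_mem_nhdsWithin] with τ h1 h2
    have h3 := subset_closure h1
    rw [← M.cover] at h3
    obtain ⟨j, hj⟩ := mem_iUnion.1 h3
    refine mem_biUnion (x := j) ?_ hj
    rintro rfl
    have h4 := (M.mem_tri_iff p.1 _).1 hj p.2
    have h5 : M.bary p x = 0 := by rw [hx, bary_lineMap, bary_pt₁, bary_pt₂]; ring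
    rw [Prod.mk.eta, bary_lineMap, h5, ← Prod.mk.eta (p := p), bary_vtx, if_pos rfl] at h4
    have : 0 < τ := h2
    linarith
  obtain ⟨j, hj, hxj⟩ := mem_iUnion₂.1 hxS
  have hxc : x ∈ convexHull ℝ (range (M.vtx p.1) ∩ range (M.vtx j)) := by
    rw [← M.conforming]; exact ⟨hxp, hxj⟩
  -- A vertex that is not shared has a coordinate vanishing at all shared vertices, hence on their
  -- convex hull and at x.
  have hmem : ∀ i, 0 < M.bary (p.1, i) x → M.vtx p.1 i ∈ range (M.vtx j) := by
    intro i hi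
    by_contra hcon
    have h1 : range (M.vtx p.1) ∩ range (M.vtx j) ⊆ {z | M.bary (p.1, i) z = 0} := by
      rintro _ ⟨⟨l, rfl⟩, hl⟩
      rw [mem_ofPred_eq, bary_vtx, if_neg]
      rintro rfl
      exact hcon hl
    have h2 : Convex ℝ {z | M.bary (p.1, i) z = 0} :=
      (convex_singleton (0 : ℝ)).affine_preimage (M.bary (p.1, i))
    exact hi.ne' (convexHull_min h1 h2 hxc)
  have ha : M.pt₁ p ∈ range (M.vtx j) := hmem _ (by
    rw [hx, bary_lineMap, pt₁, pt₂, bary_vtx, bary_vtx, if_pos rfl, if_neg (add_one_ne_add_two _)]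
    linarith [ht.2])
  have hb : M.pt₂ p ∈ range (M.vtx j) := hmem _ (by
    rw [hx, bary_lineMap, pt₁, pt₂, bary_vtx, bary_vtx, if_pos rfl,
      if_neg (add_one_ne_add_two _).symm]
    linarith [ht.1])
  obtain ⟨m, hm⟩ := ha
  obtain ⟨m', hm'⟩ := hb
  have hmm : m ≠ m' := by
    rintro rfl
    exact add_one_ne_add_two p.2 ((M.indep p.1).injective (hm.symm.trans hm'))
  have hex : ∀ m m' : Fin 3, m ≠ m' → ∃ k : Fin 3, (m = k + 1 ∧ m' = k + 2) ∨
      (m = k + 2 ∧ m' = k + 1) := by decide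
  obtain ⟨k, hk⟩ := hex m m' hmm
  refine ⟨(j, k), fun h => hj (congrArg Prod.fst h).symm, ?_⟩
  rw [edge, edge, Sym2.eq_iff, ← hm, ← hm', pt₁, pt₂]
  rcases hk with ⟨rfl, rfl⟩ | ⟨rfl, rfl⟩
  · exact Or.inl ⟨rfl, rfl⟩
  · exact Or.inr ⟨rfl, rfl⟩

theorem mem_intEdges {p : M.Side × M.Side} :
    p ∈ M.intEdges ↔ p.2.1 < p.1.1 ∧ M.edge p.1 = M.edge p.2 := by
  simp [intEdges]

theorem ne_of_mem_intEdges {p : M.Side × M.Side} (hp : p ∈ M.intEdges) : p.1 ≠ p.2 := fun h => by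
  have := (mem_intEdges.1 hp).1
  rw [h] at this
  exact lt_irrefl _ this

/-- Summation over the sides of all triangles. -/
theorem sum_sides (hΩ : IsConvexPolygon Ω) (f : M.Side → ℝ) :
    ∑ q, f q = ∑ p ∈ M.intEdges, (f p.1 + f p.2) + ∑ q ∈ M.bdryEdges, f q := by
  classical
  have hi1 : InjOn Prod.fst (M.intEdges : Set (M.Side × M.Side)) := by
    rintro ⟨p, q⟩ hp ⟨p', q'⟩ hp' (rfl : p = p')
    exact Prod.ext rfl (edge_unique (ne_of_mem_intEdges hp) (ne_of_mem_intEdges (p := (p, q')) hp')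
      (mem_intEdges.1 hp).2 (mem_intEdges (p := (p, q')).1 hp').2)
  have hi2 : InjOn Prod.snd (M.intEdges : Set (M.Side × M.Side)) := by
    rintro ⟨p, q⟩ hp ⟨p', q'⟩ hp' (rfl : q = q')
    exact Prod.ext (edge_unique (ne_of_mem_intEdges hp).symm
      (ne_of_mem_intEdges (p := (p', q)) hp').symm (mem_intEdges.1 hp).2.symm
      (mem_intEdges (p := (p', q)).1 hp').2.symm) rfl
  rw [Finset.sum_add_distrib, ← Finset.sum_image (g := Prod.fst) (f := f) hi1,
    ← Finset.sum_image (g := Prod.snd) (f := f) hi2, ← Finset.sum_union, ← Finset.sum_union]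
  · congr 1
    ext p
    simp only [Finset.mem_univ, true_iff, Finset.mem_union, Finset.mem_image]
    by_cases hp : p ∈ M.bdryEdges
    · exact Or.inr hp
    · left
      obtain ⟨q, hpq, he⟩ := exists_edge_eq_of_notMem_bdryEdges hΩ hp
      rcases lt_trichotomy p.1 q.1 with h | h | h
      · exact Or.inr ⟨(q, p), mem_intEdges.2 ⟨h, he.symm⟩, rfl⟩
      · exact absurd (side_eq_of_edge_eq h he) hpq
      · exact Or.inl ⟨(p, q), mem_intEdges.2 ⟨h, he⟩, rfl⟩
  · rw [Finset.disjoint_left]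
    intro p hp
    simp only [Finset.mem_union, Finset.mem_image] at hp
    rcases hp with ⟨q, hq, rfl⟩ | ⟨q, hq, rfl⟩
    · exact notMem_bdryEdges_of_edge_eq hΩ (ne_of_mem_intEdges hq) (mem_intEdges.1 hq).2
    · exact notMem_bdryEdges_of_edge_eq hΩ (ne_of_mem_intEdges hq).symm (mem_intEdges.1 hq).2.symm
  · rw [Finset.disjoint_left]
    intro p hp hp'
    simp only [Finset.mem_image] at hp hp'
    obtain ⟨q, hq, rfl⟩ := hp
    obtain ⟨r, hr, h⟩ := hp'
    have h1 := edge_unique (ne_of_mem_intEdges hq) (h ▸ ne_of_mem_intEdges hr).symm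
      (mem_intEdges.1 hq).2 (h ▸ (mem_intEdges.1 hr).2.symm)
    have h2 := (mem_intEdges.1 hq).1
    have h3 := (mem_intEdges.1 hr).1
    rw [h] at h3
    rw [h1] at h2
    exact lt_asymm h2 h3

theorem normal_eq (p : M.Side) : M.normal p = -(‖M.grad p‖⁻¹ • M.grad p) := by
  have h1 := M.len_smul_normal p
  have h2 : 0 < ‖M.grad p‖ := norm_pos_iff.2 (baryGrad_ne_zero _ _)
  have h3 := M.area_pos p.1
  have h4 := (M.len_pos p).ne'
  have h5 : M.len p • M.normal p = M.len p • (-(‖M.grad p‖⁻¹ • M.grad p)) := by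
    rw [h1, smul_neg, smul_smul, M.len_eq p, neg_smul]
    congr 2
    field_simp
  exact smul_right_injective Plane h4 h5

/-- The outer normals on both sides of an edge are opposite. -/
theorem normal_neg {p q : M.Side} (hne : p ≠ q) (he : M.edge p = M.edge q) :
    M.normal q = - M.normal p := by
  obtain ⟨μ, hμ⟩ : ∃ μ, μ = M.bary p (M.vtx q.1 q.2) := ⟨_, rfl⟩
  have h0 : μ < 0 := hμ ▸ bary_neg_of_edge_eq hne he
  have h1 : M.grad p = μ • M.grad q := by
    refine ext_inner_right ℝ fun y => ?_
    have h2 := inner_baryGrad_sub (M.indep p.1) p.2 y 0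
    have h3 := inner_baryGrad_sub (M.indep q.1) q.2 y 0
    rw [sub_zero] at h2 h3
    rw [grad, h2, real_inner_smul_left, grad, h3]
    change M.bary p y - M.bary p 0 = μ * (M.bary q y - M.bary q 0)
    rw [bary_eq_mul he, bary_eq_mul he 0, hμ]
    ring
  have h2 : 0 < ‖M.grad q‖ := norm_pos_iff.2 (baryGrad_ne_zero _ _)
  rw [normal_eq, normal_eq, h1, norm_smul, smul_smul, neg_neg, Real.norm_of_nonpos h0.le,
    ← neg_smul]
  congr 1
  have := h0.ne
  field_simp

theorem edgeInt_comm {p q : M.Side} (he : M.edge p = M.edge q) (F : Plane → ℝ) :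
    M.edgeInt p F = M.edgeInt q F := by
  unfold edgeInt segIntegral
  rcases Sym2.eq_iff.1 he with ⟨h1, h2⟩ | ⟨h1, h2⟩
  · rw [h1, h2]
  · rw [h1, h2, dist_comm, integral_lineMap_symm]

theorem len_comm {p q : M.Side} (he : M.edge p = M.edge q) : M.len p = M.len q := by
  unfold len
  rcases Sym2.eq_iff.1 he with ⟨h1, h2⟩ | ⟨h1, h2⟩
  · rw [h1, h2]
  · rw [h1, h2, dist_comm]

end Triangulation

/-! ### Functions of class W^{1,∞} on a convex domain are Lipschitz -/

theorem isWeakPartial_weakPartial {Ω : Set Plane} {i : Fin 2} {u : Plane → ℝ}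
    (h : HasBddWeakPartial Ω i u) : MemLp (weakPartial Ω i u) ⊤ (volume.restrict Ω) ∧
      IsWeakPartial Ω i u (weakPartial Ω i u) := by
  rw [weakPartial, dif_pos h]
  exact h.choose_spec

theorem exists_ae_bound {μ : Measure Plane} {g : Plane → ℝ} (hg : MemLp g ⊤ μ) :
    ∃ B : ℝ, 0 ≤ B ∧ ∀ᵐ x ∂μ, |g x| ≤ B := by
  refine ⟨(eLpNormEssSup g μ).toReal, ENNReal.toReal_nonneg, ?_⟩
  have hfin : eLpNormEssSup g μ ≠ ⊤ := by
    have := hg.2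
    rw [eLpNorm_exponent_top] at this
    exact this.ne
  filter_upwards [ae_le_eLpNormEssSup (f := g) (μ := μ)] with x hx
  have := (ENNReal.toReal_le_toReal (by simp) hfin).2 hx
  simpa using this

section Mollify

open scoped Convolution

variable {Ω : Set Plane} {u : Plane → ℝ}

/-- The mollification of a function on `Ω`, extended by zero. -/
noncomputable def mollify (Ω : Set Plane) (u : Plane → ℝ) (φ : ContDiffBump (0 : Plane)) :
    Plane → ℝ :=
  φ.normed volume ⋆[ContinuousLinearMap.lsmul ℝ ℝ, volume] Ω.indicator u

theorem mollify_eq_flip (φ : ContDiffBump (0 : Plane)) : mollify Ω u φ =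
    Ω.indicator u ⋆[(ContinuousLinearMap.lsmul ℝ ℝ).flip, volume] φ.normed volume :=
  (convolution_flip (ContinuousLinearMap.lsmul ℝ ℝ)).symm

/-- The derivative falls on the smooth kernel, so local integrability of the extension by zero is
enough. -/
theorem mollify_fderiv (hm : LocallyIntegrable (Ω.indicator u)) (φ : ContDiffBump (0 : Plane))
    (x : Plane) : ∃ L : Plane →L[ℝ] ℝ, HasFDerivAt (mollify Ω u φ) L x ∧
      ∀ e, L e = ∫ t, fderiv ℝ (φ.normed volume) (x - t) e * Ω.indicator u t := by
  refine ⟨((Ω.indicator u) ⋆[(ContinuousLinearMap.lsmul ℝ ℝ).flip.precompR Plane, volume]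
    fderiv ℝ (φ.normed volume)) x, ?_, fun e => ?_⟩
  · rw [mollify_eq_flip]
    exact φ.hasCompactSupport_normed.hasFDerivAt_convolution_right _ hm φ.contDiff_normed x
  · rw [convolution_precompR_apply _ hm (φ.hasCompactSupport_normed.fderiv ℝ)
      ((φ.contDiff_normed (n := 1)).continuous_fderiv one_ne_zero)]
    rfl

/-- As long as its support stays in Ω, the reflected kernel χ(t) = φ(x - t) is an admissible test
function. This moves the derivative onto g, and χ is nonnegative with integral at most one. -/
theorem abs_mollify_deriv_le (hΩ : MeasurableSet Ω) {i : Fin 2} {g : Plane → ℝ} {B : ℝ}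
    (hB : ∀ᵐ x ∂(volume.restrict Ω), |g x| ≤ B) (hw : IsWeakPartial Ω i u g)
    (φ : ContDiffBump (0 : Plane)) {x : Plane} (hx : Metric.closedBall x φ.rOut ⊆ Ω) :
    |∫ t, fderiv ℝ (φ.normed volume) (x - t) (unitVec i) * Ω.indicator u t| ≤ B := by
  obtain ⟨χ, hχ⟩ : ∃ χ : Plane → ℝ, χ = fun t => φ.normed volume (x - t) := ⟨_, rfl⟩
  have hχd : ContDiff ℝ ∞ χ := by
    rw [hχ]; exact φ.contDiff_normed.comp (contDiff_const.sub contDiff_id)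
  have hχe : χ = φ.normed volume ∘ (Homeomorph.subLeft x) := hχ
  have hχs : HasCompactSupport χ := by
    rw [hχe]; exact φ.hasCompactSupport_normed.comp_homeomorph _
  have hsupp : tsupport χ ⊆ Ω := by
    rw [hχe, tsupport_comp_eq_preimage, φ.tsupport_normed_eq]
    refine Subset.trans (fun t ht => ?_) hx
    rw [mem_preimage, Homeomorph.subLeft_apply, mem_closedBall_zero_iff] at ht
    rwa [Metric.mem_closedBall, dist_comm, dist_eq_norm]
  have hfd : ∀ t, fderiv ℝ χ t (unitVec i) = - fderiv ℝ (φ.normed volume) (x - t) (unitVec i) := by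
    intro t
    have h1 : HasFDerivAt (fun t => x - t) (-(ContinuousLinearMap.id ℝ Plane)) t :=
      (hasFDerivAt_id t).const_sub x
    have h2 : HasFDerivAt (φ.normed volume) (fderiv ℝ (φ.normed volume) (x - t)) (x - t) :=
      ((φ.contDiff_normed (n := 1)).differentiable one_ne_zero (x - t)).hasFDerivAt
    have h3 : HasFDerivAt (fun t => φ.normed volume (x - t))
        ((fderiv ℝ (φ.normed volume) (x - t)).comp (-(ContinuousLinearMap.id ℝ Plane))) t :=
      h2.comp t h1
    rw [hχ, h3.fderiv]
    simp
  have hint : Integrable χ := hχd.continuous.integrable_of_hasCompactSupport hχs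
  have hχ0 : ∀ t, 0 ≤ χ t := fun t => by rw [hχ]; exact φ.nonneg_normed _
  have hχ1 : ∫ t in Ω, χ t ≤ 1 := by
    refine (setIntegral_le_integral hint (Filter.Eventually.of_forall hχ0)).trans ?_
    rw [hχ, integral_sub_left_eq_self (fun t => φ.normed volume t) volume x]
    exact φ.integral_normed.le
  -- An a.e. bound of |g| is nonnegative unless Ω is null, which the ball around x excludes below.
  have hB0 : 0 ≤ B ∨ volume.restrict Ω = 0 := by
    by_cases h : volume.restrict Ω = 0
    · exact Or.inr h
    · left
      have : (ae (volume.restrict Ω)).NeBot := ae_neBot.2 h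
      obtain ⟨y, hy⟩ := hB.exists
      exact (abs_nonneg _).trans hy
  have key : ∫ t, fderiv ℝ (φ.normed volume) (x - t) (unitVec i) * Ω.indicator u t =
      ∫ t in Ω, g t * χ t := by
    have h1 := hw χ hχd hχs hsupp
    rw [← neg_eq_iff_eq_neg] at h1
    rw [← h1, ← integral_indicator hΩ, ← integral_neg]
    congr 1
    ext t
    by_cases ht : t ∈ Ω
    · simp only [indicator_of_mem ht, hfd]; ring
    · simp [indicator_of_notMem ht]
  have hΩ0 : 0 ≤ B := by
    rcases hB0 with h | h
    · exact h
    · exfalso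
      have h1 : volume (Metric.ball x φ.rOut) ≤ 0 := by
        rw [Measure.restrict_eq_zero] at h
        rw [← h]
        exact measure_mono (Metric.ball_subset_closedBall.trans hx)
      exact (Metric.measure_ball_pos volume x φ.rOut_pos).not_ge h1
  rw [key, ← Real.norm_eq_abs]
  refine (norm_integral_le_of_norm_le (hint.integrableOn.const_mul B) ?_).trans ?_
  · filter_upwards [hB] with t ht
    rw [norm_mul, Real.norm_eq_abs, Real.norm_of_nonneg (hχ0 t)]
    exact mul_le_mul_of_nonneg_right ht (hχ0 t)
  · rw [integral_const_mul]
    nlinarith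

theorem norm_le_of_unitVec {L : Plane →L[ℝ] ℝ} {B : Fin 2 → ℝ} (h : ∀ i, |L (unitVec i)| ≤ B i) :
    ‖L‖ ≤ B 0 + B 1 := by
  have hB : ∀ i, 0 ≤ B i := fun i => (abs_nonneg _).trans (h i)
  refine L.opNorm_le_bound (add_nonneg (hB 0) (hB 1)) fun y => ?_
  have h1 := linear_eq_sum (L : Plane →ₗ[ℝ] ℝ) y
  simp only [ContinuousLinearMap.coe_coe] at h1
  rw [h1, Fin.sum_univ_two, Real.norm_eq_abs]
  have h2 : ∀ i, |y i * L (unitVec i)| ≤ ‖y‖ * B i := fun i => by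
    rw [abs_mul]
    exact mul_le_mul (PiLp.norm_apply_le y i) (h i) (abs_nonneg _) (norm_nonneg _)
  refine (abs_add_le _ _).trans ?_
  linarith [h2 0, h2 1]

/-- A continuous function with bounded weak derivatives on a convex open set is Lipschitz. -/
theorem exists_lipschitzOnWith (hΩ : IsOpen Ω) (hconv : Convex ℝ Ω) (hb : Bornology.IsBounded Ω)
    (hu : MemW1Inf Ω u) (hc : ContinuousOn u (closure Ω)) :
    ∃ K : NNReal, LipschitzOnWith K u (closure Ω) := by
  have hg := fun i => isWeakPartial_weakPartial (hu.2 i)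
  choose B hB0 hB using fun i => exists_ae_bound (hg i).1
  refine ⟨⟨B 0 + B 1, add_nonneg (hB0 0) (hB0 1)⟩, LipschitzOnWith.closure hc ?_⟩
  have hcl : IsCompact (closure Ω) := hb.isCompact_closure
  have hint : IntegrableOn u Ω := (hc.integrableOn_compact hcl).mono_set subset_closure
  have hint' : Integrable (Ω.indicator u) := (integrable_indicator_iff hΩ.measurableSet).2 hint
  refine LipschitzOnWith.of_dist_le_mul fun x hx y hy => ?_
  refine le_of_forall_pos_le_add fun ε hε => ?_
  have hseg : segment ℝ x y ⊆ Ω := hconv.segment_subset hx hy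
  have hsegc : IsCompact (segment ℝ x y) := by
    rw [segment_eq_image_lineMap]
    exact isCompact_Icc.image AffineMap.lineMap_continuous
  obtain ⟨δ, hδ, hδΩ⟩ := hsegc.exists_cthickening_subset_open hΩ hseg
  have hcont : ∀ z ∈ Ω, ∃ r > 0, ∀ w ∈ Metric.ball z r,
      dist (Ω.indicator u w) (Ω.indicator u z) ≤ ε / 2 := by
    intro z hz
    have h1 : ContinuousAt (Ω.indicator u) z := by
      refine (((hc.mono subset_closure).continuousAt (hΩ.mem_nhds hz))).congr ?_
      filter_upwards [hΩ.mem_nhds hz] with w hw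
      rw [indicator_of_mem hw]
    obtain ⟨r, hr, h2⟩ := Metric.continuousAt_iff.1 h1 (ε / 2) (half_pos hε)
    exact ⟨r, hr, fun w hw => (h2 hw).le⟩
  obtain ⟨r₁, hr₁, h₁⟩ := hcont x hx
  obtain ⟨r₂, hr₂, h₂⟩ := hcont y hy
  -- Radius at most δ keeps the balls around the whole segment inside Ω, where the derivative bound
  -- applies; radius at most r₁ and r₂ makes the mollification ε/2-close to u at both end points.
  obtain ⟨r, hr⟩ : ∃ r, r = min δ (min r₁ r₂) := ⟨_, rfl⟩
  have hr0 : 0 < r := by rw [hr]; positivity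
  obtain ⟨φ, hφ⟩ : ∃ φ : ContDiffBump (0 : Plane), φ.rOut = r :=
    ⟨⟨r / 2, r, by linarith, by linarith⟩, rfl⟩
  have e1 : dist (mollify Ω u φ x) (u x) ≤ ε / 2 := by
    have := φ.dist_normed_convolution_le hint'.aestronglyMeasurable (x₀ := x) (ε := ε / 2)
      fun w hw => h₁ w (Metric.ball_subset_ball (by rw [hφ, hr]; simp) hw)
    rwa [indicator_of_mem hx] at this
  have e2 : dist (mollify Ω u φ y) (u y) ≤ ε / 2 := by
    have := φ.dist_normed_convolution_le hint'.aestronglyMeasurable (x₀ := y) (ε := ε / 2)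
      fun w hw => h₂ w (Metric.ball_subset_ball (by rw [hφ, hr]; simp) hw)
    rwa [indicator_of_mem hy] at this
  have e3 : dist (mollify Ω u φ x) (mollify Ω u φ y) ≤ (B 0 + B 1) * dist x y := by
    choose L hL1 hL2 using fun z => mollify_fderiv (u := u) hint'.locallyIntegrable φ z
    have := (convex_segment x y).norm_image_sub_le_of_norm_hasFDerivWithin_le (C := B 0 + B 1)
      (fun z _ => (hL1 z).hasFDerivWithinAt) (fun z hz => norm_le_of_unitVec fun i => by
        rw [hL2]
        refine abs_mollify_deriv_le hΩ.measurableSet (hB i) (hg i).2 φ ?_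
        refine Subset.trans ?_ hδΩ
        rw [hφ]
        exact (Metric.closedBall_subset_closedBall (by rw [hr]; simp)).trans
          (Metric.closedBall_subset_cthickening hz δ))
      (right_mem_segment ℝ x y) (left_mem_segment ℝ x y)
    rwa [← dist_eq_norm, ← dist_eq_norm] at this
  have e4 := dist_triangle4 (u x) (mollify Ω u φ x) (mollify Ω u φ y) (u y)
  rw [dist_comm (u x) (mollify Ω u φ x)] at e4
  change dist (u x) (u y) ≤ (B 0 + B 1) * dist x y + ε
  linarith

/-- The Lipschitz extension of a function of class `W^{1,∞}`, whose derivatives are the weak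
derivatives. -/
theorem exists_lipschitz_extension (hΩ : IsOpen Ω) (hconv : Convex ℝ Ω)
    (hb : Bornology.IsBounded Ω) (hu : MemW1Inf Ω u) (hc : ContinuousOn u (closure Ω)) :
    ∃ (K : NNReal) (U : Plane → ℝ), LipschitzWith K U ∧ EqOn u U (closure Ω) ∧
      ∀ i, ∀ᵐ x ∂(volume.restrict (closure Ω)),
        fderiv ℝ U x (unitVec i) = weakPartial Ω i u x := by
  obtain ⟨K, hK⟩ := exists_lipschitzOnWith hΩ hconv hb hu hc
  obtain ⟨U, hU, hUe⟩ := hK.extend_real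
  refine ⟨K, U, hU, hUe, fun i => ?_⟩
  -- The boundary of a convex set is a null set.
  have hcl : volume.restrict (closure Ω) = volume.restrict Ω :=
    Measure.restrict_congr_set (closure_ae_eq_of_null_frontier (hconv.addHaar_frontier _))
  rw [hcl]
  obtain ⟨hg1, hg2⟩ := isWeakPartial_weakPartial (hu.2 i)
  have hfin : volume Ω ≠ ⊤ := hb.measure_lt_top.ne
  have : IsFiniteMeasure (volume.restrict Ω) := ⟨by simpa using hfin.lt_top⟩
  have hi1 : IntegrableOn (weakPartial Ω i u) Ω := hg1.integrable le_top
  have hi2 : IntegrableOn (fun x => fderiv ℝ U x (unitVec i)) Ω :=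
    (integrableOn_fderiv_apply hU _ hb.isCompact_closure).mono_set subset_closure
  -- The a.e. derivative of U and the weak derivative of u have the same integrals against test
  -- functions, since a Lipschitz function may be integrated by parts and U = u on Ω. The
  -- fundamental lemma of the calculus of variations then identifies them.
  have key := hΩ.ae_eq_zero_of_integral_contDiff_smul_eq_zero (μ := volume)
    (f := fun x => fderiv ℝ U x (unitVec i) - weakPartial Ω i u x)
    (hi2.sub hi1).locallyIntegrableOn (fun φ hφ hφc hφs => by
      have h1 := hg2 φ hφ hφc hφs
      obtain ⟨D, hD⟩ : ∃ D, LipschitzWith D φ :=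
        hφ.lipschitzWith_of_hasCompactSupport hφc (by simp)
      have h2 := hU.integral_lineDeriv_mul_eq (μ := volume) hD hφc (unitVec i)
      have h3 : ∀ x ∉ Ω, φ x = 0 := fun x hx => by
        by_contra h
        exact hx (hφs (subset_tsupport φ h))
      have h4 : ∀ x, lineDeriv ℝ φ x (-unitVec i) = - fderiv ℝ φ x (unitVec i) := fun x => by
        rw [((hφ.differentiable (by simp)) x).lineDeriv_eq_fderiv, map_neg]
      have h5 : ∀ x ∉ Ω, fderiv ℝ φ x = 0 := fun x hx => by
        by_contra h
        exact hx (hφs (support_fderiv_subset ℝ h))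
      have h6 : ∫ x, lineDeriv ℝ φ x (-unitVec i) * U x = ∫ x in Ω, weakPartial Ω i u x * φ x := by
        rw [← neg_eq_iff_eq_neg] at h1
        rw [← h1, ← integral_neg, ← integral_indicator hΩ.measurableSet]
        congr 1
        ext x
        by_cases hx : x ∈ Ω
        · rw [indicator_of_mem hx, h4, hUe (subset_closure hx)]; ring
        · rw [indicator_of_notMem hx, h4, h5 x hx]; simp
      have h7 : ∫ x, lineDeriv ℝ U x (unitVec i) * φ x =
          ∫ x in Ω, fderiv ℝ U x (unitVec i) * φ x := by
        rw [← integral_indicator hΩ.measurableSet]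
        refine integral_congr_ae ?_
        filter_upwards [ae_fderiv_apply_eq_lineDeriv hU (unitVec i)] with x hx
        rw [← hx]
        by_cases hx : x ∈ Ω
        · rw [indicator_of_mem hx]
        · rw [indicator_of_notMem hx, h3 x hx, mul_zero]
      obtain ⟨C, hC⟩ := hφ.continuous.bounded_above_of_compact_support hφc
      have h8 : ∀ {f : Plane → ℝ}, IntegrableOn f Ω → IntegrableOn (fun x => f x * φ x) Ω :=
        fun hf => hf.mul_bdd (c := C) hφ.continuous.aestronglyMeasurable
          (Filter.Eventually.of_forall hC)
      have h9 := integral_sub (h8 hi2) (h8 hi1)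
      rw [← h7, ← h6, h2, sub_self, ← integral_indicator hΩ.measurableSet] at h9
      rw [← h9]
      congr 1
      ext x
      by_cases hx : x ∈ Ω
      · rw [indicator_of_mem hx, smul_eq_mul]; ring
      · rw [indicator_of_notMem hx, h3 x hx, zero_smul])
  rw [ae_restrict_iff' hΩ.measurableSet]
  filter_upwards [key] with x hx hxΩ
  exact sub_eq_zero.1 (hx hxΩ)

end Mollify

/-! ### Integration by parts on triangles with Lipschitz coefficients -/

/-- Integration by parts on a triangle, for a Lipschitz and a smooth function. -/
theorem integral_mul_fderiv_triangle {x : Fin 3 → Plane} (hx : AffineIndependent ℝ x) {K : NNReal}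
    {U φ : Plane → ℝ} (hU : LipschitzWith K U) (hφ : ContDiff ℝ 1 φ) (a : Plane) :
    ∫ y in convexHull ℝ (range x), (U y * fderiv ℝ φ y a + fderiv ℝ U y a * φ y) =
      - |crossArea x| * ∑ k, ((triBasis x hx).coord k).linear a *
        edgeMean x k fun y => U y * φ y := by
  have hT := isCompact_triangle x
  -- The product of U and φ is Lipschitz only on bounded sets. It is restricted to a ball whose
  -- interior contains the triangle and extended from there, so that on the triangle the derivatives
  -- are unchanged.
  obtain ⟨R, hR⟩ := hT.isBounded.subset_ball 0
  obtain ⟨D, hD⟩ : ∃ D, LipschitzOnWith D φ (Metric.closedBall 0 R) :=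
    hφ.contDiffOn.exists_lipschitzOnWith one_ne_zero (convex_closedBall 0 R)
      (isCompact_closedBall 0 R)
  obtain ⟨C, hC⟩ := (isCompact_closedBall (0 : Plane) R).exists_bound_of_continuousOn
    hU.continuous.continuousOn
  obtain ⟨C', hC'⟩ := (isCompact_closedBall (0 : Plane) R).exists_bound_of_continuousOn
    hφ.continuous.continuousOn
  have hF : LipschitzOnWith (C.toNNReal * D + C'.toNNReal * K) (fun y => U y * φ y)
      (Metric.closedBall 0 R) := by
    refine LipschitzOnWith.of_dist_le_mul fun y hy z hz => ?_
    have h1 := hU.dist_le_mul y z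
    have h2 := hD.dist_le_mul y hy z hz
    rw [Real.dist_eq] at h1 h2 ⊢
    have h3 : |U y| ≤ C.toNNReal := (hC y hy).trans (Real.le_coe_toNNReal C)
    have h4 : |φ z| ≤ C'.toNNReal := (hC' z hz).trans (Real.le_coe_toNNReal C')
    calc |U y * φ y - U z * φ z| = |U y * (φ y - φ z) + φ z * (U y - U z)| := by ring_nf
      _ ≤ |U y| * |φ y - φ z| + |φ z| * |U y - U z| := by
        rw [← abs_mul, ← abs_mul]; exact abs_add_le _ _
      _ ≤ C.toNNReal * (D * dist y z) + C'.toNNReal * (K * dist y z) :=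
        add_le_add (mul_le_mul h3 h2 (abs_nonneg _) (by positivity))
          (mul_le_mul h4 h1 (abs_nonneg _) (by positivity))
      _ = _ := by push_cast; ring
  obtain ⟨F, hFL, hFe⟩ := hF.extend_real
  have hmain := integral_fderiv_triangle hx hFL a
  have h1 : ∫ y in convexHull ℝ (range x), (U y * fderiv ℝ φ y a + fderiv ℝ U y a * φ y) =
      ∫ y in convexHull ℝ (range x), fderiv ℝ F y a := by
    refine setIntegral_congr_ae (measurableSet_convexHull_range x) ?_
    filter_upwards [hU.ae_differentiableAt] with y hy hyT
    have h2 : F =ᶠ[nhds y] fun y => U y * φ y := by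
      filter_upwards [Metric.isOpen_ball.mem_nhds (hR hyT)] with z hz
      exact (hFe (Metric.ball_subset_closedBall hz)).symm
    rw [h2.fderiv_eq, fderiv_fun_mul hy (hφ.differentiable one_ne_zero y)]
    simp only [add_apply, smul_apply, smul_eq_mul]
    ring
  rw [h1, hmain]
  congr 1
  refine Finset.sum_congr rfl fun k _ => ?_
  congr 1
  refine intervalIntegral.integral_congr fun t ht => ?_
  rw [uIcc_of_le zero_le_one] at ht
  refine (hFe (Metric.ball_subset_closedBall (hR ?_))).symm
  refine (convex_convexHull ℝ _).segment_subset (subset_convexHull ℝ _ (mem_range_self (k + 1)))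
    (subset_convexHull ℝ _ (mem_range_self (k + 2))) ?_
  rw [segment_eq_image_lineMap]
  exact mem_image_of_mem _ ht

theorem affine_decomp (v : Plane →ᵃ[ℝ] ℝ) :
    (v : Plane → ℝ) = fun y => v.linear.toContinuousLinearMap y + v 0 := v.decomp

theorem contDiff_affine (v : Plane →ᵃ[ℝ] ℝ) : ContDiff ℝ 1 v := by
  rw [affine_decomp v]
  exact (ContinuousLinearMap.contDiff _).add contDiff_const

theorem fderiv_affine (v : Plane →ᵃ[ℝ] ℝ) (y a : Plane) : fderiv ℝ v y a = v.linear a := by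
  conv_lhs => rw [affine_decomp v]
  rw [fderiv_add_const, ContinuousLinearMap.fderiv]
  rfl

namespace Triangulation

variable {Ω : Set Plane} {M : Triangulation Ω}

/-- The derivative `ζ · ∇v`. -/
noncomputable def conv (ζ : Plane → Plane) (v : M.Vh) : M.Broken :=
  fun j x => ∑ i, ζ x i * v.dx i j x

theorem edgeInt_congr {p : M.Side} {f g : Plane → ℝ}
    (h : ∀ x ∈ segment ℝ (M.pt₁ p) (M.pt₂ p), f x = g x) : M.edgeInt p f = M.edgeInt p g := by
  unfold edgeInt segIntegral
  congr 1
  refine intervalIntegral.integral_congr fun t ht => h _ ?_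
  rw [uIcc_of_le zero_le_one] at ht
  rw [segment_eq_image_lineMap]
  exact mem_image_of_mem _ ht

theorem ae_tri {P : Plane → Prop} (hΩ : IsConvexPolygon Ω)
    (h : ∀ᵐ x ∂(volume.restrict Ω), P x) (j : Fin M.n) :
    ∀ᵐ x ∂(volume.restrict (M.tri j)), P x := by
  have hcl : volume.restrict (closure Ω) = volume.restrict Ω :=
    Measure.restrict_congr_set (closure_ae_eq_of_null_frontier (hΩ.convex.addHaar_frontier _))
  rw [← hcl] at h
  exact ae_restrict_of_ae_restrict_of_subset (tri_subset_closure j) h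

theorem integrableOn_tri {f : Plane → ℝ} {j : Fin M.n} (hf : ContinuousOn f (M.tri j)) :
    IntegrableOn f (M.tri j) := hf.integrableOn_compact (tri_isCompact j)

theorem memLp_tri (hΩ : IsConvexPolygon Ω) {f : Plane → ℝ} (hf : MemLp f ⊤ (volume.restrict Ω))
    (j : Fin M.n) : MemLp f ⊤ (volume.restrict (M.tri j)) := by
  have hcl : volume.restrict (closure Ω) = volume.restrict Ω :=
    Measure.restrict_congr_set (closure_ae_eq_of_null_frontier (hΩ.convex.addHaar_frontier _))
  rw [← hcl] at hf
  exact hf.mono_measure (Measure.restrict_mono (tri_subset_closure j) le_rfl)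

theorem integrableOn_mul_of_memLp (hΩ : IsConvexPolygon Ω) {f g : Plane → ℝ}
    (hf : MemLp f ⊤ (volume.restrict Ω)) {j : Fin M.n} (hg : ContinuousOn g (M.tri j)) :
    IntegrableOn (fun x => f x * g x) (M.tri j) := by
  exact (integrableOn_tri hg).mul_of_top_right (memLp_tri hΩ hf j)

/-- Integration by parts on a triangle, for one coordinate direction. -/
theorem integral_partial_tri (hΩ : IsConvexPolygon Ω) {u : Plane → ℝ} (hu : MemW1Inf Ω u)
    (hc : ContinuousOn u (closure Ω)) (i : Fin 2) (v w : M.Vh) (j : Fin M.n) :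
    ∫ x in M.tri j, (u x * v.dx i j x * w.fn j x + u x * w.dx i j x * v.fn j x
      + weakPartial Ω i u x * (v.fn j x * w.fn j x)) =
      ∑ k, M.normal (j, k) i * M.edgeInt (j, k) (fun x => u x * (v.fn j x * w.fn j x)) := by
  obtain ⟨K, U, hU, hUe, hUd⟩ := exists_lipschitz_extension hΩ.isOpen hΩ.convex hΩ.isBounded hu hc
  have hφ : ContDiff ℝ 1 fun x => v j x * w j x := (contDiff_affine _).mul (contDiff_affine _)
  have h := integral_mul_fderiv_triangle (M.indep j) hU hφ (unitVec i)
  have h1 : ∀ᵐ x ∂(volume.restrict (M.tri j)), fderiv ℝ U x (unitVec i) = weakPartial Ω i u x :=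
    ae_restrict_of_ae_restrict_of_subset (tri_subset_closure j) (hUd i)
  have h2 : ∫ x in M.tri j, (u x * v.dx i j x * w.fn j x + u x * w.dx i j x * v.fn j x
      + weakPartial Ω i u x * (v.fn j x * w.fn j x)) = ∫ x in M.tri j,
        (U x * fderiv ℝ (fun x => v j x * w j x) x (unitVec i)
          + fderiv ℝ U x (unitVec i) * (v j x * w j x)) := by
    refine integral_congr_ae ?_
    filter_upwards [h1, ae_restrict_mem (tri_isCompact j).isClosed.measurableSet] with x hx hxT
    rw [hx, fderiv_fun_mul ((contDiff_affine _).differentiable one_ne_zero x)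
      ((contDiff_affine _).differentiable one_ne_zero x), ← hUe (tri_subset_closure j hxT)]
    simp only [add_apply, smul_apply, smul_eq_mul,
      fderiv_affine, Vh.dx, Vh.fn]
    ring
  rw [h2]
  refine h.trans ?_
  rw [Finset.mul_sum]
  refine Finset.sum_congr rfl fun k _ => ?_
  have h3 : M.edgeInt (j, k) (fun x => u x * (v.fn j x * w.fn j x)) =
      M.edgeInt (j, k) (fun x => U x * (v j x * w j x)) :=
    edgeInt_congr fun x hx => by
      rw [hUe (tri_subset_closure j (segment_subset_tri (j, k) hx))]; rfl
  have h4 := M.len_mul_normal (j, k) i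
  rw [h3, edgeInt_eq]
  rw [area, mul_div_cancel₀ _ two_ne_zero] at h4
  change _ = -|crossArea (M.vtx j)| * baryGrad (M.indep j) k i at h4
  rw [baryGrad_apply] at h4
  linear_combination (-edgeMean (M.vtx j) k fun x => U x * (v j x * w j x)) * h4

end Triangulation

/-! ### Discrete derivatives in terms of gradients and jumps -/

/-- The Cauchy–Schwarz inequality for integrals. -/
theorem sq_integral_mul_le {α : Type*} [MeasurableSpace α] {μ : Measure α} {f g : α → ℝ}
    (hf : Integrable (fun x => f x ^ 2) μ) (hg : Integrable (fun x => g x ^ 2) μ)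
    (hfg : Integrable (fun x => f x * g x) μ) :
    (∫ x, f x * g x ∂μ) ^ 2 ≤ (∫ x, f x ^ 2 ∂μ) * ∫ x, g x ^ 2 ∂μ := by
  -- The quadratic polynomial in t is the integral of (f - tg)²; being nonnegative, it has
  -- discriminant at most zero.
  have h : ∀ t : ℝ, 0 ≤ (∫ x, g x ^ 2 ∂μ) * (t * t) + (-2 * ∫ x, f x * g x ∂μ) * t
      + ∫ x, f x ^ 2 ∂μ := by
    intro t
    have h1 : ∫ x, (f x - t * g x) ^ 2 ∂μ = (∫ x, f x ^ 2 ∂μ) - 2 * t * (∫ x, f x * g x ∂μ)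
        + t ^ 2 * ∫ x, g x ^ 2 ∂μ := by
      have h2 : ∀ x, (f x - t * g x) ^ 2 = f x ^ 2 - 2 * t * (f x * g x) + t ^ 2 * g x ^ 2 :=
        fun x => by ring
      simp only [h2]
      rw [integral_add (f := fun x => f x ^ 2 - 2 * t * (f x * g x)) (hf.sub (hfg.const_mul _))
        (hg.const_mul _), integral_sub hf (hfg.const_mul _), integral_const_mul,
        integral_const_mul]
    have h3 : 0 ≤ ∫ x, (f x - t * g x) ^ 2 ∂μ := integral_nonneg fun x => sq_nonneg _
    rw [h1] at h3
    linarith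
  have := discrim_le_zero h
  rw [discrim] at this
  nlinarith

namespace Triangulation

variable {Ω : Set Plane} {M : Triangulation Ω}

theorem edgeInt_add_smul {p : M.Side} {f g : Plane → ℝ}
    (hf : ContinuousOn f (segment ℝ (M.pt₁ p) (M.pt₂ p)))
    (hg : ContinuousOn g (segment ℝ (M.pt₁ p) (M.pt₂ p))) (a b : ℝ) :
    M.edgeInt p (fun x => a * f x + b * g x) = a * M.edgeInt p f + b * M.edgeInt p g := by
  rw [edgeInt_add (f := fun x => a * f x) (g := fun x => b * g x) (continuousOn_const.mul hf)
    (continuousOn_const.mul hg), edgeInt_smul, edgeInt_smul]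

theorem edgeInt_zero (p : M.Side) : M.edgeInt p (fun _ => 0) = 0 := by
  simp [edgeInt, segIntegral]

theorem edgeInt_nonneg {p : M.Side} {f : Plane → ℝ}
    (h : ∀ x ∈ segment ℝ (M.pt₁ p) (M.pt₂ p), 0 ≤ f x) : 0 ≤ M.edgeInt p f := by
  refine mul_nonneg dist_nonneg (intervalIntegral.integral_nonneg zero_le_one fun t ht => h _ ?_)
  rw [segment_eq_image_lineMap]
  exact mem_image_of_mem _ ht

theorem edgeInt_mono {p : M.Side} {f g : Plane → ℝ}
    (hf : ContinuousOn f (segment ℝ (M.pt₁ p) (M.pt₂ p)))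
    (hg : ContinuousOn g (segment ℝ (M.pt₁ p) (M.pt₂ p)))
    (h : ∀ x ∈ segment ℝ (M.pt₁ p) (M.pt₂ p), f x ≤ g x) : M.edgeInt p f ≤ M.edgeInt p g := by
  have h1 := edgeInt_add_smul hg hf 1 (-1)
  have h2 : 0 ≤ M.edgeInt p (fun x => 1 * g x + -1 * f x) :=
    edgeInt_nonneg fun x hx => by linarith [h x hx]
  rw [h1] at h2
  linarith

open Classical in
/-- The values of `u` on the other side of an edge (zero for boundary edges). -/
noncomputable def outer (u : M.Broken) (q : M.Side) : Plane → ℝ :=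
  if h : ∃ q', q ≠ q' ∧ M.edge q = M.edge q' then u h.choose.1 else 0

theorem outer_of_edge_eq (u : M.Broken) {p q : M.Side} (hne : p ≠ q) (he : M.edge p = M.edge q) :
    outer u p = u q.1 := by
  have h : ∃ q', p ≠ q' ∧ M.edge p = M.edge q' := ⟨q, hne, he⟩
  rw [outer, dif_pos h, edge_unique h.choose_spec.1 hne h.choose_spec.2 he]

theorem outer_of_mem_bdryEdges (hΩ : IsConvexPolygon Ω) (u : M.Broken) {p : M.Side}
    (hp : p ∈ M.bdryEdges) : outer u p = 0 := by
  rw [outer, dif_neg]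
  rintro ⟨q, hne, he⟩
  exact notMem_bdryEdges_of_edge_eq hΩ hne he hp

/-- The jump across an edge, seen from one of its sides. -/
noncomputable def sideJump (v : M.Vh) (q : M.Side) (x : Plane) : ℝ := v.fn q.1 x - outer v.fn q x

theorem continuous_outer (v : M.Vh) (q : M.Side) : Continuous (outer v.fn q) := by
  unfold outer
  split_ifs
  · exact fn_continuous v _
  · exact continuous_zero

theorem continuous_sideJump (v : M.Vh) (q : M.Side) : Continuous (sideJump v q) :=
  (fn_continuous v _).sub (continuous_outer v q)

/-- The sign of a wind. -/
def windSign : Wind → ℝ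
  | Wind.plus => 1
  | Wind.minus => -1

/-- The sides on which the jump enters the discrete derivative on the adjacent triangle. -/
def Seen (s : Wind) (i : Fin 2) (q : M.Side) : Prop :=
  q ∈ M.bdryEdges ∨ windSign s * M.normal q i < 0

theorem integral_dx_tri (i : Fin 2) (v w : M.Vh) (j : Fin M.n) :
    (∫ x in M.tri j, v.fn j x * w.dx i j x) + ∫ x in M.tri j, v.dx i j x * w.fn j x =
      ∑ k, M.normal (j, k) i * M.edgeInt (j, k) (fun x => v.fn j x * w.fn j x) := by
  obtain ⟨K, hK⟩ : ∃ K, LipschitzWith K (v j) := by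
    rw [affine_decomp]
    exact ⟨_, (ContinuousLinearMap.lipschitz (v j).linear.toContinuousLinearMap).add
      (LipschitzWith.const (v j 0))⟩
  have h := integral_mul_fderiv_triangle (M.indep j) hK (contDiff_affine (w j)) (unitVec i)
  simp only [fderiv_affine] at h
  rw [← integral_add (f := fun x => v.fn j x * w.dx i j x) (g := fun x => v.dx i j x * w.fn j x)
    (integrableOn_tri ((fn_continuous v j).mul continuous_const).continuousOn)
    (integrableOn_tri (continuous_const.mul (fn_continuous w j)).continuousOn)]
  refine h.trans ?_
  rw [Finset.mul_sum]
  refine Finset.sum_congr rfl fun k _ => ?_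
  have h4 := M.len_mul_normal (j, k) i
  rw [edgeInt_eq]
  rw [area, mul_div_cancel₀ _ two_ne_zero] at h4
  change _ = -|crossArea (M.vtx j)| * baryGrad (M.indep j) k i at h4
  rw [baryGrad_apply] at h4
  change _ = M.normal (j, k) i * (M.len (j, k) * edgeMean (M.vtx j) k fun x => v j x * w j x)
  linear_combination (-edgeMean (M.vtx j) k fun x => v j x * w j x) * h4

theorem l2_dx (i : Fin 2) (v w : M.Vh) : l2 v.fn (w.dx i) + l2 (v.dx i) w.fn =
    ∑ q : M.Side, M.normal q i * M.edgeInt q (fun x => v.fn q.1 x * w.fn q.1 x) := by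
  rw [Fintype.sum_prod_type, l2, l2, ← Finset.sum_add_distrib]
  exact Finset.sum_congr rfl fun j _ => integral_dx_tri i v w j

theorem normal_int {p : M.Side × M.Side} (hp : p ∈ M.intEdges) :
    M.normal p.2 = - M.normal p.1 :=
  normal_neg (ne_of_mem_intEdges hp) (mem_intEdges.1 hp).2

theorem normal_int_apply {p : M.Side × M.Side} (hp : p ∈ M.intEdges) (i : Fin 2) :
    M.normal p.2 i = - M.normal p.1 i := by
  rw [normal_int hp]; rfl

theorem edgeInt_int {p : M.Side × M.Side} (hp : p ∈ M.intEdges) (F : Plane → ℝ) :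
    M.edgeInt p.2 F = M.edgeInt p.1 F :=
  (edgeInt_comm (mem_intEdges.1 hp).2 F).symm

theorem sideJump_fst (v : M.Vh) {p : M.Side × M.Side} (hp : p ∈ M.intEdges) (x : Plane) :
    sideJump v p.1 x = v.fn p.1.1 x - v.fn p.2.1 x := by
  rw [sideJump, outer_of_edge_eq _ (ne_of_mem_intEdges hp) (mem_intEdges.1 hp).2]

theorem sideJump_snd (v : M.Vh) {p : M.Side × M.Side} (hp : p ∈ M.intEdges) (x : Plane) :
    sideJump v p.2 x = v.fn p.2.1 x - v.fn p.1.1 x := by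
  rw [sideJump, outer_of_edge_eq _ (ne_of_mem_intEdges hp).symm (mem_intEdges.1 hp).2.symm]

theorem sideJump_bdry (hΩ : IsConvexPolygon Ω) (v : M.Vh) {q : M.Side} (hq : q ∈ M.bdryEdges)
    (x : Plane) : sideJump v q x = v.fn q.1 x := by
  rw [sideJump, outer_of_mem_bdryEdges hΩ _ hq]
  simp

open Classical in
/-- The discrete derivatives in terms of the piecewise derivatives and the jumps. -/
theorem partialFunctional₀_eq (hΩ : IsConvexPolygon Ω) (s : Wind) (i : Fin 2) (v w : M.Vh) :
    partialFunctional₀ s i v.fn w = l2 (v.dx i) w.fn - ∑ q : M.Side, if Seen s i q then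
      M.normal q i * M.edgeInt q (fun x => sideJump v q x * w.fn q.1 x) else 0 := by
  have h := l2_dx i v w
  rw [sum_sides hΩ] at h ⊢
  rw [partialFunctional₀, eq_sub_of_add_eq h]
  have hb : ∑ q ∈ M.bdryEdges, (if Seen s i q then
      M.normal q i * M.edgeInt q (fun x => sideJump v q x * w.fn q.1 x) else 0) =
      ∑ q ∈ M.bdryEdges, M.normal q i * M.edgeInt q (fun x => v.fn q.1 x * w.fn q.1 x) := by
    refine Finset.sum_congr rfl fun q hq => ?_
    have hs : Seen s i q := Or.inl hq
    rw [if_pos hs]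
    simp only [sideJump_bdry hΩ v hq]
  have hi : ∀ p ∈ M.intEdges,
      M.edgeInt p.1 (fun x => trace s i v.fn p x * M.normal p.1 i * jump w.fn p x) =
      (M.normal p.1 i * M.edgeInt p.1 (fun x => v.fn p.1.1 x * w.fn p.1.1 x)
        + M.normal p.2 i * M.edgeInt p.2 (fun x => v.fn p.2.1 x * w.fn p.2.1 x))
      - ((if Seen s i p.1 then M.normal p.1 i *
            M.edgeInt p.1 (fun x => sideJump v p.1 x * w.fn p.1.1 x) else 0)
        + if Seen s i p.2 then M.normal p.2 i *
            M.edgeInt p.2 (fun x => sideJump v p.2 x * w.fn p.2.1 x) else 0) := by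
    intro p hp
    have hb1 : p.1 ∉ M.bdryEdges :=
      notMem_bdryEdges_of_edge_eq hΩ (ne_of_mem_intEdges hp) (mem_intEdges.1 hp).2
    have hb2 : p.2 ∉ M.bdryEdges :=
      notMem_bdryEdges_of_edge_eq hΩ (ne_of_mem_intEdges hp).symm (mem_intEdges.1 hp).2.symm
    have hc : ∀ j l, ContinuousOn (fun x => v.fn j x * w.fn l x)
        (segment ℝ (M.pt₁ p.1) (M.pt₂ p.1)) := fun j l =>
      ((fn_continuous v j).mul (fn_continuous w l)).continuousOn
    have e1 : ∀ j, M.edgeInt p.1 (fun x => sideJump v p.1 x * w.fn j x) =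
        M.edgeInt p.1 (fun x => v.fn p.1.1 x * w.fn j x)
          - M.edgeInt p.1 (fun x => v.fn p.2.1 x * w.fn j x) := fun j => by
      have := edgeInt_add_smul (hc p.1.1 j) (hc p.2.1 j) 1 (-1)
      rw [one_mul, neg_one_mul, ← sub_eq_add_neg] at this
      rw [← this]
      congr 1; ext x
      rw [sideJump_fst v hp]; ring
    have e2 : ∀ j, M.edgeInt p.1 (fun x => sideJump v p.2 x * w.fn j x) =
        M.edgeInt p.1 (fun x => v.fn p.2.1 x * w.fn j x)
          - M.edgeInt p.1 (fun x => v.fn p.1.1 x * w.fn j x) := fun j => by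
      have := edgeInt_add_smul (hc p.2.1 j) (hc p.1.1 j) 1 (-1)
      rw [one_mul, neg_one_mul, ← sub_eq_add_neg] at this
      rw [← this]
      congr 1; ext x
      rw [sideJump_snd v hp]; ring
    have e3 : ∀ j, M.edgeInt p.1 (fun x => v.fn j x * M.normal p.1 i * jump w.fn p x) =
        M.normal p.1 i * M.edgeInt p.1 (fun x => v.fn j x * w.fn p.1.1 x)
          - M.normal p.1 i * M.edgeInt p.1 (fun x => v.fn j x * w.fn p.2.1 x) := fun j => by
      have := edgeInt_add_smul (hc j p.1.1) (hc j p.2.1) (M.normal p.1 i) (-M.normal p.1 i)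
      rw [neg_mul, ← sub_eq_add_neg] at this
      rw [← this]
      congr 1; ext x
      rw [jump]; ring
    have e4 : M.normal p.1 i = 0 →
        M.edgeInt p.1 (fun x => trace s i v.fn p x * M.normal p.1 i * jump w.fn p x) = 0 := by
      intro h0
      rw [h0]
      simp [edgeInt_zero]
    simp only [edgeInt_int hp, normal_int_apply hp, Seen, hb1, hb2, false_or, e1, e2]
    obtain ⟨n, hn⟩ : ∃ n, M.normal p.1 i = n := ⟨_, rfl⟩
    rw [hn] at e3 e4 ⊢
    -- The normals on the two sides are opposite, so for n ≠ 0 a wind sees exactly one side, and the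
    -- trace is the value from the unseen one. Replacing the own trace by it costs a jump on the
    -- seen side only. For n = 0 the averaged trace is multiplied by zero.
    rcases lt_trichotomy n 0 with h0 | h0 | h0
    · have h1 : ¬ 0 < n := h0.le.not_gt
      have h2 : ¬ -n < 0 := by linarith
      cases s <;>
      · simp only [trace, windSign, hn, h0, h1, h2, if_true, if_false, one_mul, neg_mul, neg_neg, e3]
        ring
    · rw [e4 h0, h0]
      simp
    · have h1 : ¬ n < 0 := h0.le.not_gt
      have h2 : -n < 0 := by linarith
      cases s <;>
      · simp only [trace, windSign, hn, h0, h1, h2, if_true, if_false, one_mul, neg_mul, neg_neg, e3]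
        ring
  rw [Finset.sum_congr rfl hi, hb, Finset.sum_sub_distrib]
  ring

theorem partial₀_eq (s : Wind) (i : Fin 2) (v w : M.Vh) :
    l2 (partial₀ s i v.fn).fn w.fn = partialFunctional₀ s i v.fn w :=
  partial₀_spec (fun j => (fn_continuous v j).continuousOn) s i w

theorem l2_single (u : M.Broken) (j : Fin M.n) (g : Plane →ᵃ[ℝ] ℝ) :
    l2 u (Vh.fn (Pi.single j g : M.Vh)) = ∫ x in M.tri j, u j x * g x := by
  rw [l2, Finset.sum_eq_single j]
  · simp [Vh.fn]
  · intro l _ hl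
    simp [Vh.fn, Pi.single_eq_of_ne hl]
  · simp

open Classical in
/-- The discrete derivatives on a single triangle. -/
theorem integral_partial₀_tri (hΩ : IsConvexPolygon Ω) (s : Wind) (i : Fin 2) (v : M.Vh)
    (j : Fin M.n) (g : Plane →ᵃ[ℝ] ℝ) :
    ∫ x in M.tri j, (partial₀ s i v.fn).fn j x * g x =
      (v j).linear (unitVec i) * (∫ x in M.tri j, g x) - ∑ k, if Seen s i (j, k) then
        M.normal (j, k) i * M.edgeInt (j, k) (fun x => sideJump v (j, k) x * g x) else 0 := by
  rw [← l2_single, partial₀_eq, partialFunctional₀_eq hΩ, l2_single, Fintype.sum_prod_type,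
    Finset.sum_eq_single j]
  · simp only [Vh.dx, Vh.fn, Pi.single_eq_same, integral_const_mul]
  · intro l _ hl
    refine Finset.sum_eq_zero fun k _ => ?_
    have h0 : (fun x => sideJump v (l, k) x * Vh.fn (Pi.single j g : M.Vh) l x) = fun _ => 0 := by
      ext x
      simp [Vh.fn, Pi.single_eq_of_ne hl]
    simp only [h0, edgeInt_zero, mul_zero, ite_self]
  · simp

end Triangulation

/-! ### Control of the broken gradient by the discrete gradients -/

/-- The linear algebra behind the control of the gradient on a triangle with one boundary edge. -/
theorem abs_le_of_boundary_moments {a N₀ N₁ N₂ : Fin 2 → ℝ} {B μ E h A : ℝ}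
    (hh : 0 ≤ h) (hA : 0 < A)
    (h₀ : ∀ i, |a i - N₀ i * B| ≤ E) (h₁ : ∀ i, 0 ≤ N₁ i * N₂ i → |a i| ≤ E)
    (h₂ : ∀ i, N₁ i * N₂ i < 0 → |a i - N₁ i * μ| ≤ E)
    (hN : ∀ i, N₀ i + N₁ i + N₂ i = 0) (hN₀ : ∀ i, |N₀ i| ≤ h) (hN₁ : ∀ i, |N₁ i| ≤ h)
    (hcross : 2 * A ≤ |N₀ 0 * N₁ 1 - N₀ 1 * N₁ 0|) (i : Fin 2) :
    |a i| ≤ E * (1 + 2 * h ^ 2 / A) := by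
  -- Everything reduces to a bound of the unknown boundary moment B, which does not depend on i.
  -- Either one coordinate gives it directly, or the two coordinates give it together.
  have key : A * |B| ≤ 2 * E * h := by
    by_cases hc : ∃ i, 0 ≤ N₁ i * N₂ i
    · obtain ⟨i, hi⟩ := hc
      have e1 : |N₀ i * B| ≤ 2 * E := by
        have := abs_sub_abs_le_abs_sub (N₀ i * B) (a i)
        rw [abs_sub_comm] at this
        linarith [h₀ i, h₁ i hi]
      -- No cancellation takes place in N₀ = -(N₁ + N₂) when both terms have the same sign. The
      -- cross product bound then keeps |N₀ i| away from zero, so B can be recovered from N₀ i * B.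
      have e2 : |N₁ i| ≤ |N₀ i| := by
        have : N₀ i = -(N₁ i + N₂ i) := by linarith [hN i]
        rw [this, abs_neg, ← sq_le_sq]
        nlinarith [sq_nonneg (N₂ i)]
      have e3 : ∀ k l : Fin 2, |N₀ k * N₁ l - N₀ l * N₁ k| ≤ |N₀ k| * |N₁ l| + |N₀ l| * |N₁ k| :=
        fun k l => by
          rw [← abs_mul, ← abs_mul]; exact abs_sub _ _
      have e4 : A ≤ h * |N₀ i| := by
        have e5 := e3 0 1
        fin_cases i
        · simp only [Fin.zero_eta] at e2 ⊢
          nlinarith [mul_le_mul (hN₀ 1) e2 (abs_nonneg _) hh,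
            mul_le_mul_of_nonneg_left (hN₁ 1) (abs_nonneg (N₀ 0))]
        · simp only [Fin.mk_one] at e2 ⊢
          nlinarith [mul_le_mul (hN₀ 0) e2 (abs_nonneg _) hh,
            mul_le_mul_of_nonneg_left (hN₁ 0) (abs_nonneg (N₀ 1))]
      rw [abs_mul] at e1
      nlinarith [mul_le_mul_of_nonneg_right e4 (abs_nonneg B), mul_le_mul_of_nonneg_left e1 hh]
    · push Not at hc
      have e1 : ∀ i, |N₁ i * μ - N₀ i * B| ≤ 2 * E := fun i => by
        have e2 : N₁ i * μ - N₀ i * B = (a i - N₀ i * B) - (a i - N₁ i * μ) := by ring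
        rw [e2]
        have := abs_sub (a i - N₀ i * B) (a i - N₁ i * μ)
        linarith [h₀ i, h₂ i (hc i)]
      -- In this case N₀B and N₁μ approximate the same vector a. The cross product with N₁ removes
      -- μ, and N₀, N₁ are transversal by `hcross`.
      have e3 : (N₀ 0 * N₁ 1 - N₀ 1 * N₁ 0) * B =
          N₁ 0 * (N₁ 1 * μ - N₀ 1 * B) - N₁ 1 * (N₁ 0 * μ - N₀ 0 * B) := by ring
      have e4 : |N₀ 0 * N₁ 1 - N₀ 1 * N₁ 0| * |B| ≤ h * (2 * E) + h * (2 * E) := by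
        rw [← abs_mul, e3]
        refine (abs_sub _ _).trans ?_
        rw [abs_mul, abs_mul]
        exact add_le_add (mul_le_mul (hN₁ 0) (e1 1) (abs_nonneg _) hh)
          (mul_le_mul (hN₁ 1) (e1 0) (abs_nonneg _) hh)
      nlinarith [mul_le_mul_of_nonneg_right hcross (abs_nonneg B)]
  have e1 : |a i| ≤ E + |N₀ i * B| := by
    have := abs_sub_abs_le_abs_sub (a i) (N₀ i * B)
    linarith [h₀ i]
  have e2 : |N₀ i * B| ≤ h * (2 * E * h / A) := by
    rw [abs_mul]
    refine mul_le_mul (hN₀ i) ?_ (abs_nonneg _) hh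
    rw [le_div_iff₀ hA]
    linarith
  calc |a i| ≤ E + h * (2 * E * h / A) := e1.trans (by linarith)
    _ = _ := by ring

/-- Pigeonhole on three signs. Applied to the i-th components of the normals, the wind s sees
neither of the sides m + 1 and m + 2 when these are interior, while the coordinate of vertex m
vanishes on the remaining side. -/
theorem exists_two_same_sign (f : Fin 3 → ℝ) : ∃ (s : Wind) (m : Fin 3),
    0 ≤ Triangulation.windSign s * f (m + 1) ∧ 0 ≤ Triangulation.windSign s * f (m + 2) := by
  have e1 : (1 : Fin 3) + 1 = 2 := rfl
  have e2 : (1 : Fin 3) + 2 = 0 := rfl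
  have e3 : (2 : Fin 3) + 1 = 0 := rfl
  have e4 : (2 : Fin 3) + 2 = 1 := rfl
  have key : ∀ m : Fin 3, (0 ≤ f (m + 1) ∧ 0 ≤ f (m + 2)) ∨ (f (m + 1) ≤ 0 ∧ f (m + 2) ≤ 0) →
      ∃ (s : Wind) (m : Fin 3),
    0 ≤ Triangulation.windSign s * f (m + 1) ∧ 0 ≤ Triangulation.windSign s * f (m + 2) := by
    rintro m (h | h)
    · exact ⟨Wind.plus, m, by simpa [Triangulation.windSign] using h⟩
    · exact ⟨Wind.minus, m, by simpa [Triangulation.windSign] using h⟩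
  rcases le_total 0 (f 0) with h0 | h0 <;> rcases le_total 0 (f 1) with h1 | h1 <;>
    rcases le_total 0 (f 2) with h2 | h2
  · exact key 0 (Or.inl ⟨h1, h2⟩)
  · exact key 2 (Or.inl ⟨h0, h1⟩)
  · exact key 1 (Or.inl ⟨h2, h0⟩)
  · exact key 0 (Or.inr ⟨h1, h2⟩)
  · exact key 0 (Or.inl ⟨h1, h2⟩)
  · exact key 1 (Or.inr ⟨h2, h0⟩)
  · exact key 2 (Or.inr ⟨h0, h1⟩)
  · exact key 0 (Or.inr ⟨h1, h2⟩)

namespace Triangulation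

variable {Ω : Set Plane} {M : Triangulation Ω}

/-- The squared norms of all discrete derivatives on a triangle. -/
noncomputable def gradTri (v : M.Vh) (j : Fin M.n) : ℝ :=
  ∑ i, ((∫ x in M.tri j, (partial₀ Wind.plus i v.fn).fn j x ^ 2)
    + ∫ x in M.tri j, (partial₀ Wind.minus i v.fn).fn j x ^ 2)

theorem integral_sq_nonneg (f : Plane → ℝ) (s : Set Plane) : 0 ≤ ∫ x in s, f x ^ 2 :=
  integral_nonneg fun _ => sq_nonneg _

theorem gradTri_nonneg (v : M.Vh) (j : Fin M.n) : 0 ≤ gradTri v j :=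
  Finset.sum_nonneg fun _ _ => add_nonneg (integral_sq_nonneg _ _) (integral_sq_nonneg _ _)

theorem integral_sq_le_gradTri (v : M.Vh) (j : Fin M.n) (s : Wind) (i : Fin 2) :
    ∫ x in M.tri j, (partial₀ s i v.fn).fn j x ^ 2 ≤ gradTri v j := by
  have h : (∫ x in M.tri j, (partial₀ Wind.plus i v.fn).fn j x ^ 2)
    + (∫ x in M.tri j, (partial₀ Wind.minus i v.fn).fn j x ^ 2) ≤ gradTri v j :=
    Finset.single_le_sum (f := fun i => (∫ x in M.tri j, (partial₀ Wind.plus i v.fn).fn j x ^ 2)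
      + ∫ x in M.tri j, (partial₀ Wind.minus i v.fn).fn j x ^ 2)
      (fun i _ => add_nonneg (integral_sq_nonneg _ _) (integral_sq_nonneg _ _))
      (Finset.mem_univ i)
  cases s
  · linarith [integral_sq_nonneg ((partial₀ Wind.minus i v.fn).fn j) (M.tri j)]
  · linarith [integral_sq_nonneg ((partial₀ Wind.plus i v.fn).fn j) (M.tri j)]

/-- Moments of the discrete derivatives against functions with values in `[0, 1]`. -/
theorem abs_integral_partial₀_le (v : M.Vh) (j : Fin M.n) (s : Wind) (i : Fin 2)
    (g : Plane →ᵃ[ℝ] ℝ) (hg : ∀ x ∈ M.tri j, g x ∈ Icc (0 : ℝ) 1) :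
    |∫ x in M.tri j, (partial₀ s i v.fn).fn j x * g x| ≤ √(M.area j * gradTri v j) := by
  refine Real.abs_le_sqrt ?_
  have hd := fn_continuous (partial₀ s i v.fn) j
  have hc := continuous_affine g
  refine (sq_integral_mul_le (integrableOn_tri (hd.pow 2).continuousOn)
    (integrableOn_tri (hc.pow 2).continuousOn) (integrableOn_tri (hd.mul hc).continuousOn)).trans ?_
  rw [mul_comm]
  refine mul_le_mul ?_ (integral_sq_le_gradTri v j s i) (integral_sq_nonneg _ _) (M.area_pos j).le
  rw [← volume_real_tri]
  have h1 : ∫ x in M.tri j, g x ^ 2 ≤ ∫ x in M.tri j, (1 : ℝ) := by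
    refine setIntegral_mono_on (integrableOn_tri (hc.pow 2).continuousOn)
      (integrableOn_tri continuousOn_const) (tri_isCompact j).isClosed.measurableSet fun x hx => ?_
    have := hg x hx
    simp only [mem_Icc] at this
    nlinarith
  refine h1.trans (le_of_eq ?_)
  simp

theorem bary_mem_Icc (p : M.Side) {x : Plane} (hx : x ∈ M.tri p.1) : M.bary p x ∈ Icc (0 : ℝ) 1 :=
  coord_mem_Icc (M.indep p.1) hx p.2

theorem integral_bary (j : Fin M.n) (m : Fin 3) :
    ∫ x in M.tri j, M.bary (j, m) x = M.area j / 3 := by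
  refine (integral_affine_triangle (M.indep j) _).trans ?_
  rw [bary_vtx, bary_vtx, bary_vtx, area]
  fin_cases m <;> simp <;> ring

open Classical in
/-- The moments of the discrete derivatives against barycentric coordinates. -/
theorem abs_moment_le (hΩ : IsConvexPolygon Ω) (v : M.Vh) (j : Fin M.n) (s : Wind) (i : Fin 2)
    (m : Fin 3) :
    |(v j).linear (unitVec i) * (M.area j / 3) -
      ((if Seen s i (j, m + 1) then M.len (j, m + 1) * M.normal (j, m + 1) i *
        edgeMean (M.vtx j) (m + 1) (fun x => sideJump v (j, m + 1) x * M.bary (j, m) x) else 0)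
      + if Seen s i (j, m + 2) then M.len (j, m + 2) * M.normal (j, m + 2) i *
        edgeMean (M.vtx j) (m + 2) (fun x => sideJump v (j, m + 2) x * M.bary (j, m) x) else 0)|
      ≤ √(M.area j * gradTri v j) := by
  have h := abs_integral_partial₀_le v j s i (M.bary (j, m)) fun x hx => bary_mem_Icc (j, m) hx
  rw [integral_partial₀_tri hΩ, integral_bary, sum_fin3 m] at h
  have h0 : M.edgeInt (j, m) (fun x => sideJump v (j, m) x * M.bary (j, m) x) = 0 := by
    rw [← edgeInt_zero (j, m)]
    refine edgeInt_congr fun x hx => ?_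
    rw [segment_eq_image_lineMap] at hx
    obtain ⟨t, -, rfl⟩ := hx
    rw [bary_lineMap, bary_pt₁, bary_pt₂]
    ring
  rw [h0, mul_zero, ite_self, zero_add] at h
  convert h using 4
  · simp only [edgeInt_eq]
    split_ifs <;> ring
  · simp only [edgeInt_eq]
    split_ifs <;> ring

/-- Normals scaled by the edge lengths are the edge vectors rotated by a right angle, so their cross
product is, up to sign, that of two edge vectors. -/
theorem cross_normal (j : Fin M.n) (k : Fin 3) :
    |M.len (j, k) * M.normal (j, k) 0 * (M.len (j, k + 1) * M.normal (j, k + 1) 1)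
      - M.len (j, k) * M.normal (j, k) 1 * (M.len (j, k + 1) * M.normal (j, k + 1) 0)|
      = 2 * M.area j := by
  have h0 := crossArea_ne_zero (M.indep j)
  obtain ⟨a0, a1⟩ := crossArea_mul_baryGrad (M.indep j) k
  obtain ⟨b0, b1⟩ := crossArea_mul_baryGrad (M.indep j) (k + 1)
  have hc := crossArea_rotate (M.vtx j) (k + 1)
  have e1 : k + 1 + 1 = k + 2 := by rw [add_assoc]; rfl
  have e2 : k + 1 + 2 = k := by rw [add_assoc]; simp
  rw [e1, e2] at b0 b1 hc
  simp only [len_mul_normal]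
  change |-(2 * M.area j) * baryGrad (M.indep j) k 0 * (-(2 * M.area j) *
    baryGrad (M.indep j) (k + 1) 1) - -(2 * M.area j) * baryGrad (M.indep j) k 1 *
    (-(2 * M.area j) * baryGrad (M.indep j) (k + 1) 0)| = _
  rw [area, mul_div_cancel₀ _ two_ne_zero]
  congr 1
  have h1 : |crossArea (M.vtx j)| * |crossArea (M.vtx j)| =
    crossArea (M.vtx j) * crossArea (M.vtx j) := abs_mul_abs_self _
  calc _ = |crossArea (M.vtx j)| * |crossArea (M.vtx j)| * (baryGrad (M.indep j) k 0 *
        baryGrad (M.indep j) (k + 1) 1 - baryGrad (M.indep j) k 1 *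
        baryGrad (M.indep j) (k + 1) 0) := by ring
    _ = (crossArea (M.vtx j) * baryGrad (M.indep j) k 0) *
        (crossArea (M.vtx j) * baryGrad (M.indep j) (k + 1) 1)
        - (crossArea (M.vtx j) * baryGrad (M.indep j) k 1) *
        (crossArea (M.vtx j) * baryGrad (M.indep j) (k + 1) 0) := by rw [h1]; ring
    _ = _ := by rw [a0, a1, b0, b1]; linear_combination -hc

theorem abs_len_mul_normal_le (p : M.Side) (i : Fin 2) :
    |M.len p * M.normal p i| ≤ M.diamT p.1 := by
  rw [abs_mul, abs_of_pos (M.len_pos p)]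
  have h1 : |M.normal p i| ≤ 1 := by
    rw [← M.norm_normal p]; exact PiLp.norm_apply_le (M.normal p) i
  have h2 := M.len_le_diamT p
  have h3 := M.len_pos p
  nlinarith [abs_nonneg (M.normal p i)]

theorem sum_len_mul_normal (j : Fin M.n) (k : Fin 3) (i : Fin 2) :
    M.len (j, k) * M.normal (j, k) i + M.len (j, k + 1) * M.normal (j, k + 1) i
      + M.len (j, k + 2) * M.normal (j, k + 2) i = 0 := by
  simp only [len_mul_normal]
  have h := congrArg (fun y : Plane => y i) (M.sum_grad j)
  have h1 : (∑ k, M.grad (j, k)) i = ∑ k, M.grad (j, k) i := by simp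
  simp only [h1, PiLp.zero_apply, sum_fin3 k] at h
  linear_combination (-(2 * M.area j)) * h

/-- The gradient on a triangle with at most one boundary edge is controlled by the discrete
derivatives. -/
theorem sq_dx_mul_area_le_gradTri (hΩ : IsConvexPolygon Ω) {ρ : ℝ} (hρ : 0 < ρ)
    (hreg : M.ShapeRegular ρ) (hM : M.AtMostOneBoundaryEdge) (v : M.Vh) (j : Fin M.n) (i : Fin 2) :
    M.area j * (v j).linear (unitVec i) ^ 2 ≤ (3 * (1 + 4 / ρ ^ 2)) ^ 2 * gradTri v j := by
  classical
  obtain ⟨E, hE⟩ : ∃ E, E = √(M.area j * gradTri v j) := ⟨_, rfl⟩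
  have hE0 : 0 ≤ E := hE ▸ Real.sqrt_nonneg _
  have hE2 : E ^ 2 = M.area j * gradTri v j := by
    rw [hE, Real.sq_sqrt (mul_nonneg (M.area_pos j).le (gradTri_nonneg v j))]
  have hA := M.area_pos j
  have hmom := fun s i m => abs_moment_le hΩ v j s i m
  rw [← hE] at hmom
  -- The moments carry a factor |T|/3, and E² is |T| times the discrete energy on T. Squaring
  -- therefore leaves one factor |T| to cancel.
  suffices hs : |(v j).linear (unitVec i) * (M.area j / 3)| ≤ E * (1 + 4 / ρ ^ 2) by
    have h1 : |(v j).linear (unitVec i) * (M.area j / 3)| ^ 2 ≤ (E * (1 + 4 / ρ ^ 2)) ^ 2 :=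
      pow_le_pow_left₀ (abs_nonneg _) hs 2
    rw [sq_abs, mul_pow E, hE2] at h1
    have h2 : M.area j * (M.area j * (v j).linear (unitVec i) ^ 2) ≤
        M.area j * ((3 * (1 + 4 / ρ ^ 2)) ^ 2 * gradTri v j) := by nlinarith
    exact le_of_mul_le_mul_left h2 hA
  have hE1 : E ≤ E * (1 + 4 / ρ ^ 2) := by
    have : 0 ≤ 4 / ρ ^ 2 := by positivity
    nlinarith
  by_cases hb : ∃ b, (j, b) ∈ M.bdryEdges
  · obtain ⟨b, hb⟩ := hb
    have hnb : ∀ k, k ≠ b → (j, k) ∉ M.bdryEdges := fun k hk h =>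
      hk (congrArg Prod.snd (hM _ h _ hb rfl))
    have hb1 := hnb (b + 1) (ne_add_one b).symm
    have hb2 := hnb (b + 2) (ne_add_two b).symm
    have e1 : b + 1 + 1 = b + 2 := by rw [add_assoc]; rfl
    have e2 : b + 1 + 2 = b := by rw [add_assoc]; simp
    have hsb : ∀ s i, Seen s i (j, b) := fun s i => Or.inl hb
    have hs1 : ∀ s i, Seen s i (j, b + 1) ↔ windSign s * M.normal (j, b + 1) i < 0 := fun s i => by
      simp [Seen, hb1]
    have hs2 : ∀ s i, Seen s i (j, b + 2) ↔ windSign s * M.normal (j, b + 2) i < 0 := fun s i => by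
      simp [Seen, hb2]
    have hwind : ∀ r : ℝ, ∃ s, 0 ≤ windSign s * r := fun r => by
      rcases le_total 0 r with h | h
      · exact ⟨Wind.plus, by simpa [windSign] using h⟩
      · exact ⟨Wind.minus, by simpa [windSign] using h⟩
    refine (abs_le_of_boundary_moments (a := fun i => (v j).linear (unitVec i) * (M.area j / 3))
      (N₀ := fun i => M.len (j, b) * M.normal (j, b) i)
      (N₁ := fun i => M.len (j, b + 1) * M.normal (j, b + 1) i)
      (N₂ := fun i => M.len (j, b + 2) * M.normal (j, b + 2) i)
      (B := edgeMean (M.vtx j) b fun x => sideJump v (j, b) x * M.bary (j, b + 1) x)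
      (μ := edgeMean (M.vtx j) (b + 1) fun x => sideJump v (j, b + 1) x * M.bary (j, b) x)
      (h := M.diamT j) (E := E) (M.diamT_pos j).le hA ?_ ?_ ?_ (fun i => sum_len_mul_normal j b i)
      (fun i => abs_len_mul_normal_le (j, b) i) (fun i => abs_len_mul_normal_le (j, b + 1) i)
      (cross_normal j b).ge i).trans ?_
    · intro i
      -- The coordinate of vertex b + 1 vanishes on side b + 1, and this wind does not see side b +
      -- 2: only the boundary side contributes.
      obtain ⟨s, hs⟩ := hwind (M.normal (j, b + 2) i)
      have h := hmom s i (b + 1)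
      rw [e1, e2, if_neg (fun h => hs.not_gt ((hs2 s i).1 h)), if_pos (hsb s i), zero_add] at h
      exact h
    · intro i hi
      -- The coordinate of vertex b vanishes on the boundary side. Both interior sides have the same
      -- sign and are hidden from one wind, so no jump is left.
      have hpos := mul_pos (M.len_pos (j, b + 1)) (M.len_pos (j, b + 2))
      have hi' : 0 ≤ M.normal (j, b + 1) i * M.normal (j, b + 2) i := by
        by_contra! hcon
        nlinarith
      have : ∃ s, 0 ≤ windSign s * M.normal (j, b + 1) i ∧ 0 ≤ windSign s * M.normal (j, b + 2) i := by
        rcases mul_nonneg_iff.1 hi' with h | h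
        · exact ⟨Wind.plus, by simpa [windSign] using h⟩
        · exact ⟨Wind.minus, by simpa [windSign] using h⟩
      obtain ⟨s, h1, h2⟩ := this
      have h := hmom s i b
      rw [if_neg (fun h => h1.not_gt ((hs1 s i).1 h)), if_neg (fun h => h2.not_gt ((hs2 s i).1 h)),
        add_zero, sub_zero] at h
      exact h
    · intro i hi
      -- For opposite signs no wind hides both interior sides; the chosen one sees b + 1 only, with
      -- a moment μ that does not depend on i.
      have hpos := mul_pos (M.len_pos (j, b + 1)) (M.len_pos (j, b + 2))
      have hi' : M.normal (j, b + 1) i * M.normal (j, b + 2) i < 0 := by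
        by_contra! hcon
        nlinarith
      have : ∃ s, windSign s * M.normal (j, b + 1) i < 0 ∧ 0 ≤ windSign s * M.normal (j, b + 2) i := by
        rcases mul_neg_iff.1 hi' with h | h
        · exact ⟨Wind.minus, by simpa [windSign] using ⟨h.1, h.2.le⟩⟩
        · exact ⟨Wind.plus, by simpa [windSign] using ⟨h.1, h.2.le⟩⟩
      obtain ⟨s, h1, h2⟩ := this
      have h := hmom s i b
      rw [if_pos ((hs1 s i).2 h1), if_neg (fun h => h2.not_gt ((hs2 s i).1 h)), add_zero] at h
      exact h
    · refine mul_le_mul_of_nonneg_left ?_ hE0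
      have h1 := hreg.sq_le_area hρ j
      have h2 : 2 * M.diamT j ^ 2 / M.area j ≤ 4 / ρ ^ 2 := by
        rw [div_le_div_iff₀ hA (by positivity)]
        nlinarith
      linarith
  · push Not at hb
    obtain ⟨s, m, h1, h2⟩ := exists_two_same_sign fun k => M.normal (j, k) i
    have h := hmom s i m
    have hs : ∀ k, 0 ≤ windSign s * M.normal (j, k) i → ¬ Seen s i (j, k) := fun k hk h => by
      rcases h with h | h
      · exact hb k h
      · exact hk.not_gt h
    rw [if_neg (hs _ h1), if_neg (hs _ h2), add_zero, sub_zero] at h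
    exact h.trans hE1

theorem sum_gradTri_le (σ : Sym2 Plane → ℝ) (hσ : ∀ p : M.Side, 0 ≤ σ (M.edge p)) (v : M.Vh) :
    ∑ j, gradTri v j ≤ 2 * normDSq σ v := by
  have h1 : ∑ j, gradTri v j = (∑ i, l2 (partial₀ Wind.plus i v.fn).fn (partial₀ Wind.plus i v.fn).fn)
      + ∑ i, l2 (partial₀ Wind.minus i v.fn).fn (partial₀ Wind.minus i v.fn).fn := by
    simp only [gradTri, l2, ← sq]
    rw [Finset.sum_comm, ← Finset.sum_add_distrib]
    exact Finset.sum_congr rfl fun i _ => Finset.sum_add_distrib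
  have h2 : 0 ≤ ∑ p ∈ M.intEdges, σ (M.edge p.1) / M.len p.1 *
      M.edgeInt p.1 (fun x => jump v.fn p x ^ 2) := Finset.sum_nonneg fun p _ =>
    mul_nonneg (div_nonneg (hσ _) (M.len_pos _).le) (edgeInt_nonneg fun x _ => sq_nonneg _)
  have h3 : 0 ≤ ∑ p ∈ M.bdryEdges, σ (M.edge p) / M.len p *
      M.edgeInt p (fun x => v.fn p.1 x ^ 2) := Finset.sum_nonneg fun p _ =>
    mul_nonneg (div_nonneg (hσ _) (M.len_pos _).le) (edgeInt_nonneg fun x _ => sq_nonneg _)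
  rw [h1, normDSq]
  linarith

/-- The contribution of a side to the penalty term. -/
noncomputable def sidePenalty (σ : Sym2 Plane → ℝ) (v : M.Vh) (q : M.Side) : ℝ :=
  σ (M.edge q) / M.len q * M.edgeInt q (fun x => sideJump v q x ^ 2)

theorem sidePenalty_nonneg {σ : Sym2 Plane → ℝ} (hσ : ∀ p : M.Side, 0 ≤ σ (M.edge p)) (v : M.Vh)
    (q : M.Side) : 0 ≤ sidePenalty σ v q :=
  mul_nonneg (div_nonneg (hσ _) (M.len_pos _).le) (edgeInt_nonneg fun _ _ => sq_nonneg _)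

/-- An interior edge is counted from both of its sides, with jumps that differ in sign only; hence
the factor 2. -/
theorem sum_sidePenalty_le (hΩ : IsConvexPolygon Ω) {σ : Sym2 Plane → ℝ}
    (hσ : ∀ p : M.Side, 0 ≤ σ (M.edge p)) (v : M.Vh) :
    ∑ q, sidePenalty σ v q ≤ 2 * normDSq σ v := by
  rw [sum_sides hΩ]
  have h1 : ∀ p ∈ M.intEdges, sidePenalty σ v p.1 + sidePenalty σ v p.2 =
      2 * (σ (M.edge p.1) / M.len p.1 * M.edgeInt p.1 (fun x => jump v.fn p x ^ 2)) := by
    intro p hp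
    have he := (mem_intEdges.1 hp).2
    have e1 : M.edgeInt p.1 (fun x => sideJump v p.1 x ^ 2) =
        M.edgeInt p.1 (fun x => jump v.fn p x ^ 2) := by
      congr 1; ext x; rw [sideJump_fst v hp, jump]
    have e2 : M.edgeInt p.1 (fun x => sideJump v p.2 x ^ 2) =
        M.edgeInt p.1 (fun x => jump v.fn p x ^ 2) := by
      congr 1; ext x; rw [sideJump_snd v hp, jump]; ring
    rw [sidePenalty, sidePenalty, ← he, ← len_comm he, edgeInt_int hp, e1, e2]
    ring
  have h2 : ∀ q ∈ M.bdryEdges, sidePenalty σ v q =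
      σ (M.edge q) / M.len q * M.edgeInt q (fun x => v.fn q.1 x ^ 2) := by
    intro q hq
    simp only [sidePenalty, sideJump_bdry hΩ v hq]
  rw [Finset.sum_congr rfl h1, Finset.sum_congr rfl h2, ← Finset.mul_sum]
  have h3 : 0 ≤ (∑ i, l2 (partial₀ Wind.plus i v.fn).fn (partial₀ Wind.plus i v.fn).fn)
      + ∑ i, l2 (partial₀ Wind.minus i v.fn).fn (partial₀ Wind.minus i v.fn).fn := by
    simp only [l2, ← sq]
    exact add_nonneg (Finset.sum_nonneg fun i _ => Finset.sum_nonneg fun j _ =>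
      integral_sq_nonneg _ _) (Finset.sum_nonneg fun i _ => Finset.sum_nonneg fun j _ =>
      integral_sq_nonneg _ _)
  have h4 : 0 ≤ ∑ p ∈ M.bdryEdges, σ (M.edge p) / M.len p *
      M.edgeInt p (fun x => v.fn p.1 x ^ 2) := Finset.sum_nonneg fun p _ =>
    mul_nonneg (div_nonneg (hσ _) (M.len_pos _).le) (edgeInt_nonneg fun x _ => sq_nonneg _)
  rw [normDSq]
  linarith

theorem sq_edgeMean_le (x : Fin 3 → Plane) (k : Fin 3) {F : Plane → ℝ} (hF : Continuous F) :
    edgeMean x k F ^ 2 ≤ edgeMean x k fun y => F y ^ 2 := by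
  have hc : Continuous fun t : ℝ => F (AffineMap.lineMap (x (k + 1)) (x (k + 2)) t) :=
    hF.comp AffineMap.lineMap_continuous
  have hi : ∀ {f : ℝ → ℝ}, Continuous f → IntegrableOn f (Ioc 0 1) := fun hf =>
    (hf.integrableOn_Icc).mono_set Ioc_subset_Icc_self
  have h := sq_integral_mul_le (f := fun t : ℝ => F (AffineMap.lineMap (x (k + 1)) (x (k + 2)) t))
    (g := fun _ => (1 : ℝ)) (hi (hc.pow 2)) (hi (by fun_prop)) (hi (by fun_prop))
  simp only [edgeMean, intervalIntegral.integral_of_le zero_le_one]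
  simpa using h

open Classical in
/-- The gradient on a triangle is controlled by the discrete derivatives and the penalties. -/
theorem sq_dx_mul_area_le_sidePenalty (hΩ : IsConvexPolygon Ω) {ρ : ℝ} (hρ : 0 < ρ)
    (hreg : M.ShapeRegular ρ) {σ : Sym2 Plane → ℝ} {σmin : ℝ} (hσmin : 0 < σmin)
    (hσ : ∀ p : M.Side, σmin ≤ σ (M.edge p)) (v : M.Vh) (j : Fin M.n) (i : Fin 2) :
    M.area j * (v j).linear (unitVec i) ^ 2 ≤
      4 * gradTri v j + 8 / (ρ ^ 2 * σmin) * ∑ k, sidePenalty σ v (j, k) := by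
  have hA := M.area_pos j
  have h := integral_partial₀_tri hΩ Wind.plus i v j (AffineMap.const ℝ Plane 1)
  have hb := abs_integral_partial₀_le v j Wind.plus i (AffineMap.const ℝ Plane 1)
    fun x _ => by simp
  have h1 : ∫ x in M.tri j, (AffineMap.const ℝ Plane (1 : ℝ)) x = M.area j := by
    rw [← volume_real_tri]; simp
  rw [h1] at h
  have hE0 : 0 ≤ M.area j * gradTri v j := mul_nonneg hA.le (gradTri_nonneg v j)
  have hterm : ∀ k, (if Seen Wind.plus i (j, k) then M.normal (j, k) i * M.edgeInt (j, k)
      (fun x => sideJump v (j, k) x * (AffineMap.const ℝ Plane (1 : ℝ)) x) else 0) ^ 2 ≤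
      M.diamT j ^ 2 / σmin * sidePenalty σ v (j, k) := by
    intro k
    have hp : 0 ≤ M.diamT j ^ 2 / σmin * sidePenalty σ v (j, k) :=
      mul_nonneg (by positivity) (sidePenalty_nonneg (fun p => hσmin.le.trans (hσ p)) v _)
    split_ifs
    · simp only [AffineMap.const_apply, mul_one]
      obtain ⟨m, hm⟩ : ∃ m, m = edgeMean (M.vtx j) k (sideJump v (j, k)) := ⟨_, rfl⟩
      obtain ⟨m2, hm2⟩ : ∃ m2, m2 = edgeMean (M.vtx j) k (fun x => sideJump v (j, k) x ^ 2) :=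
        ⟨_, rfl⟩
      have e1 : m ^ 2 ≤ m2 := by
        rw [hm, hm2]; exact sq_edgeMean_le _ _ (continuous_sideJump v _)
      have e2 : M.edgeInt (j, k) (fun x => sideJump v (j, k) x) = M.len (j, k) * m := by
        rw [hm]; exact edgeInt_eq _ _ _
      have e3 : M.edgeInt (j, k) (fun x => sideJump v (j, k) x ^ 2) = M.len (j, k) * m2 := by
        rw [hm2]; exact edgeInt_eq _ _ _
      have hl := (M.len_pos (j, k)).ne'
      have e4 : sidePenalty σ v (j, k) = σ (M.edge (j, k)) * m2 := by
        rw [sidePenalty, e3]; field_simp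
      rw [e2, e4]
      have e5 := abs_len_mul_normal_le (M := M) (j, k) i
      have e6 : (M.len (j, k) * M.normal (j, k) i) ^ 2 ≤ M.diamT j ^ 2 := by
        rw [← sq_abs]; exact pow_le_pow_left₀ (abs_nonneg _) e5 2
      have e7 : m2 ≤ σ (M.edge (j, k)) * m2 / σmin := by
        rw [le_div_iff₀ hσmin]
        nlinarith [hσ (j, k), sq_nonneg m]
      calc (M.normal (j, k) i * (M.len (j, k) * m)) ^ 2
          = (M.len (j, k) * M.normal (j, k) i) ^ 2 * m ^ 2 := by ring
        _ ≤ M.diamT j ^ 2 * (σ (M.edge (j, k)) * m2 / σmin) :=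
          mul_le_mul e6 (e1.trans e7) (sq_nonneg _) (sq_nonneg _)
        _ = _ := by ring
    · simpa using hp
  obtain ⟨f, hf⟩ : ∃ f : Fin 3 → ℝ, f = fun k => if Seen Wind.plus i (j, k) then
      M.normal (j, k) i * M.edgeInt (j, k)
      (fun x => sideJump v (j, k) x * (AffineMap.const ℝ Plane (1 : ℝ)) x) else 0 := ⟨_, rfl⟩
  have hterm' : ∀ k, f k ^ 2 ≤ M.diamT j ^ 2 / σmin * sidePenalty σ v (j, k) := fun k => by
    rw [hf]; exact hterm k
  have h' : ∫ x in M.tri j, (partial₀ Wind.plus i v.fn).fn j x * (AffineMap.const ℝ Plane (1 : ℝ)) x =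
      (v j).linear (unitVec i) * M.area j - ∑ k, f k := by rw [hf]; exact h
  obtain ⟨D, hD⟩ : ∃ D, D = ∫ x in M.tri j, (partial₀ Wind.plus i v.fn).fn j x *
    (AffineMap.const ℝ Plane (1 : ℝ)) x := ⟨_, rfl⟩
  rw [← hD] at h' hb
  have hD2 : D ^ 2 ≤ M.area j * gradTri v j := by
    rw [← sq_abs, ← Real.sq_sqrt hE0]; exact pow_le_pow_left₀ (abs_nonneg _) hb 2
  rw [Fin.sum_univ_three] at h' ⊢
  -- Here the test function is the constant 1, so the gradient is one moment plus at most three jump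
  -- terms. The 4 comes from squaring a sum of four numbers.
  have e1 : ((v j).linear (unitVec i) * M.area j) ^ 2 ≤ 4 * (D ^ 2 + f 0 ^ 2 + f 1 ^ 2 + f 2 ^ 2) := by
    have : (v j).linear (unitVec i) * M.area j = D + f 0 + f 1 + f 2 := by linarith
    rw [this]
    nlinarith [sq_nonneg (D - f 0), sq_nonneg (D - f 1), sq_nonneg (D - f 2), sq_nonneg (f 0 - f 1),
      sq_nonneg (f 0 - f 2), sq_nonneg (f 1 - f 2)]
  have hpen : ∀ k, 0 ≤ sidePenalty σ v (j, k) := fun k =>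
    sidePenalty_nonneg (fun p => hσmin.le.trans (hσ p)) v _
  have e2 : M.diamT j ^ 2 / σmin ≤ M.area j * (2 / (ρ ^ 2 * σmin)) := by
    have := hreg.sq_le_area hρ j
    rw [mul_div_assoc', div_le_div_iff₀ hσmin (by positivity)]
    nlinarith
  have e3 : ∀ k, f k ^ 2 ≤ M.area j * (2 / (ρ ^ 2 * σmin)) * sidePenalty σ v (j, k) := fun k =>
    (hterm' k).trans (mul_le_mul_of_nonneg_right e2 (hpen k))
  have e4 : M.area j * (M.area j * (v j).linear (unitVec i) ^ 2) ≤ M.area j * (4 * gradTri v j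
      + 8 / (ρ ^ 2 * σmin) * (sidePenalty σ v (j, 0) + sidePenalty σ v (j, 1)
        + sidePenalty σ v (j, 2))) := by
    have e5 : (8 : ℝ) / (ρ ^ 2 * σmin) = 4 * (2 / (ρ ^ 2 * σmin)) := by ring
    rw [e5]
    linarith [e3 0, e3 1, e3 2]
  exact le_of_mul_le_mul_left e4 hA

/-- The broken gradient is controlled by the norm `‖·‖_d`. -/
theorem exists_sum_grad_le (ρ σmin : ℝ) (hρ : 0 < ρ) (hσmin : 0 < σmin) :
    ∃ C : ℝ, 0 < C ∧ ∀ {Ω : Set Plane}, IsConvexPolygon Ω → ∀ M : Triangulation Ω,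
      M.ShapeRegular ρ → ∀ σ : Sym2 Plane → ℝ, (∀ p : M.Side, 0 ≤ σ (M.edge p)) →
      (M.AtMostOneBoundaryEdge ∨ ∀ p : M.Side, σmin ≤ σ (M.edge p)) → ∀ v : M.Vh,
      ∑ j, M.area j * ∑ i, (v j).linear (unitVec i) ^ 2 ≤ C * normDSq σ v := by
  -- The 4 is 2 · 2: there are two coordinate directions, and the sums of `gradTri` and of
  -- `sidePenalty` are each at most 2‖v‖_d². The bracket covers both alternatives at once.
  refine ⟨4 * ((3 * (1 + 4 / ρ ^ 2)) ^ 2 + 4 + 8 / (ρ ^ 2 * σmin)), by positivity, ?_⟩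
  intro Ω hΩ M hreg σ hσ hor v
  have hg := sum_gradTri_le σ hσ v
  have hp := sum_sidePenalty_le hΩ hσ v
  have hg0 : 0 ≤ ∑ j, gradTri v j := Finset.sum_nonneg fun j _ => gradTri_nonneg v j
  rw [Fintype.sum_prod_type] at hp
  have hp0 : 0 ≤ ∑ j, ∑ k, sidePenalty σ v (j, k) :=
    Finset.sum_nonneg fun j _ => Finset.sum_nonneg fun k _ => sidePenalty_nonneg hσ v _
  have a1 : 0 ≤ (3 * (1 + 4 / ρ ^ 2)) ^ 2 := by positivity
  have a2 : 0 ≤ 8 / (ρ ^ 2 * σmin) := by positivity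
  have key : ∀ j i, M.area j * (v j).linear (unitVec i) ^ 2 ≤
      ((3 * (1 + 4 / ρ ^ 2)) ^ 2 + 4) * gradTri v j
        + 8 / (ρ ^ 2 * σmin) * ∑ k, sidePenalty σ v (j, k) := by
    intro j i
    have hg1 := gradTri_nonneg v j
    have hp1 : 0 ≤ ∑ k, sidePenalty σ v (j, k) :=
      Finset.sum_nonneg fun k _ => sidePenalty_nonneg hσ v _
    rcases hor with h | h
    · have := sq_dx_mul_area_le_gradTri hΩ hρ hreg h v j i
      nlinarith [mul_nonneg a2 hp1]
    · have := sq_dx_mul_area_le_sidePenalty hΩ hρ hreg hσmin h v j i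
      nlinarith [mul_nonneg a1 hg1]
  have h1 : ∑ j, M.area j * ∑ i, (v j).linear (unitVec i) ^ 2 ≤
      ∑ j, (2 * ((3 * (1 + 4 / ρ ^ 2)) ^ 2 + 4) * gradTri v j
        + 2 * (8 / (ρ ^ 2 * σmin)) * ∑ k, sidePenalty σ v (j, k)) := by
    refine Finset.sum_le_sum fun j _ => ?_
    rw [Fin.sum_univ_two]
    linarith [key j 0, key j 1]
  rw [Finset.sum_add_distrib, ← Finset.mul_sum, ← Finset.mul_sum] at h1
  have h2 : 2 * ((3 * (1 + 4 / ρ ^ 2)) ^ 2 + 4) * ∑ j, gradTri v j ≤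
      2 * ((3 * (1 + 4 / ρ ^ 2)) ^ 2 + 4) * (2 * normDSq σ v) :=
    mul_le_mul_of_nonneg_left hg (by positivity)
  have h3 : 2 * (8 / (ρ ^ 2 * σmin)) * ∑ j, ∑ k, sidePenalty σ v (j, k) ≤
      2 * (8 / (ρ ^ 2 * σmin)) * (2 * normDSq σ v) :=
    mul_le_mul_of_nonneg_left hp (by positivity)
  linarith

/-! ### Integration by parts and coercivity for the upwind form -/

/-- The normal component `ζ · n`, seen from a side. -/
noncomputable def flux (ζ : Plane → Plane) (q : M.Side) (x : Plane) : ℝ :=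
  inner ℝ (ζ x) (M.normal q)

theorem flux_eq_sum (ζ : Plane → Plane) (q : M.Side) (x : Plane) :
    flux ζ q x = ∑ i, ζ x i * M.normal q i := by
  rw [flux, inner_plane, Fin.sum_univ_two]

theorem continuousOn_flux {ζ : Plane → Plane} (hζc : ContinuousOn ζ (closure Ω)) (q : M.Side) :
    ContinuousOn (flux ζ q) (segment ℝ (M.pt₁ q) (M.pt₂ q)) :=
  (hζc.mono ((segment_subset_tri q).trans (tri_subset_closure q.1))).inner continuousOn_const

theorem continuousOn_coord {ζ : Plane → Plane} (hζc : ContinuousOn ζ (closure Ω)) (i : Fin 2) :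
    ContinuousOn (fun x => ζ x i) (closure Ω) :=
  (EuclideanSpace.proj i : Plane →L[ℝ] ℝ).continuous.comp_continuousOn hζc

theorem continuousOn_coord_mul {ζ : Plane → Plane} (hζc : ContinuousOn ζ (closure Ω)) (i : Fin 2)
    (v : M.Vh) (j : Fin M.n) : ContinuousOn (fun x => ζ x i * v.fn j x) (M.tri j) :=
  ((continuousOn_coord hζc i).mono (tri_subset_closure j)).mul (fn_continuous v j).continuousOn

theorem continuousOn_conv {ζ : Plane → Plane} (hζc : ContinuousOn ζ (closure Ω))
    (v : M.Vh) (j : Fin M.n) : ContinuousOn (conv ζ v j) (M.tri j) :=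
  continuousOn_finsetSum _ fun i _ =>
    ((continuousOn_coord hζc i).mono (tri_subset_closure j)).mul continuousOn_const

theorem flux_int {p : M.Side × M.Side} (hp : p ∈ M.intEdges) (ζ : Plane → Plane) (x : Plane) :
    flux ζ p.2 x = - flux ζ p.1 x := by
  rw [flux, normal_int hp, inner_neg_right, flux]

theorem edgeInt_sum {p : M.Side} {ι : Type*} (s : Finset ι) {f : ι → Plane → ℝ}
    (hf : ∀ i ∈ s, ContinuousOn (f i) (segment ℝ (M.pt₁ p) (M.pt₂ p))) :
    M.edgeInt p (fun x => ∑ i ∈ s, f i x) = ∑ i ∈ s, M.edgeInt p (f i) := by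
  classical
  induction s using Finset.induction_on with
  | empty => simp [edgeInt_zero]
  | insert a s ha ih =>
    simp only [Finset.sum_insert ha]
    rw [← ih fun i hi => hf i (Finset.mem_insert_of_mem hi)]
    exact edgeInt_add (f := f a) (g := fun x => ∑ i ∈ s, f i x) (hf a (Finset.mem_insert_self a s))
      (continuousOn_finsetSum _ fun i hi => hf i (Finset.mem_insert_of_mem hi))

theorem l2_coord_dx {ζ : Plane → Plane} (hζc : ContinuousOn ζ (closure Ω)) (v w : M.Vh) :
    ∑ i, l2 (fun j x => ζ x i * v.fn j x) (w.dx i) = l2 v.fn (conv ζ w) := by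
  simp only [l2]
  rw [Finset.sum_comm]
  refine Finset.sum_congr rfl fun j _ => ?_
  rw [← integral_finsetSum (f := fun i x => ζ x i * v.fn j x * w.dx i j x) _ fun i _ =>
    integrableOn_tri ((continuousOn_coord_mul hζc i v j).mul continuousOn_const)]
  congr 1; ext x
  rw [conv, Finset.mul_sum]
  exact Finset.sum_congr rfl fun i _ => by ring

theorem continuousOn_fn (v : M.Vh) (j : Fin M.n) (s : Set Plane) : ContinuousOn (v.fn j) s :=
  (fn_continuous v j).continuousOn

theorem continuousOn_jump (v : M.Vh) (p : M.Side × M.Side) (s : Set Plane) :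
    ContinuousOn (jump v.fn p) s := (continuousOn_fn v _ s).sub (continuousOn_fn v _ s)

theorem continuousOn_avg (v : M.Vh) (p : M.Side × M.Side) (s : Set Plane) :
    ContinuousOn (avg v.fn p) s :=
  ((continuousOn_fn v _ s).add (continuousOn_fn v _ s)).div_const 2

/-- On an interior edge the two winds take the values from opposite sides, or both take the average,
so their sum is always twice the average. -/
theorem partialFunctional_avg {ζ : Plane → Plane} (hζc : ContinuousOn ζ (closure Ω)) (v w : M.Vh)
    (i : Fin 2) :
    partialFunctional Wind.plus i (fun j x => ζ x i * v.fn j x) w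
      + partialFunctional Wind.minus i (fun j x => ζ x i * v.fn j x) w =
    2 * (∑ p ∈ M.intEdges, M.edgeInt p.1
        (fun x => ζ x i * M.normal p.1 i * (avg v.fn p x * jump w.fn p x))
      + ∑ p ∈ M.bdryEdges, M.edgeInt p
        (fun x => ζ x i * M.normal p i * (v.fn p.1 x * w.fn p.1 x))
      - l2 (fun j x => ζ x i * v.fn j x) (w.dx i)) := by
  have hu := fun j => continuousOn_coord_mul hζc i v j
  have hi : ∀ p ∈ M.intEdges,
      M.edgeInt p.1 (fun x => trace Wind.plus i (fun j x => ζ x i * v.fn j x) p x *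
        M.normal p.1 i * jump w.fn p x)
      + M.edgeInt p.1 (fun x => trace Wind.minus i (fun j x => ζ x i * v.fn j x) p x *
        M.normal p.1 i * jump w.fn p x) =
      2 * M.edgeInt p.1 (fun x => ζ x i * M.normal p.1 i * (avg v.fn p x * jump w.fn p x)) := by
    intro p hp
    have hc := fun s => ((trace_continuousOn hu s i hp).mul
      (continuousOn_const (c := M.normal p.1 i))).mul (continuousOn_jump w p _)
    have h := edgeInt_add (hc Wind.plus) (hc Wind.minus)
    refine h.symm.trans ?_
    rw [← edgeInt_smul]
    congr 1; ext x
    simp only [Pi.mul_apply, trace, avg]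
    split_ifs <;> ring
  have hb : ∀ p ∈ M.bdryEdges,
      M.edgeInt p (fun x => ζ x i * v.fn p.1 x * M.normal p i * w.fn p.1 x) =
      M.edgeInt p (fun x => ζ x i * M.normal p i * (v.fn p.1 x * w.fn p.1 x)) := by
    intro p _
    congr 1; ext x; ring
  have hi' := Finset.sum_congr (rfl : M.intEdges = M.intEdges) hi
  rw [Finset.sum_add_distrib, ← Finset.mul_sum] at hi'
  simp only [partialFunctional]
  rw [Finset.sum_congr rfl hb]
  linarith

/-- Summing the averaged derivatives over i assembles the components ζ_i n_i into the flux ζ·n. The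
result is the DG divergence with central flux. -/
theorem l2_avgDiv {ζ : Plane → Plane} (hζc : ContinuousOn ζ (closure Ω)) (v w : M.Vh) :
    l2 (avgDiv fun i j x => ζ x i * v.fn j x).fn w.fn =
    ∑ p ∈ M.intEdges, M.edgeInt p.1 (fun x => flux ζ p.1 x * (avg v.fn p x * jump w.fn p x))
      + ∑ p ∈ M.bdryEdges, M.edgeInt p (fun x => flux ζ p x * (v.fn p.1 x * w.fn p.1 x))
      - l2 v.fn (conv ζ w) := by
  change l2Form M (avgDiv fun i j x => ζ x i * v.fn j x) w = _
  simp only [avgDiv, discDiv, map_smul, map_add, map_sum, LinearMap.smul_apply,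
    LinearMap.add_apply, LinearMap.sum_apply, ← Finset.sum_add_distrib]
  have h : ∀ i, l2Form M (discPartial Wind.plus i fun j x => ζ x i * v.fn j x) w
      + l2Form M (discPartial Wind.minus i fun j x => ζ x i * v.fn j x) w = _ := fun i => by
    refine Eq.trans ?_ (partialFunctional_avg hζc v w i)
    exact congrArg₂ (· + ·)
      (discPartial_spec (fun j => continuousOn_coord_mul hζc i v j) Wind.plus i w)
      (discPartial_spec (fun j => continuousOn_coord_mul hζc i v j) Wind.minus i w)
  simp only [h]
  rw [← Finset.mul_sum, Finset.sum_sub_distrib, Finset.sum_add_distrib, l2_coord_dx hζc,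
    Finset.sum_comm (s := Finset.univ) (t := M.intEdges),
    Finset.sum_comm (s := Finset.univ) (t := M.bdryEdges), smul_eq_mul]
  have hc : ∀ q : M.Side, ∀ g : Plane → ℝ, Continuous g →
      ∑ i, M.edgeInt q (fun x => ζ x i * M.normal q i * g x) =
        M.edgeInt q (fun x => flux ζ q x * g x) := by
    intro q g hg
    have h := edgeInt_sum (p := q) (Finset.univ : Finset (Fin 2))
      (f := fun i x => ζ x i * M.normal q i * g x) fun i _ => (((continuousOn_coord hζc i).mono
        ((segment_subset_tri q).trans (tri_subset_closure q.1))).mul continuousOn_const).mul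
        hg.continuousOn
    rw [← h]
    congr 1; ext x
    rw [flux_eq_sum, Finset.sum_mul]
  have h1 : ∀ p ∈ M.intEdges, _ := fun p _ => hc p.1 (fun x => avg v.fn p x * jump w.fn p x)
    ((((fn_continuous v _).add (fn_continuous v _)).div_const 2).mul
      ((fn_continuous w _).sub (fn_continuous w _)))
  have h2 : ∀ p ∈ M.bdryEdges, _ := fun p _ => hc p (fun x => v.fn p.1 x * w.fn p.1 x)
    ((fn_continuous v _).mul (fn_continuous w _))
  rw [Finset.sum_congr rfl h1, Finset.sum_congr rfl h2]
  ring

/-- Integration by parts for `ζ · ∇` on the mesh. -/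
theorem l2_conv_add (hΩ : IsConvexPolygon Ω) {ζ : Plane → Plane}
    (hζ : ∀ i, MemW1Inf Ω (fun x => ζ x i)) (hζc : ContinuousOn ζ (closure Ω)) (v w : M.Vh) :
    l2 (conv ζ v) w.fn + l2 v.fn (conv ζ w) + l2 (fun j x => weakDiv Ω ζ x * v.fn j x) w.fn =
    ∑ p ∈ M.intEdges, M.edgeInt p.1 (fun x => flux ζ p.1 x *
        (v.fn p.1.1 x * w.fn p.1.1 x - v.fn p.2.1 x * w.fn p.2.1 x))
      + ∑ p ∈ M.bdryEdges, M.edgeInt p (fun x => flux ζ p x * (v.fn p.1 x * w.fn p.1 x)) := by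
  have hseg : ∀ q : M.Side, ∀ i, ContinuousOn (fun x => ζ x i) (segment ℝ (M.pt₁ q) (M.pt₂ q)) :=
    fun q i => (continuousOn_coord hζc i).mono
      ((segment_subset_tri q).trans (tri_subset_closure q.1))
  have hwp : ∀ i, MemLp (weakPartial Ω i fun x => ζ x i) ⊤ (volume.restrict Ω) := fun i =>
    (isWeakPartial_weakPartial ((hζ i).2 i)).1
  have hq : ∀ q : M.Side, ∑ i, M.normal q i * M.edgeInt q
      (fun x => ζ x i * (v.fn q.1 x * w.fn q.1 x)) =
      M.edgeInt q (fun x => flux ζ q x * (v.fn q.1 x * w.fn q.1 x)) := by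
    intro q
    simp only [← edgeInt_smul]
    have h := edgeInt_sum (p := q) (Finset.univ : Finset (Fin 2))
      (f := fun i x => M.normal q i * (ζ x i * (v.fn q.1 x * w.fn q.1 x))) fun i _ =>
        continuousOn_const.mul ((hseg q i).mul ((continuousOn_fn v _ _).mul (continuousOn_fn w _ _)))
    rw [← h]
    congr 1; ext x
    rw [flux_eq_sum, Finset.sum_mul]
    exact Finset.sum_congr rfl fun i _ => by ring
  have hj : ∀ j, (∫ x in M.tri j, conv ζ v j x * w.fn j x) + (∫ x in M.tri j, v.fn j x * conv ζ w j x)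
      + ∫ x in M.tri j, weakDiv Ω ζ x * v.fn j x * w.fn j x =
      ∑ k, M.edgeInt (j, k) (fun x => flux ζ (j, k) x * (v.fn j x * w.fn j x)) := by
    intro j
    have hv := continuousOn_fn v j (M.tri j)
    have hw := continuousOn_fn w j (M.tri j)
    have hd : ∀ i, IntegrableOn (fun x => weakPartial Ω i (fun x => ζ x i) x * (v.fn j x * w.fn j x))
        (M.tri j) := fun i => integrableOn_mul_of_memLp hΩ (hwp i) (hv.mul hw)
    have e3 : ∀ x, weakDiv Ω ζ x * v.fn j x * w.fn j x =
        ∑ i, weakPartial Ω i (fun x => ζ x i) x * (v.fn j x * w.fn j x) := fun x => by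
      rw [weakDiv, mul_assoc, Finset.sum_mul]
    have hd' : IntegrableOn (fun x => weakDiv Ω ζ x * v.fn j x * w.fn j x) (M.tri j) := by
      simp only [e3]
      exact integrable_finsetSum _ fun i _ => hd i
    have h1 : IntegrableOn (fun x => conv ζ v j x * w.fn j x) (M.tri j) :=
      integrableOn_tri ((continuousOn_conv hζc v j).mul hw)
    have h2 : IntegrableOn (fun x => v.fn j x * conv ζ w j x) (M.tri j) :=
      integrableOn_tri (hv.mul (continuousOn_conv hζc w j))
    have h12 : IntegrableOn (fun x => conv ζ v j x * w.fn j x + v.fn j x * conv ζ w j x)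
      (M.tri j) := h1.add h2
    rw [← integral_add h1 h2, ← integral_add h12 hd']
    have h4 := fun i => integral_partial_tri hΩ (hζ i) (continuousOn_coord hζc i) i v w j
    have h5 := Finset.sum_congr (rfl : (Finset.univ : Finset (Fin 2)) = _) fun i _ => h4 i
    rw [Finset.sum_comm, Finset.sum_congr rfl fun k _ => hq (j, k)] at h5
    rw [← h5, ← integral_finsetSum]
    · congr 1; ext x
      rw [e3, conv, conv, Finset.sum_mul, Finset.mul_sum, ← Finset.sum_add_distrib,
        ← Finset.sum_add_distrib]
      exact Finset.sum_congr rfl fun i _ => by ring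
    · intro i _
      have hz := (continuousOn_coord hζc i).mono (tri_subset_closure j)
      exact (integrableOn_tri (((hz.mul continuousOn_const).mul hw).add
        ((hz.mul continuousOn_const).mul hv))).add (hd i)
  have hs := Finset.sum_congr (rfl : (Finset.univ : Finset (Fin M.n)) = _) fun j _ => hj j
  rw [Finset.sum_add_distrib, Finset.sum_add_distrib] at hs
  change l2 (conv ζ v) w.fn + l2 v.fn (conv ζ w) + l2 (fun j x => weakDiv Ω ζ x * v.fn j x) w.fn = _
    at hs
  rw [hs, ← Fintype.sum_prod_type (f := fun q : M.Side =>
    M.edgeInt q (fun x => flux ζ q x * (v.fn q.1 x * w.fn q.1 x))), sum_sides hΩ]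
  congr 1
  refine Finset.sum_congr rfl fun p hp => ?_
  rw [edgeInt_int hp]
  have hfl := continuousOn_flux hζc p.1
  have hc : ∀ l, ContinuousOn (fun x => flux ζ p.1 x * (v.fn l x * w.fn l x))
      (segment ℝ (M.pt₁ p.1) (M.pt₂ p.1)) := fun l =>
    hfl.mul ((continuousOn_fn v _ _).mul (continuousOn_fn w _ _))
  have h1 := edgeInt_add_smul (hc p.1.1) (hc p.2.1) 1 (-1)
  have h2 : M.edgeInt p.1 (fun x => flux ζ p.2 x * (v.fn p.2.1 x * w.fn p.2.1 x)) =
      - M.edgeInt p.1 (fun x => flux ζ p.1 x * (v.fn p.2.1 x * w.fn p.2.1 x)) := by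
    rw [← neg_one_mul, ← edgeInt_smul]
    congr 1; ext x
    rw [flux_int hp]; ring
  rw [h2]
  rw [one_mul, neg_one_mul] at h1
  rw [← h1]
  congr 1; ext x; ring

theorem memLp_weakDiv {ζ : Plane → Plane} (hζ : ∀ i, MemW1Inf Ω (fun x => ζ x i)) :
    MemLp (weakDiv Ω ζ) ⊤ (volume.restrict Ω) :=
  memLp_finsetSum _ fun i _ => (isWeakPartial_weakPartial ((hζ i).2 i)).1

theorem l2_sub_smul (hΩ : IsConvexPolygon Ω) {f g : Plane → ℝ}
    (hf : MemLp f ⊤ (volume.restrict Ω)) (hg : MemLp g ⊤ (volume.restrict Ω)) (c : ℝ) (v w : M.Vh) :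
    l2 (fun j x => (f x - c * g x) * v.fn j x) w.fn =
      l2 (fun j x => f x * v.fn j x) w.fn - c * l2 (fun j x => g x * v.fn j x) w.fn := by
  simp only [l2]
  rw [Finset.mul_sum, ← Finset.sum_sub_distrib]
  refine Finset.sum_congr rfl fun j _ => ?_
  have hvw := (continuousOn_fn v j (M.tri j)).mul (continuousOn_fn w j (M.tri j))
  have h1 := integrableOn_mul_of_memLp hΩ hf hvw
  have h2 := (integrableOn_mul_of_memLp hΩ hg hvw).const_mul c
  simp only [Pi.mul_apply, ← mul_assoc] at h1 h2
  rw [← integral_const_mul]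
  simp only [← mul_assoc]
  rw [← integral_sub h1 h2]
  congr 1; ext x; ring

/-- The upwind form after integration by parts. -/
theorem formUpw_eq (hΩ : IsConvexPolygon Ω) {ζ : Plane → Plane}
    (hζ : ∀ i, MemW1Inf Ω (fun x => ζ x i)) (hζc : ContinuousOn ζ (closure Ω)) {γ : Plane → ℝ}
    (hγ : MemLp γ ⊤ (volume.restrict Ω)) (v w : M.Vh) :
    formUpw ζ γ v w = l2 (conv ζ v) w.fn + l2 (fun j x => γ x * v.fn j x) w.fn
      + ∑ p ∈ M.intEdges, M.edgeInt p.1 (fun x =>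
        1 / 2 * |flux ζ p.1 x| * (jump v.fn p x * jump w.fn p x)
          - flux ζ p.1 x * (jump v.fn p x * avg w.fn p x))
      + ∑ p ∈ M.bdryEdges, M.edgeInt p (fun x =>
        max (-flux ζ p x) 0 * (v.fn p.1 x * w.fn p.1 x)) := by
  have h := l2_conv_add hΩ hζ hζc v w
  have hr := l2_sub_smul hΩ hγ (memLp_weakDiv hζ) 1 v w
  simp only [one_mul] at hr
  -- Pointwise identity on an edge: {v}[w] - (v⁺w⁺ - v⁻w⁻) = -[v]{w}.
  have hi : ∀ p ∈ M.intEdges, M.edgeInt p.1 (fun x =>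
        1 / 2 * |flux ζ p.1 x| * (jump v.fn p x * jump w.fn p x)
          - flux ζ p.1 x * (jump v.fn p x * avg w.fn p x)) =
      M.edgeInt p.1 (fun x =>
        1 / 2 * |inner ℝ (ζ x) (M.normal p.1)| * jump v.fn p x * jump w.fn p x)
      + M.edgeInt p.1 (fun x => flux ζ p.1 x * (avg v.fn p x * jump w.fn p x))
      - M.edgeInt p.1 (fun x => flux ζ p.1 x *
        (v.fn p.1.1 x * w.fn p.1.1 x - v.fn p.2.1 x * w.fn p.2.1 x)) := by
    intro p _
    have hfl := continuousOn_flux hζc p.1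
    have c1 : ContinuousOn (fun x =>
        1 / 2 * |inner ℝ (ζ x) (M.normal p.1)| * jump v.fn p x * jump w.fn p x)
        (segment ℝ (M.pt₁ p.1) (M.pt₂ p.1)) :=
      ((continuousOn_const.mul hfl.abs).mul (continuousOn_jump v p _)).mul (continuousOn_jump w p _)
    have c2 : ContinuousOn (fun x => flux ζ p.1 x * (avg v.fn p x * jump w.fn p x))
        (segment ℝ (M.pt₁ p.1) (M.pt₂ p.1)) :=
      hfl.mul ((continuousOn_avg v p _).mul (continuousOn_jump w p _))
    have c3 : ContinuousOn (fun x => flux ζ p.1 x *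
        (v.fn p.1.1 x * w.fn p.1.1 x - v.fn p.2.1 x * w.fn p.2.1 x))
        (segment ℝ (M.pt₁ p.1) (M.pt₂ p.1)) :=
      hfl.mul (((continuousOn_fn v _ _).mul (continuousOn_fn w _ _)).sub
        ((continuousOn_fn v _ _).mul (continuousOn_fn w _ _)))
    have h1 := edgeInt_add_smul c2 c3 1 (-1)
    have h2 := edgeInt_add (g := fun x => 1 * (flux ζ p.1 x * (avg v.fn p x * jump w.fn p x)) +
        -1 * (flux ζ p.1 x * (v.fn p.1.1 x * w.fn p.1.1 x - v.fn p.2.1 x * w.fn p.2.1 x))) c1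
      ((continuousOn_const.mul c2).add (continuousOn_const.mul c3))
    rw [one_mul, neg_one_mul, ← sub_eq_add_neg] at h1
    rw [add_sub_assoc, ← h1]
    refine Eq.trans ?_ h2
    congr 1; ext x
    simp only [flux, jump, avg]
    ring
  have hb : ∀ p ∈ M.bdryEdges, M.edgeInt p (fun x =>
        max (-flux ζ p x) 0 * (v.fn p.1 x * w.fn p.1 x)) =
      M.edgeInt p ({x | inner ℝ (ζ x) (M.normal p) < 0}.indicator
        fun x => |inner ℝ (ζ x) (M.normal p)| * v.fn p.1 x * w.fn p.1 x) := by
    intro p _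
    congr 1; ext x
    rw [flux]
    by_cases hx : inner ℝ (ζ x) (M.normal p) < 0
    · rw [indicator_of_mem (by exact hx), abs_of_neg hx, max_eq_left (by linarith), mul_assoc]
    · rw [indicator_of_notMem (by exact hx), max_eq_right (by linarith), zero_mul]
  rw [Finset.sum_congr rfl hi, Finset.sum_congr rfl hb, Finset.sum_sub_distrib,
    Finset.sum_add_distrib, formUpw, formAR, l2_avgDiv hζc, hr, inflow, upwind]
  linarith

/-- The upwind form on the diagonal. -/
theorem formUpw_self (hΩ : IsConvexPolygon Ω) {ζ : Plane → Plane}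
    (hζ : ∀ i, MemW1Inf Ω (fun x => ζ x i)) (hζc : ContinuousOn ζ (closure Ω)) {γ : Plane → ℝ}
    (hγ : MemLp γ ⊤ (volume.restrict Ω)) (v : M.Vh) :
    formUpw ζ γ v v = l2 (fun j x => (γ x - 1 / 2 * weakDiv Ω ζ x) * v.fn j x) v.fn
      + ∑ p ∈ M.intEdges, M.edgeInt p.1 (fun x => 1 / 2 * |flux ζ p.1 x| * jump v.fn p x ^ 2)
      + ∑ p ∈ M.bdryEdges, M.edgeInt p (fun x => 1 / 2 * |flux ζ p x| * v.fn p.1 x ^ 2) := by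
  have h := l2_conv_add hΩ hζ hζc v v
  rw [l2_comm v.fn] at h
  rw [formUpw_eq hΩ hζ hζc hγ, l2_sub_smul hΩ hγ (memLp_weakDiv hζ)]
  -- Since [v]{v} is half the jump of v², subtracting half of the integration by parts identity
  -- cancels the unsigned edge terms and turns γ into γ - ½∇·ζ. On the boundary max(-f, 0) = ½|f| -
  -- ½f plays the same role.
  have hi : ∀ p ∈ M.intEdges, M.edgeInt p.1 (fun x =>
        1 / 2 * |flux ζ p.1 x| * (jump v.fn p x * jump v.fn p x)
          - flux ζ p.1 x * (jump v.fn p x * avg v.fn p x)) =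
      M.edgeInt p.1 (fun x => 1 / 2 * |flux ζ p.1 x| * jump v.fn p x ^ 2)
      - 1 / 2 * M.edgeInt p.1 (fun x => flux ζ p.1 x *
        (v.fn p.1.1 x * v.fn p.1.1 x - v.fn p.2.1 x * v.fn p.2.1 x)) := by
    intro p _
    have hfl := continuousOn_flux hζc p.1
    have c1 : ContinuousOn (fun x => 1 / 2 * |flux ζ p.1 x| * jump v.fn p x ^ 2)
        (segment ℝ (M.pt₁ p.1) (M.pt₂ p.1)) :=
      (continuousOn_const.mul hfl.abs).mul ((continuousOn_jump v p _).pow 2)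
    have c3 : ContinuousOn (fun x => flux ζ p.1 x *
        (v.fn p.1.1 x * v.fn p.1.1 x - v.fn p.2.1 x * v.fn p.2.1 x))
        (segment ℝ (M.pt₁ p.1) (M.pt₂ p.1)) :=
      hfl.mul (((continuousOn_fn v _ _).mul (continuousOn_fn v _ _)).sub
        ((continuousOn_fn v _ _).mul (continuousOn_fn v _ _)))
    have h1 := edgeInt_add_smul c1 c3 1 (-(1 / 2))
    rw [one_mul, neg_mul, ← sub_eq_add_neg] at h1
    rw [← h1]
    congr 1; ext x
    simp only [jump, avg]
    ring
  have hb : ∀ p ∈ M.bdryEdges, M.edgeInt p (fun x =>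
        max (-flux ζ p x) 0 * (v.fn p.1 x * v.fn p.1 x)) =
      M.edgeInt p (fun x => 1 / 2 * |flux ζ p x| * v.fn p.1 x ^ 2)
      - 1 / 2 * M.edgeInt p (fun x => flux ζ p x * (v.fn p.1 x * v.fn p.1 x)) := by
    intro p _
    have hfl := continuousOn_flux hζc p
    have c1 : ContinuousOn (fun x => 1 / 2 * |flux ζ p x| * v.fn p.1 x ^ 2)
        (segment ℝ (M.pt₁ p) (M.pt₂ p)) :=
      (continuousOn_const.mul hfl.abs).mul ((continuousOn_fn v _ _).pow 2)
    have c3 : ContinuousOn (fun x => flux ζ p x * (v.fn p.1 x * v.fn p.1 x))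
        (segment ℝ (M.pt₁ p) (M.pt₂ p)) :=
      hfl.mul ((continuousOn_fn v _ _).mul (continuousOn_fn v _ _))
    have h1 := edgeInt_add_smul c1 c3 1 (-(1 / 2))
    rw [one_mul, neg_mul, ← sub_eq_add_neg] at h1
    rw [← h1]
    congr 1; ext x
    rcases le_total 0 (flux ζ p x) with h | h
    · rw [max_eq_right (by linarith), abs_of_nonneg h]; ring
    · rw [max_eq_left (by linarith), abs_of_nonpos h]; ring
  rw [Finset.sum_congr rfl hi, Finset.sum_congr rfl hb, Finset.sum_sub_distrib,
    Finset.sum_sub_distrib, ← Finset.mul_sum, ← Finset.mul_sum]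
  linarith

/-- Coercivity of the upwind form. -/
theorem le_formUpw_self (hΩ : IsConvexPolygon Ω) {ζ : Plane → Plane}
    (hζ : ∀ i, MemW1Inf Ω (fun x => ζ x i)) (hζc : ContinuousOn ζ (closure Ω)) {γ : Plane → ℝ}
    (hγ : MemLp γ ⊤ (volume.restrict Ω)) {γ₀ : ℝ}
    (hγζ : ∀ᵐ x ∂(volume.restrict Ω), γ₀ ≤ γ x - 1 / 2 * weakDiv Ω ζ x) (v : M.Vh) :
    min γ₀ 1 * normUpwSq ζ v ≤ formUpw ζ γ v v := by
  have h1 : γ₀ * l2 v.fn v.fn ≤ l2 (fun j x => (γ x - 1 / 2 * weakDiv Ω ζ x) * v.fn j x) v.fn := by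
    rw [l2, l2, Finset.mul_sum]
    refine Finset.sum_le_sum fun j _ => ?_
    have hvv := (continuousOn_fn v j (M.tri j)).mul (continuousOn_fn v j (M.tri j))
    rw [← integral_const_mul]
    refine integral_mono_ae ((integrableOn_tri hvv).const_mul γ₀) ?_ ?_
    · have := integrableOn_mul_of_memLp hΩ (hγ.sub ((memLp_weakDiv hζ).const_mul (1 / 2))) hvv
      refine this.congr (Filter.Eventually.of_forall fun x => ?_)
      simp only [Pi.sub_apply, Pi.mul_apply]
      ring
    · filter_upwards [ae_tri hΩ hγζ j] with x hx
      nlinarith [mul_self_nonneg (v.fn j x)]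
  have h0 : 0 ≤ l2 v.fn v.fn := Finset.sum_nonneg fun j _ => integral_nonneg fun x => mul_self_nonneg _
  have h2 : 0 ≤ ∑ p ∈ M.intEdges, M.edgeInt p.1
      (fun x => 1 / 2 * |flux ζ p.1 x| * jump v.fn p x ^ 2) :=
    Finset.sum_nonneg fun p _ => edgeInt_nonneg fun x _ => by positivity
  have h3 : 0 ≤ ∑ p ∈ M.bdryEdges, M.edgeInt p
      (fun x => 1 / 2 * |flux ζ p x| * v.fn p.1 x ^ 2) :=
    Finset.sum_nonneg fun p _ => edgeInt_nonneg fun x _ => by positivity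
  rw [formUpw_self hΩ hζ hζc hγ, normUpwSq, normARSq]
  have e1 := mul_le_mul_of_nonneg_right (min_le_left γ₀ 1) h0
  have e2 := mul_le_mul_of_nonneg_right (min_le_right γ₀ 1) h2
  have e3 := mul_le_mul_of_nonneg_right (min_le_right γ₀ 1) h3
  simp only [flux] at e2 e3 ⊢
  linarith

/-! ### Inverse and trace inequalities; discrete derivatives of piecewise constants -/

/-- The exact mass matrix gives this after dropping the square of the sum of the vertex values. -/
theorem area_mul_sum_sq_vtx_le (g : Plane →ᵃ[ℝ] ℝ) (j : Fin M.n) :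
    M.area j * ∑ k, g (M.vtx j k) ^ 2 ≤ 12 * ∫ x in M.tri j, g x ^ 2 := by
  have h := integral_affine_sq_triangle (M.indep j) g
  change ∫ x in M.tri j, g x ^ 2 = _ at h
  have hA := M.area_pos j
  rw [h, Fin.sum_univ_three]
  rw [area] at hA ⊢
  nlinarith [mul_nonneg hA.le (sq_nonneg (g (M.vtx j 0) + g (M.vtx j 1) + g (M.vtx j 2)))]

theorem linear_eq_sum_grad (g : Plane →ᵃ[ℝ] ℝ) (j : Fin M.n) (i : Fin 2) :
    g.linear (unitVec i) = ∑ k, M.grad (j, k) i * g (M.vtx j k) := by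
  have h1 : g.linear (unitVec i) = g (unitVec i) - g 0 := by
    have := g.linearMap_vsub (unitVec i) 0
    simpa using this
  rw [h1, affine_eq_sum_coord (M.indep j) g (unitVec i), affine_eq_sum_coord (M.indep j) g 0,
    ← Finset.sum_sub_distrib]
  refine Finset.sum_congr rfl fun k _ => ?_
  rw [← sub_mul, grad, baryGrad_apply]
  congr 1
  have := ((triBasis _ (M.indep j)).coord k).linearMap_vsub (unitVec i) 0
  simpa using this.symm

/-- The inverse inequality. -/
theorem inverse_inequality {ρ : ℝ} (hρ : 0 < ρ) (hreg : M.ShapeRegular ρ) (g : Plane →ᵃ[ℝ] ℝ)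
    (j : Fin M.n) : M.area j * M.diamT j ^ 2 * ∑ i, g.linear (unitVec i) ^ 2 ≤
      72 / ρ ^ 2 * ∫ x in M.tri j, g x ^ 2 := by
  have hA := M.area_pos j
  have hd := M.diamT_pos j
  have h1 := area_mul_sum_sq_vtx_le g j
  have hk : ∀ i k, (ρ * M.diamT j * M.grad (j, k) i) ^ 2 ≤ 1 := fun i k => by
    have h2 := hreg.norm_grad_mul_le hρ (j, k)
    have h3 : |M.grad (j, k) i| ≤ ‖M.grad (j, k)‖ := by
      simpa using PiLp.norm_apply_le (M.grad (j, k)) i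
    rw [sq_le_one_iff_abs_le_one, abs_mul, abs_of_pos (by positivity)]
    dsimp only at h2
    nlinarith [mul_le_mul_of_nonneg_right h3 (mul_pos hρ hd).le]
  -- Cauchy–Schwarz over the three vertices gives the 3; two directions and the 12 of the mass
  -- matrix lead to 72.
  have hi : ∀ i, (ρ * M.diamT j) ^ 2 * g.linear (unitVec i) ^ 2 ≤ 3 * ∑ k, g (M.vtx j k) ^ 2 := by
    intro i
    have e : (ρ * M.diamT j) ^ 2 * g.linear (unitVec i) ^ 2 =
        (∑ k, (ρ * M.diamT j * M.grad (j, k) i) * g (M.vtx j k)) ^ 2 := by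
      rw [linear_eq_sum_grad g j i, ← mul_pow, Finset.mul_sum]
      simp only [mul_assoc]
    rw [e]
    refine (Finset.sum_mul_sq_le_sq_mul_sq _ _ _).trans ?_
    refine mul_le_mul_of_nonneg_right ?_ (Finset.sum_nonneg fun _ _ => sq_nonneg _)
    refine (Finset.sum_le_sum fun k _ => hk i k).trans (by simp)
  rw [Fin.sum_univ_two, div_mul_eq_mul_div, le_div_iff₀ (by positivity)]
  have h4 := mul_le_mul_of_nonneg_left (add_le_add (hi 0) (hi 1)) hA.le
  calc _ = M.area j * ((ρ * M.diamT j) ^ 2 * g.linear (unitVec 0) ^ 2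
        + (ρ * M.diamT j) ^ 2 * g.linear (unitVec 1) ^ 2) := by ring
    _ ≤ _ := h4
    _ = 6 * (M.area j * ∑ k, g (M.vtx j k) ^ 2) := by ring
    _ ≤ _ := by linarith

theorem edgeInt_const (p : M.Side) (c : ℝ) : M.edgeInt p (fun _ => c) = M.len p * c := by
  simp [edgeInt, segIntegral, len]

theorem edgeInt_le_const {p : M.Side} {f : Plane → ℝ} {c : ℝ}
    (hf : ContinuousOn f (segment ℝ (M.pt₁ p) (M.pt₂ p)))
    (h : ∀ x ∈ segment ℝ (M.pt₁ p) (M.pt₂ p), f x ≤ c) : M.edgeInt p f ≤ M.len p * c := by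
  rw [← edgeInt_const]
  exact edgeInt_mono hf continuousOn_const h

theorem affine_sq_le (g : Plane →ᵃ[ℝ] ℝ) {j : Fin M.n} {x : Plane} (hx : x ∈ M.tri j) :
    g x ^ 2 ≤ ∑ k, g (M.vtx j k) ^ 2 := by
  rw [affine_eq_sum_coord (M.indep j) g x]
  refine (Finset.sum_mul_sq_le_sq_mul_sq _ _ _).trans ?_
  refine mul_le_of_le_one_left (Finset.sum_nonneg fun _ _ => sq_nonneg _) ?_
  rw [← (triBasis _ (M.indep j)).sum_coord_apply_eq_one x]
  refine Finset.sum_le_sum fun k _ => ?_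
  have := coord_mem_Icc (M.indep j) hx k
  nlinarith [this.1, this.2]

/-- The discrete trace inequality. -/
theorem diamT_mul_edgeInt_sq_le {ρ : ℝ} (hρ : 0 < ρ) (hreg : M.ShapeRegular ρ)
    (g : Plane →ᵃ[ℝ] ℝ) (p : M.Side) :
    M.diamT p.1 * M.edgeInt p (fun x => g x ^ 2) ≤
      24 / ρ ^ 2 * ∫ x in M.tri p.1, g x ^ 2 := by
  have hd := M.diamT_pos p.1
  have hS : 0 ≤ ∑ k, g (M.vtx p.1 k) ^ 2 := Finset.sum_nonneg fun _ _ => sq_nonneg _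
  have h1 := area_mul_sum_sq_vtx_le g p.1
  have h2 : M.edgeInt p (fun x => g x ^ 2) ≤ M.len p * ∑ k, g (M.vtx p.1 k) ^ 2 :=
    edgeInt_le_const ((continuous_affine g).pow 2).continuousOn fun x hx =>
      affine_sq_le g (segment_subset_tri p hx)
  have h3 := mul_le_mul_of_nonneg_right (M.len_le_diamT p) hS
  rw [div_mul_eq_mul_div, le_div_iff₀ (by positivity)]
  have h4 := mul_le_mul_of_nonneg_left (h2.trans h3) (mul_pos (sq_pos_of_pos hρ) hd).le
  have h5 := mul_le_mul_of_nonneg_right (hreg.sq_le_area hρ p.1) hS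
  linarith

/-- Piecewise constant functions. -/
noncomputable def piecewiseConst (c : Fin M.n → ℝ) : M.Vh := fun j => AffineMap.const ℝ Plane (c j)

theorem fn_piecewiseConst (c : Fin M.n → ℝ) (j : Fin M.n) (x : Plane) :
    (piecewiseConst c).fn j x = c j := rfl

theorem dx_piecewiseConst (c : Fin M.n → ℝ) (i : Fin 2) :
    Vh.dx i (piecewiseConst c) = fun _ _ => (0 : ℝ) := by
  funext j x
  simp [Vh.dx, piecewiseConst]

/-- The square of a jump is at most twice the sum of the squares on both sides and is counted twice,
which charges 4 to each of the three sides of a triangle. The weight 1/h_e cancels the edge length,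
so no power of the mesh size remains. -/
theorem sum_edgeInt_sideJump_piecewiseConst_le (hΩ : IsConvexPolygon Ω) (c : Fin M.n → ℝ) :
    ∑ q : M.Side, 1 / M.len q * M.edgeInt q (fun x => sideJump (piecewiseConst c) q x ^ 2) ≤
      12 * ∑ j, c j ^ 2 := by
  have h12 : (12 : ℝ) * ∑ j, c j ^ 2 = ∑ q : M.Side, 4 * c q.1 ^ 2 := by
    rw [Fintype.sum_prod_type, Finset.mul_sum]
    refine Finset.sum_congr rfl fun j _ => ?_
    simp only [Finset.sum_const, Finset.card_univ, Fintype.card_fin, nsmul_eq_mul]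
    push_cast; ring
  rw [h12, sum_sides hΩ, sum_sides hΩ]
  refine add_le_add (Finset.sum_le_sum fun p hp => ?_) (Finset.sum_le_sum fun q hq => ?_)
  · simp only [sideJump_fst _ hp, sideJump_snd _ hp, fn_piecewiseConst, edgeInt_const]
    have h1 := (M.len_pos p.1).ne'
    have h2 := (M.len_pos p.2).ne'
    rw [← mul_assoc, ← mul_assoc, one_div_mul_cancel h1, one_div_mul_cancel h2]
    nlinarith [sq_nonneg (c p.1.1 + c p.2.1)]
  · simp only [sideJump_bdry hΩ _ hq, fn_piecewiseConst, edgeInt_const]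
    have h1 := (M.len_pos q).ne'
    rw [← mul_assoc, one_div_mul_cancel h1]
    nlinarith [sq_nonneg (c q.1)]

theorem l2_self_eq (v : M.Vh) : l2 v.fn v.fn = ∑ j, ∫ x in M.tri j, v j x ^ 2 := by
  simp only [l2, Vh.fn, sq]

-- A piecewise constant has no elementwise derivative, so its discrete derivative d consists of
-- jumps alone. Testing with d and using the trace inequality absorbs d into the left-hand side.
open Classical in
theorem l2_partial₀_piecewiseConst_le (hΩ : IsConvexPolygon Ω) {ρ : ℝ} (hρ : 0 < ρ)
    (hreg : M.ShapeRegular ρ) (s : Wind) (i : Fin 2) (c : Fin M.n → ℝ) :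
    l2 (partial₀ s i (piecewiseConst c).fn).fn (partial₀ s i (piecewiseConst c).fn).fn ≤
      864 / ρ ^ 2 * ∑ j, c j ^ 2 := by
  obtain ⟨d, hd⟩ : ∃ d : M.Vh, d = partial₀ s i (piecewiseConst c).fn := ⟨_, rfl⟩
  have h := partial₀_eq s i (piecewiseConst c) d
  rw [partialFunctional₀_eq hΩ, dx_piecewiseConst, ← hd] at h
  have h0 : l2 (fun _ _ => (0 : ℝ)) d.fn = 0 := by simp [l2]
  rw [h0, zero_sub] at h
  rw [← hd]
  have hK : 0 < 72 / ρ ^ 2 := by positivity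
  -- This is three times the constant of the trace inequality: with it each side costs one sixth of
  -- ‖d‖² on its triangle, and three sides cost one half.
  obtain ⟨K, hKe⟩ : ∃ K, K = 72 / ρ ^ 2 := ⟨_, rfl⟩
  rw [← hKe] at hK
  have hq : ∀ q : M.Side, - (if Seen s i q then M.normal q i * M.edgeInt q
        (fun x => sideJump (piecewiseConst c) q x * d.fn q.1 x) else 0) ≤
      K / 2 * (1 / M.len q * M.edgeInt q (fun x => sideJump (piecewiseConst c) q x ^ 2))
        + 1 / 6 * ∫ x in M.tri q.1, d q.1 x ^ 2 := by
    intro q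
    have hl := M.len_pos q
    have hh := M.diamT_pos q.1
    have t0 : 0 ≤ M.edgeInt q (fun x => sideJump (piecewiseConst c) q x ^ 2) :=
      edgeInt_nonneg fun x _ => sq_nonneg _
    have t1 : 0 ≤ ∫ x in M.tri q.1, d q.1 x ^ 2 := integral_sq_nonneg _ _
    split_ifs
    · have hn : |M.normal q i| ≤ 1 := by
        have := PiLp.norm_apply_le (M.normal q) i
        rwa [norm_normal] at this
      have e1 : ∀ x, -(M.normal q i * (sideJump (piecewiseConst c) q x * d.fn q.1 x)) ≤
          K / (2 * M.diamT q.1) * sideJump (piecewiseConst c) q x ^ 2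
            + M.diamT q.1 / (2 * K) * d q.1 x ^ 2 := by
        intro x
        obtain ⟨a, ha⟩ : ∃ a, a = sideJump (piecewiseConst c) q x := ⟨_, rfl⟩
        obtain ⟨b, hb⟩ : ∃ b, b = d q.1 x := ⟨_, rfl⟩
        change -(M.normal q i * (sideJump (piecewiseConst c) q x * d q.1 x)) ≤ _
        rw [← ha, ← hb]
        have e2 : -(M.normal q i * (a * b)) ≤ |a| * |b| := by
          refine (neg_le_abs _).trans ?_
          rw [abs_mul, abs_mul]
          exact mul_le_of_le_one_left (by positivity) hn
        refine e2.trans ?_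
        have e3 : K / (2 * M.diamT q.1) * a ^ 2 + M.diamT q.1 / (2 * K) * b ^ 2 - |a| * |b| =
            (K * |a| - M.diamT q.1 * |b|) ^ 2 / (2 * K * M.diamT q.1) := by
          rw [← sq_abs a, ← sq_abs b]
          field_simp
          ring
        have e4 : 0 ≤ (K * |a| - M.diamT q.1 * |b|) ^ 2 / (2 * K * M.diamT q.1) := by positivity
        linarith
      have c1 := continuous_sideJump (piecewiseConst c) q
      have c2 := continuous_affine (d q.1)
      have e2 : - (M.normal q i * M.edgeInt q
          (fun x => sideJump (piecewiseConst c) q x * d.fn q.1 x)) ≤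
          K / (2 * M.diamT q.1) * M.edgeInt q (fun x => sideJump (piecewiseConst c) q x ^ 2)
            + M.diamT q.1 / (2 * K) * M.edgeInt q (fun x => d q.1 x ^ 2) := by
        rw [← neg_mul, ← edgeInt_smul, ← edgeInt_add_smul
          (f := fun x => sideJump (piecewiseConst c) q x ^ 2) (g := fun x => d q.1 x ^ 2)
          (c1.pow 2).continuousOn (c2.pow 2).continuousOn]
        refine edgeInt_mono (continuousOn_const.mul (c1.mul (fn_continuous d _)).continuousOn)
          ((continuousOn_const.mul (c1.pow 2).continuousOn).add
            (continuousOn_const.mul (c2.pow 2).continuousOn)) fun x _ => ?_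
        rw [neg_mul]; exact e1 x
      refine e2.trans (add_le_add ?_ ?_)
      · have e3 : K / (2 * M.diamT q.1) ≤ K / 2 * (1 / M.len q) := by
          rw [div_mul_div_comm, mul_one]
          exact div_le_div_of_nonneg_left hK.le (by positivity) (by linarith [M.len_le_diamT q])
        calc _ ≤ _ := mul_le_mul_of_nonneg_right e3 t0
          _ = _ := by ring
      · have e3 := diamT_mul_edgeInt_sq_le hρ hreg (d q.1) q
        have e4 : (24 : ℝ) / ρ ^ 2 = K / 3 := by rw [hKe]; ring
        rw [e4] at e3
        have e5 := mul_le_mul_of_nonneg_left e3 (show 0 ≤ 1 / (2 * K) by positivity)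
        calc _ = 1 / (2 * K) * (M.diamT q.1 * M.edgeInt q fun x => d q.1 x ^ 2) := by ring
          _ ≤ _ := e5
          _ = _ := by field_simp; ring
    · have : 0 ≤ 1 / M.len q := by positivity
      rw [neg_zero]
      positivity
  have hs := Finset.sum_le_sum fun q (_ : q ∈ (Finset.univ : Finset M.Side)) => hq q
  rw [Finset.sum_neg_distrib, ← h, Finset.sum_add_distrib, ← Finset.mul_sum, ← Finset.mul_sum] at hs
  have h3 : ∑ q : M.Side, ∫ x in M.tri q.1, d q.1 x ^ 2 = 3 * l2 d.fn d.fn := by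
    rw [l2_self_eq, Fintype.sum_prod_type, Finset.mul_sum]
    refine Finset.sum_congr rfl fun j _ => ?_
    simp
  rw [h3] at hs
  have h4 := mul_le_mul_of_nonneg_left (sum_edgeInt_sideJump_piecewiseConst_le hΩ c) hK.le
  have h5 : (864 : ℝ) / ρ ^ 2 = 12 * K := by rw [hKe]; ring
  rw [h5]
  linarith

/-- Half the sum of the four squared discrete derivatives gives 2 · 864, and the penalties are at
most σmax. -/
theorem normDSq_piecewiseConst_le (hΩ : IsConvexPolygon Ω) {ρ : ℝ} (hρ : 0 < ρ)
    (hreg : M.ShapeRegular ρ) {σ : Sym2 Plane → ℝ} {σmax : ℝ}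
    (hσ : ∀ p : M.Side, 0 ≤ σ (M.edge p) ∧ σ (M.edge p) ≤ σmax) (c : Fin M.n → ℝ) :
    normDSq σ (piecewiseConst c) ≤ (1728 / ρ ^ 2 + 12 * |σmax|) * ∑ j, c j ^ 2 := by
  have hp := fun s i => l2_partial₀_piecewiseConst_le hΩ hρ hreg s i c
  have h1 : ∑ p ∈ M.intEdges, σ (M.edge p.1) / M.len p.1 *
      M.edgeInt p.1 (fun x => jump (piecewiseConst c).fn p x ^ 2)
      + ∑ p ∈ M.bdryEdges, σ (M.edge p) / M.len p *
      M.edgeInt p (fun x => (piecewiseConst c).fn p.1 x ^ 2) ≤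
      |σmax| * ∑ q : M.Side, 1 / M.len q *
        M.edgeInt q (fun x => sideJump (piecewiseConst c) q x ^ 2) := by
    rw [sum_sides hΩ, mul_add, Finset.mul_sum, Finset.mul_sum]
    have key : ∀ (q : M.Side) (f : Plane → ℝ), (∀ x, 0 ≤ f x) →
        σ (M.edge q) / M.len q * M.edgeInt q f ≤ |σmax| * (1 / M.len q * M.edgeInt q f) := by
      intro q f hf
      have e1 : 0 ≤ 1 / M.len q * M.edgeInt q f :=
        mul_nonneg (one_div_pos.2 (M.len_pos q)).le (edgeInt_nonneg fun x _ => hf x)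
      have e2 := mul_le_mul_of_nonneg_right ((hσ q).2.trans (le_abs_self _)) e1
      calc _ = σ (M.edge q) * (1 / M.len q * M.edgeInt q f) := by ring
        _ ≤ _ := e2
    refine add_le_add (Finset.sum_le_sum fun p hp => ?_) (Finset.sum_le_sum fun q hq => ?_)
    · have e1 := key p.1 (fun x => jump (piecewiseConst c).fn p x ^ 2) fun x => sq_nonneg _
      have e2 : 0 ≤ 1 / M.len p.2 * M.edgeInt p.2 (fun x => sideJump (piecewiseConst c) p.2 x ^ 2) :=
        mul_nonneg (one_div_pos.2 (M.len_pos _)).le (edgeInt_nonneg fun x _ => sq_nonneg _)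
      have e3 : M.edgeInt p.1 (fun x => sideJump (piecewiseConst c) p.1 x ^ 2) =
          M.edgeInt p.1 (fun x => jump (piecewiseConst c).fn p x ^ 2) := by
        simp only [sideJump_fst _ hp, jump]
      rw [e3]
      refine e1.trans (mul_le_mul_of_nonneg_left ?_ (abs_nonneg _))
      linarith
    · have e1 := key q (fun x => (piecewiseConst c).fn q.1 x ^ 2) fun x => sq_nonneg _
      simpa only [sideJump_bdry hΩ _ hq] using e1
  have h2 := mul_le_mul_of_nonneg_left (sum_edgeInt_sideJump_piecewiseConst_le hΩ c) (abs_nonneg σmax)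
  rw [normDSq, Fin.sum_univ_two, Fin.sum_univ_two]
  have h3 : (1728 / ρ ^ 2 + 12 * |σmax|) * ∑ j, c j ^ 2 =
      2 * (864 / ρ ^ 2 * ∑ j, c j ^ 2) + |σmax| * (12 * ∑ j, c j ^ 2) := by ring
  rw [h3]
  linarith [hp Wind.plus 0, hp Wind.plus 1, hp Wind.minus 0, hp Wind.minus 1]

/-! ### The streamline test function -/

/-- The piecewise constant test function `h_T (ζ · ∇v)`, with `ζ` frozen at a vertex. -/
noncomputable def streamline (ζ : Plane → Plane) (v : M.Vh) : M.Vh :=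
  piecewiseConst fun j => M.diamT j * conv ζ v j (M.vtx j 0)

/-- The weighted norm of the streamline derivative with `ζ` frozen at a vertex. -/
noncomputable def frozenSq (ζ : Plane → Plane) (v : M.Vh) : ℝ :=
  ∑ j, M.diamT j * (M.area j * conv ζ v j (M.vtx j 0) ^ 2)

/-- The streamline derivative part of `‖·‖_{h♯}²`. -/
noncomputable def streamSq (ζ : Plane → Plane) (v : M.Vh) : ℝ :=
  ∑ j, M.diamT j * ∫ x in M.tri j, conv ζ v j x ^ 2

theorem frozenSq_nonneg (ζ : Plane → Plane) (v : M.Vh) : 0 ≤ frozenSq ζ v :=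
  Finset.sum_nonneg fun j _ => mul_nonneg (M.diamT_pos j).le
    (mul_nonneg (M.area_pos j).le (sq_nonneg _))

theorem streamSq_nonneg (ζ : Plane → Plane) (v : M.Vh) : 0 ≤ streamSq ζ v :=
  Finset.sum_nonneg fun j _ => mul_nonneg (M.diamT_pos j).le (integral_sq_nonneg _ _)

theorem streamSq_streamline (ζ : Plane → Plane) (v : M.Vh) : streamSq ζ (streamline ζ v) = 0 := by
  simp [streamSq, conv, streamline, dx_piecewiseConst]

theorem setIntegral_const_tri (j : Fin M.n) (c : ℝ) : ∫ _ in M.tri j, c = M.area j * c := by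
  rw [setIntegral_const, volume_real_tri, smul_eq_mul]

/-- Freezing ζ costs Lh_T per component, and the inverse inequality pays for h_T∇v with v. The
constant is 2 · 72, with the 2 from the two components. -/
theorem integral_sq_conv_sub_le {ζ : Plane → Plane} (hζc : ContinuousOn ζ (closure Ω)) {L : ℝ}
    (hL : ∀ i, ∀ x ∈ closure Ω, ∀ y ∈ closure Ω, |ζ x i - ζ y i| ≤ L * dist x y)
    {ρ : ℝ} (hρ : 0 < ρ) (hreg : M.ShapeRegular ρ) (v : M.Vh) (j : Fin M.n) :
    ∫ x in M.tri j, (conv ζ v j x - conv ζ v j (M.vtx j 0)) ^ 2 ≤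
      144 * L ^ 2 / ρ ^ 2 * ∫ x in M.tri j, v j x ^ 2 := by
  obtain ⟨G, hG⟩ : ∃ G, G = ∑ i, (v j).linear (unitVec i) ^ 2 := ⟨_, rfl⟩
  have hG0 : 0 ≤ G := hG ▸ Finset.sum_nonneg fun _ _ => sq_nonneg _
  have hpt : ∀ x ∈ M.tri j, (conv ζ v j x - conv ζ v j (M.vtx j 0)) ^ 2 ≤
      2 * (L * M.diamT j) ^ 2 * G := by
    intro x hx
    have e1 : conv ζ v j x - conv ζ v j (M.vtx j 0) =
        ∑ i, (ζ x i - ζ (M.vtx j 0) i) * (v j).linear (unitVec i) := by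
      simp only [conv, Vh.dx, sub_mul, Finset.sum_sub_distrib]
    rw [e1]
    refine (Finset.sum_mul_sq_le_sq_mul_sq _ _ _).trans ?_
    rw [← hG]
    refine mul_le_mul_of_nonneg_right ?_ hG0
    have e2 : ∀ i, (ζ x i - ζ (M.vtx j 0) i) ^ 2 ≤ (L * M.diamT j) ^ 2 := by
      intro i
      have h1 := hL i x (tri_subset_closure j hx) _ (tri_subset_closure j (M.vtx_mem j 0))
      have h2 := M.dist_le_diamT hx (M.vtx_mem j 0)
      rw [← sq_abs (ζ x i - _)]
      -- No sign of L is assumed, but L is nonnegative as soon as two points of the closure are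
      -- distinct.
      rcases (dist_nonneg (x := x) (y := M.vtx j 0)).eq_or_lt with h0 | h0
      · rw [← h0, mul_zero] at h1
        have h3 : |ζ x i - ζ (M.vtx j 0) i| = 0 := le_antisymm h1 (abs_nonneg _)
        rw [h3, zero_pow two_ne_zero]; positivity
      · have hL0 : 0 ≤ L := nonneg_of_mul_nonneg_left ((abs_nonneg _).trans h1) h0
        exact pow_le_pow_left₀ (abs_nonneg _) (h1.trans (mul_le_mul_of_nonneg_left h2 hL0)) 2
    rw [Fin.sum_univ_two]
    linarith [e2 0, e2 1]
  have h1 : ∫ x in M.tri j, (conv ζ v j x - conv ζ v j (M.vtx j 0)) ^ 2 ≤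
      ∫ _ in M.tri j, 2 * (L * M.diamT j) ^ 2 * G :=
    setIntegral_mono_on (integrableOn_tri (((continuousOn_conv hζc v j).sub continuousOn_const).pow 2))
      (integrableOn_tri continuousOn_const) (tri_isCompact j).isClosed.measurableSet hpt
  rw [setIntegral_const_tri] at h1
  have h2 := mul_le_mul_of_nonneg_left (inverse_inequality hρ hreg (v j) j)
    (show 0 ≤ 2 * L ^ 2 by positivity)
  rw [← hG] at h2
  calc _ ≤ _ := h1
    _ = 2 * L ^ 2 * (M.area j * M.diamT j ^ 2 * G) := by ring
    _ ≤ _ := h2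
    _ = _ := by ring

theorem frozenSq_le {ζ : Plane → Plane} (hζc : ContinuousOn ζ (closure Ω)) {L : ℝ}
    (hL : ∀ i, ∀ x ∈ closure Ω, ∀ y ∈ closure Ω, |ζ x i - ζ y i| ≤ L * dist x y)
    {ρ : ℝ} (hρ : 0 < ρ) (hreg : M.ShapeRegular ρ) {D : ℝ} (hD : ∀ j, M.diamT j ≤ D) (v : M.Vh) :
    frozenSq ζ v ≤ 2 * streamSq ζ v + 288 * L ^ 2 * D / ρ ^ 2 * l2 v.fn v.fn := by
  rw [frozenSq, streamSq, l2_self_eq, Finset.mul_sum, Finset.mul_sum, ← Finset.sum_add_distrib]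
  refine Finset.sum_le_sum fun j _ => ?_
  have hh := (M.diamT_pos j).le
  have hc := continuousOn_conv hζc v j
  have h1 := integral_sq_conv_sub_le hζc hL hρ hreg v j
  have h2 : M.area j * conv ζ v j (M.vtx j 0) ^ 2 ≤ 2 * (∫ x in M.tri j, conv ζ v j x ^ 2)
      + 2 * ∫ x in M.tri j, (conv ζ v j x - conv ζ v j (M.vtx j 0)) ^ 2 := by
    have i1 := (integrableOn_tri (hc.pow 2)).const_mul 2
    have i2 := (integrableOn_tri ((hc.sub (continuousOn_const
      (c := conv ζ v j (M.vtx j 0)))).pow 2)).const_mul 2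
    rw [← setIntegral_const_tri, ← integral_const_mul, ← integral_const_mul]
    refine (integral_mono (integrableOn_tri continuousOn_const) (i1.add i2) fun x => ?_).trans_eq
      (integral_add i1 i2)
    simp only [Pi.add_apply, Pi.pow_apply, Pi.sub_apply]
    nlinarith [sq_nonneg (2 * conv ζ v j x - conv ζ v j (M.vtx j 0))]
  have h3 := mul_le_mul_of_nonneg_left h2 hh
  have hI : 0 ≤ ∫ x in M.tri j, v j x ^ 2 := integral_sq_nonneg _ _
  have h4 := mul_le_mul_of_nonneg_left h1 hh
  have h5 : M.diamT j * (144 * L ^ 2 / ρ ^ 2 * ∫ x in M.tri j, v j x ^ 2) ≤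
      D * (144 * L ^ 2 / ρ ^ 2 * ∫ x in M.tri j, v j x ^ 2) :=
    mul_le_mul_of_nonneg_right (hD j) (by positivity)
  have h6 : 288 * L ^ 2 * D / ρ ^ 2 * ∫ x in M.tri j, v j x ^ 2 =
      2 * (D * (144 * L ^ 2 / ρ ^ 2 * ∫ x in M.tri j, v j x ^ 2)) := by ring
  rw [h6]
  linarith

/-- With b the frozen value of c = ζ·∇v on T, b∫c = ½∫c² + ½|T|b² - ½∫(c - b)². The last term is the
freezing error; the term in b² is kept to absorb the reaction and edge terms. -/
theorem le_l2_conv_streamline {ζ : Plane → Plane} (hζc : ContinuousOn ζ (closure Ω)) {L : ℝ}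
    (hL : ∀ i, ∀ x ∈ closure Ω, ∀ y ∈ closure Ω, |ζ x i - ζ y i| ≤ L * dist x y)
    {ρ : ℝ} (hρ : 0 < ρ) (hreg : M.ShapeRegular ρ) {D : ℝ} (hD : ∀ j, M.diamT j ≤ D) (v : M.Vh) :
    1 / 2 * streamSq ζ v + 1 / 2 * frozenSq ζ v - 72 * L ^ 2 * D / ρ ^ 2 * l2 v.fn v.fn ≤
      l2 (conv ζ v) (streamline ζ v).fn := by
  rw [frozenSq, streamSq, l2_self_eq, Finset.mul_sum, Finset.mul_sum, Finset.mul_sum,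
    ← Finset.sum_add_distrib, ← Finset.sum_sub_distrib, l2]
  refine Finset.sum_le_sum fun j _ => ?_
  have hh := (M.diamT_pos j).le
  have hc := continuousOn_conv hζc v j
  have h1 := integral_sq_conv_sub_le hζc hL hρ hreg v j
  obtain ⟨b, hb⟩ : ∃ b, b = conv ζ v j (M.vtx j 0) := ⟨_, rfl⟩
  have h2 : ∫ x in M.tri j, (conv ζ v j x - b) ^ 2 =
      (∫ x in M.tri j, conv ζ v j x ^ 2) - 2 * b * (∫ x in M.tri j, conv ζ v j x)
        + M.area j * b ^ 2 := by
    have i1 : IntegrableOn (fun x => conv ζ v j x ^ 2) (M.tri j) := integrableOn_tri (hc.pow 2)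
    have i2 : IntegrableOn (fun x => 2 * b * conv ζ v j x) (M.tri j) :=
      (integrableOn_tri hc).const_mul (2 * b)
    have i3 : IntegrableOn (fun x => conv ζ v j x ^ 2 - 2 * b * conv ζ v j x) (M.tri j) := i1.sub i2
    have i4 : IntegrableOn (fun _ => b ^ 2) (M.tri j) := integrableOn_tri continuousOn_const
    rw [← integral_const_mul, ← setIntegral_const_tri, ← integral_sub i1 i2, ← integral_add i3 i4]
    congr 1; ext x; ring
  have h3 : ∫ x in M.tri j, conv ζ v j x * (streamline ζ v).fn j x =
      M.diamT j * (b * ∫ x in M.tri j, conv ζ v j x) := by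
    rw [← mul_assoc, mul_comm (M.diamT j * b), ← integral_mul_const]
    simp only [streamline, fn_piecewiseConst, hb]
  rw [h3]
  rw [← hb] at h1 ⊢
  have hI : 0 ≤ ∫ x in M.tri j, v j x ^ 2 := integral_sq_nonneg _ _
  have h4 := mul_le_mul_of_nonneg_left h1 hh
  have h5 : M.diamT j * (144 * L ^ 2 / ρ ^ 2 * ∫ x in M.tri j, v j x ^ 2) ≤
      D * (144 * L ^ 2 / ρ ^ 2 * ∫ x in M.tri j, v j x ^ 2) :=
    mul_le_mul_of_nonneg_right (hD j) (by positivity)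
  have h6 : 72 * L ^ 2 * D / ρ ^ 2 * ∫ x in M.tri j, v j x ^ 2 =
      1 / 2 * (D * (144 * L ^ 2 / ρ ^ 2 * ∫ x in M.tri j, v j x ^ 2)) := by ring
  rw [h6]
  rw [h2] at h4
  linarith

/-- Young's inequality Γ|a||b| ≤ 2Γ²a² + b²/8, with the weight chosen so that only an eighth of the
frozen term is spent. -/
theorem le_l2_reaction_streamline (hΩ : IsConvexPolygon Ω) (ζ : Plane → Plane) {γ : Plane → ℝ}
    (hγ : MemLp γ ⊤ (volume.restrict Ω)) {Γ : ℝ}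
    (hΓ : ∀ᵐ x ∂(volume.restrict Ω), |γ x| ≤ Γ) {D : ℝ} (hD : ∀ j, M.diamT j ≤ D) (v : M.Vh) :
    -(2 * Γ ^ 2 * D * l2 v.fn v.fn + 1 / 8 * frozenSq ζ v) ≤
      l2 (fun j x => γ x * v.fn j x) (streamline ζ v).fn := by
  rw [frozenSq, l2_self_eq, Finset.mul_sum, Finset.mul_sum, ← Finset.sum_add_distrib,
    ← Finset.sum_neg_distrib, l2]
  refine Finset.sum_le_sum fun j _ => ?_
  have hh := (M.diamT_pos j).le
  have hv := continuousOn_fn v j (M.tri j)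
  obtain ⟨b, hb⟩ : ∃ b, b = conv ζ v j (M.vtx j 0) := ⟨_, rfl⟩
  rw [← hb]
  have i1 : IntegrableOn (fun x => v j x ^ 2) (M.tri j) := integrableOn_tri (hv.pow 2)
  have i2 := (i1.const_mul (2 * Γ ^ 2 * M.diamT j)).add
    (integrableOn_tri (j := j) (continuousOn_const (c := M.diamT j * (1 / 8 * b ^ 2))))
  have i3 : IntegrableOn (fun x => γ x * v.fn j x * (streamline ζ v).fn j x) (M.tri j) := by
    have := integrableOn_mul_of_memLp hΩ hγ
      (hv.mul (continuousOn_fn (streamline ζ v) j (M.tri j)))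
    simpa only [Pi.mul_apply, ← mul_assoc] using this
  have h1 : ∫ x in M.tri j, -(2 * Γ ^ 2 * M.diamT j * v j x ^ 2 + M.diamT j * (1 / 8 * b ^ 2)) ≤
      ∫ x in M.tri j, γ x * v.fn j x * (streamline ζ v).fn j x := by
    refine integral_mono_ae i2.neg i3 ?_
    filter_upwards [ae_tri hΩ hΓ j] with x hx
    have e1 : (streamline ζ v).fn j x = M.diamT j * b := by
      rw [hb]; rfl
    rw [e1]
    change _ ≤ γ x * v j x * _
    obtain ⟨a, ha⟩ : ∃ a, a = v j x := ⟨_, rfl⟩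
    rw [← ha]
    have e2 : -(Γ * |a| * |b|) ≤ γ x * a * b := by
      refine (neg_le_neg ?_).trans (neg_abs_le _)
      rw [abs_mul, abs_mul]
      exact mul_le_mul_of_nonneg_right (mul_le_mul_of_nonneg_right hx (abs_nonneg _)) (abs_nonneg _)
    have e3 : -(2 * Γ ^ 2 * a ^ 2 + 1 / 8 * b ^ 2) ≤ γ x * a * b := by
      nlinarith [sq_nonneg (4 * (Γ * |a|) - |b|), sq_abs a, sq_abs b]
    have e4 := mul_le_mul_of_nonneg_left e3 hh
    linarith
  refine le_trans ?_ h1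
  rw [integral_neg, integral_add (i1.const_mul _) (integrableOn_tri continuousOn_const),
    integral_const_mul, setIntegral_const_tri]
  have hI : 0 ≤ ∫ x in M.tri j, v j x ^ 2 := integral_sq_nonneg _ _
  have h5 := mul_le_mul_of_nonneg_right (hD j)
    (show 0 ≤ 2 * Γ ^ 2 * ∫ x in M.tri j, v j x ^ 2 by positivity)
  linarith

theorem abs_flux_le {ζ : Plane → Plane} {Z : ℝ} (hZ : ∀ x ∈ closure Ω, ‖ζ x‖ ≤ Z) {q : M.Side}
    {x : Plane} (hx : x ∈ segment ℝ (M.pt₁ q) (M.pt₂ q)) : |flux ζ q x| ≤ Z := by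
  refine (abs_real_inner_le_norm _ _).trans ?_
  rw [norm_normal, mul_one]
  exact hZ x (tri_subset_closure q.1 (segment_subset_tri q hx))

/-- The factor h_T in the test function makes up for the length of the edge: h_e h_T² ≤ h_T · h_T²,
and h_T² ≤ 2|T|/ρ². Each of the three sides contributes 2/ρ². -/
theorem sum_len_mul_sq_le (ζ : Plane → Plane) {ρ : ℝ} (hρ : 0 < ρ) (hreg : M.ShapeRegular ρ)
    (v : M.Vh) : ∑ q : M.Side, M.len q * (M.diamT q.1 * conv ζ v q.1 (M.vtx q.1 0)) ^ 2 ≤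
      6 / ρ ^ 2 * frozenSq ζ v := by
  rw [Fintype.sum_prod_type, frozenSq, Finset.mul_sum]
  refine Finset.sum_le_sum fun j _ => ?_
  dsimp only
  obtain ⟨b, hb⟩ : ∃ b, b = conv ζ v j (M.vtx j 0) := ⟨_, rfl⟩
  rw [← hb]
  have hh := (M.diamT_pos j).le
  have h1 : ∀ k, M.len (j, k) * (M.diamT j * b) ^ 2 ≤ 2 / ρ ^ 2 * (M.diamT j * (M.area j * b ^ 2)) := by
    intro k
    have h2 := mul_le_mul_of_nonneg_right (M.len_le_diamT (j, k)) (sq_nonneg (M.diamT j * b))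
    refine h2.trans ?_
    rw [div_mul_eq_mul_div, le_div_iff₀ (by positivity)]
    have h3 := mul_le_mul_of_nonneg_right (hreg.sq_le_area hρ j) (mul_nonneg hh (sq_nonneg b))
    linarith
  rw [Fin.sum_univ_three]
  have h2 : 6 / ρ ^ 2 * (M.diamT j * (M.area j * b ^ 2)) =
    3 * (2 / ρ ^ 2 * (M.diamT j * (M.area j * b ^ 2))) := by ring
  rw [h2]
  linarith [h1 0, h1 1, h1 2]

theorem streamline_apply (ζ : Plane → Plane) (v : M.Vh) (j : Fin M.n) (x : Plane) :
    (streamline ζ v).fn j x = M.diamT j * conv ζ v j (M.vtx j 0) := rfl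

theorem normUpwSq_streamline_le (hΩ : IsConvexPolygon Ω) {ζ : Plane → Plane}
    (hζc : ContinuousOn ζ (closure Ω)) {Z : ℝ} (hZ : ∀ x ∈ closure Ω, ‖ζ x‖ ≤ Z)
    {ρ : ℝ} (hρ : 0 < ρ) (hreg : M.ShapeRegular ρ) {D : ℝ} (hD : ∀ j, M.diamT j ≤ D)
    (hZ0 : 0 ≤ Z) (v : M.Vh) :
    normUpwSq ζ (streamline ζ v) ≤ (D + 6 * Z / ρ ^ 2) * frozenSq ζ v := by
  have h1 : l2 (streamline ζ v).fn (streamline ζ v).fn ≤ D * frozenSq ζ v := by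
    rw [l2, frozenSq, Finset.mul_sum]
    refine Finset.sum_le_sum fun j _ => ?_
    simp only [streamline_apply]
    rw [setIntegral_const_tri]
    have h2 : 0 ≤ M.diamT j * (M.area j * conv ζ v j (M.vtx j 0) ^ 2) :=
      mul_nonneg (M.diamT_pos j).le (mul_nonneg (M.area_pos j).le (sq_nonneg _))
    have h3 := mul_le_mul_of_nonneg_right (hD j) h2
    linarith
  have h2 := mul_le_mul_of_nonneg_left (sum_len_mul_sq_le ζ hρ hreg v) hZ0
  rw [sum_sides hΩ, mul_add, Finset.mul_sum, Finset.mul_sum] at h2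
  have h3 : ∀ p ∈ M.intEdges, M.edgeInt p.1
      (fun x => 1 / 2 * |inner ℝ (ζ x) (M.normal p.1)| * jump (streamline ζ v).fn p x ^ 2) ≤
      Z * (M.len p.1 * (M.diamT p.1.1 * conv ζ v p.1.1 (M.vtx p.1.1 0)) ^ 2
        + M.len p.2 * (M.diamT p.2.1 * conv ζ v p.2.1 (M.vtx p.2.1 0)) ^ 2) := by
    intro p hp
    rw [← len_comm (mem_intEdges.1 hp).2]
    simp only [jump, streamline_apply]
    obtain ⟨a, ha⟩ : ∃ a, a = M.diamT p.1.1 * conv ζ v p.1.1 (M.vtx p.1.1 0) := ⟨_, rfl⟩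
    obtain ⟨b, hb⟩ : ∃ b, b = M.diamT p.2.1 * conv ζ v p.2.1 (M.vtx p.2.1 0) := ⟨_, rfl⟩
    rw [← ha, ← hb]
    refine (edgeInt_le_const (f := fun x => 1 / 2 * |inner ℝ (ζ x) (M.normal p.1)| * (a - b) ^ 2)
      (c := 1 / 2 * Z * (a - b) ^ 2)
      ((continuousOn_const.mul (continuousOn_flux hζc p.1).abs).mul continuousOn_const)
      fun x hx => ?_).trans ?_
    · have := abs_flux_le hZ hx
      rw [flux] at this
      exact mul_le_mul_of_nonneg_right (by linarith) (sq_nonneg _)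
    · have := mul_nonneg (M.len_pos p.1).le (mul_nonneg hZ0 (sq_nonneg (a + b)))
      linarith
  have h4 : ∀ p ∈ M.bdryEdges, M.edgeInt p
      (fun x => 1 / 2 * |inner ℝ (ζ x) (M.normal p)| * (streamline ζ v).fn p.1 x ^ 2) ≤
      Z * (M.len p * (M.diamT p.1 * conv ζ v p.1 (M.vtx p.1 0)) ^ 2) := by
    intro p _
    simp only [streamline_apply]
    obtain ⟨a, ha⟩ : ∃ a, a = M.diamT p.1 * conv ζ v p.1 (M.vtx p.1 0) := ⟨_, rfl⟩
    rw [← ha]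
    refine (edgeInt_le_const (f := fun x => 1 / 2 * |inner ℝ (ζ x) (M.normal p)| * a ^ 2)
      (c := 1 / 2 * Z * a ^ 2)
      ((continuousOn_const.mul (continuousOn_flux hζc p).abs).mul continuousOn_const)
      fun x hx => ?_).trans ?_
    · have := abs_flux_le hZ hx
      rw [flux] at this
      exact mul_le_mul_of_nonneg_right (by linarith) (sq_nonneg _)
    · have := mul_nonneg (M.len_pos p).le (mul_nonneg hZ0 (sq_nonneg a))
      linarith
  have h5 := Finset.sum_le_sum h3
  have h6 := Finset.sum_le_sum h4
  rw [normUpwSq, normARSq]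
  have h7 : (D + 6 * Z / ρ ^ 2) * frozenSq ζ v =
    D * frozenSq ζ v + Z * (6 / ρ ^ 2 * frozenSq ζ v) := by ring
  rw [h7]
  linarith

/-- Young's inequality weighted by f, so that a² keeps the weight |ζ·n| of the upwind norm while b²
gets only the bound Z of that weight. -/
theorem mul_abs_mul_abs_le {κ : ℝ} (hκ : 0 < κ) {a b f Z : ℝ} (hf : 0 ≤ f) (hfZ : f ≤ Z) :
    f * (|a| * |b|) ≤ κ * (1 / 2 * f * a ^ 2) + Z / (2 * κ) * b ^ 2 := by
  have h1 : κ * (1 / 2 * f * a ^ 2) + f / (2 * κ) * b ^ 2 - f * (|a| * |b|) =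
      f / (2 * κ) * (κ * |a| - |b|) ^ 2 := by
    rw [← sq_abs a, ← sq_abs b]
    field_simp
    ring
  have h2 : 0 ≤ f / (2 * κ) * (κ * |a| - |b|) ^ 2 := by positivity
  have h3 : f / (2 * κ) * b ^ 2 ≤ Z / (2 * κ) * b ^ 2 :=
    mul_le_mul_of_nonneg_right (div_le_div_of_nonneg_right hfZ (by positivity)) (sq_nonneg b)
  linarith

/-- The jumps of v carry the weight |ζ·n| and are bounded by the upwind norm; the traces of the test
function are bounded by the frozen term. A large κ makes the share of the latter small. -/
theorem le_edge_terms_streamline (hΩ : IsConvexPolygon Ω) {ζ : Plane → Plane}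
    (hζc : ContinuousOn ζ (closure Ω)) {Z : ℝ} (hZ : ∀ x ∈ closure Ω, ‖ζ x‖ ≤ Z)
    {ρ : ℝ} (hρ : 0 < ρ) (hreg : M.ShapeRegular ρ) (hZ0 : 0 ≤ Z) {κ : ℝ} (hκ : 0 < κ) (v : M.Vh) :
    -(κ * (∑ p ∈ M.intEdges, M.edgeInt p.1 (fun x => 1 / 2 * |flux ζ p.1 x| * jump v.fn p x ^ 2)
        + ∑ p ∈ M.bdryEdges, M.edgeInt p (fun x => 1 / 2 * |flux ζ p x| * v.fn p.1 x ^ 2))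
      + 6 * Z / (κ * ρ ^ 2) * frozenSq ζ v) ≤
    ∑ p ∈ M.intEdges, M.edgeInt p.1 (fun x =>
        1 / 2 * |flux ζ p.1 x| * (jump v.fn p x * jump (streamline ζ v).fn p x)
          - flux ζ p.1 x * (jump v.fn p x * avg (streamline ζ v).fn p x))
      + ∑ p ∈ M.bdryEdges, M.edgeInt p (fun x =>
        max (-flux ζ p x) 0 * (v.fn p.1 x * (streamline ζ v).fn p.1 x)) := by
  have h2 := mul_le_mul_of_nonneg_left (sum_len_mul_sq_le ζ hρ hreg v)
    (show 0 ≤ Z / κ by positivity)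
  rw [sum_sides hΩ, mul_add, Finset.mul_sum, Finset.mul_sum] at h2
  have h3 : ∀ p ∈ M.intEdges,
      -(κ * M.edgeInt p.1 (fun x => 1 / 2 * |flux ζ p.1 x| * jump v.fn p x ^ 2)) -
      Z / κ * (M.len p.1 * (M.diamT p.1.1 * conv ζ v p.1.1 (M.vtx p.1.1 0)) ^ 2
        + M.len p.2 * (M.diamT p.2.1 * conv ζ v p.2.1 (M.vtx p.2.1 0)) ^ 2) ≤
      M.edgeInt p.1 (fun x =>
        1 / 2 * |flux ζ p.1 x| * (jump v.fn p x * jump (streamline ζ v).fn p x)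
          - flux ζ p.1 x * (jump v.fn p x * avg (streamline ζ v).fn p x)) := by
    intro p hp
    rw [← len_comm (mem_intEdges.1 hp).2]
    have hjump : ∀ x, jump (streamline ζ v).fn p x = M.diamT p.1.1 * conv ζ v p.1.1 (M.vtx p.1.1 0)
      - M.diamT p.2.1 * conv ζ v p.2.1 (M.vtx p.2.1 0) := fun _ => rfl
    simp only [hjump, avg, streamline_apply]
    obtain ⟨a, ha⟩ : ∃ a, a = M.diamT p.1.1 * conv ζ v p.1.1 (M.vtx p.1.1 0) := ⟨_, rfl⟩
    obtain ⟨b, hb⟩ : ∃ b, b = M.diamT p.2.1 * conv ζ v p.2.1 (M.vtx p.2.1 0) := ⟨_, rfl⟩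
    rw [← ha, ← hb]
    have hfl := continuousOn_flux hζc p.1
    have hj := continuousOn_jump v p (segment ℝ (M.pt₁ p.1) (M.pt₂ p.1))
    have c1 : ContinuousOn (fun x => 1 / 2 * |flux ζ p.1 x| * jump v.fn p x ^ 2)
        (segment ℝ (M.pt₁ p.1) (M.pt₂ p.1)) :=
      (continuousOn_const.mul hfl.abs).mul (hj.pow 2)
    have e1 := edgeInt_add_smul (g := fun _ => (1 : ℝ)) c1 continuousOn_const (-κ)
      (-(Z / κ * (a ^ 2 + b ^ 2)))
    rw [edgeInt_const] at e1
    have e2 : -(κ * M.edgeInt p.1 (fun x => 1 / 2 * |flux ζ p.1 x| * jump v.fn p x ^ 2)) -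
      Z / κ * (M.len p.1 * a ^ 2 + M.len p.1 * b ^ 2) =
      -κ * M.edgeInt p.1 (fun x => 1 / 2 * |flux ζ p.1 x| * jump v.fn p x ^ 2)
        + -(Z / κ * (a ^ 2 + b ^ 2)) * (M.len p.1 * 1) := by ring
    rw [e2, ← e1]
    refine edgeInt_mono ((continuousOn_const.mul c1).add continuousOn_const)
      (((continuousOn_const.mul hfl.abs).mul (hj.mul continuousOn_const)).sub
        (hfl.mul (hj.mul continuousOn_const))) fun x hx => ?_
    obtain ⟨f, hf⟩ : ∃ f, f = flux ζ p.1 x := ⟨_, rfl⟩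
    obtain ⟨d, hd⟩ : ∃ d, d = jump v.fn p x := ⟨_, rfl⟩
    have hfZ := abs_flux_le hZ hx
    rw [← hf] at hfZ
    rw [← hf, ← hd]
    have y1 := mul_abs_mul_abs_le hκ (a := d) (b := |a| + |b|) (abs_nonneg f) hfZ
    rw [abs_of_nonneg (add_nonneg (abs_nonneg a) (abs_nonneg b))] at y1
    have y2 : Z / (2 * κ) * (|a| + |b|) ^ 2 ≤ Z / κ * (a ^ 2 + b ^ 2) := by
      have : Z / κ * (a ^ 2 + b ^ 2) = Z / (2 * κ) * (2 * (|a| ^ 2 + |b| ^ 2)) := by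
        rw [sq_abs, sq_abs]; field_simp
      rw [this]
      exact mul_le_mul_of_nonneg_left (by nlinarith [sq_nonneg (|a| - |b|)]) (by positivity)
    -- Upwinding leaves only the downwind value of the test function: b when the flow leaves T⁺, a
    -- when it enters T⁺.
    have y3 : -(|f| * (|d| * (|a| + |b|))) ≤
        1 / 2 * |f| * (d * (a - b)) - f * (d * ((a + b) / 2)) := by
      rcases le_total 0 f with h0 | h0
      · have e3 : 1 / 2 * |f| * (d * (a - b)) - f * (d * ((a + b) / 2)) = -(|f| * (d * b)) := by
          rw [abs_of_nonneg h0]; ring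
        rw [e3]
        refine neg_le_neg (mul_le_mul_of_nonneg_left ?_ (abs_nonneg _))
        refine (le_abs_self _).trans ?_
        rw [abs_mul]
        exact mul_le_mul_of_nonneg_left (by linarith [abs_nonneg a]) (abs_nonneg _)
      · have e3 : 1 / 2 * |f| * (d * (a - b)) - f * (d * ((a + b) / 2)) = -(|f| * -(d * a)) := by
          rw [abs_of_nonpos h0]; ring
        rw [e3]
        refine neg_le_neg (mul_le_mul_of_nonneg_left ?_ (abs_nonneg _))
        refine (neg_le_abs _).trans ?_
        rw [abs_mul]
        exact mul_le_mul_of_nonneg_left (by linarith [abs_nonneg b]) (abs_nonneg _)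
    linarith
  have h4 : ∀ p ∈ M.bdryEdges,
      -(κ * M.edgeInt p (fun x => 1 / 2 * |flux ζ p x| * v.fn p.1 x ^ 2)) -
      Z / κ * (M.len p * (M.diamT p.1 * conv ζ v p.1 (M.vtx p.1 0)) ^ 2) ≤
      M.edgeInt p (fun x =>
        max (-flux ζ p x) 0 * (v.fn p.1 x * (streamline ζ v).fn p.1 x)) := by
    intro p _
    simp only [streamline_apply]
    obtain ⟨a, ha⟩ : ∃ a, a = M.diamT p.1 * conv ζ v p.1 (M.vtx p.1 0) := ⟨_, rfl⟩
    rw [← ha]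
    have hfl := continuousOn_flux hζc p
    have hj := continuousOn_fn v p.1 (segment ℝ (M.pt₁ p) (M.pt₂ p))
    have c1 : ContinuousOn (fun x => 1 / 2 * |flux ζ p x| * v.fn p.1 x ^ 2)
        (segment ℝ (M.pt₁ p) (M.pt₂ p)) :=
      (continuousOn_const.mul hfl.abs).mul (hj.pow 2)
    have e1 := edgeInt_add_smul (g := fun _ => (1 : ℝ)) c1 continuousOn_const (-κ) (-(Z / κ * a ^ 2))
    rw [edgeInt_const] at e1
    have e2 : -(κ * M.edgeInt p (fun x => 1 / 2 * |flux ζ p x| * v.fn p.1 x ^ 2)) -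
      Z / κ * (M.len p * a ^ 2) =
      -κ * M.edgeInt p (fun x => 1 / 2 * |flux ζ p x| * v.fn p.1 x ^ 2)
        + -(Z / κ * a ^ 2) * (M.len p * 1) := by ring
    rw [e2, ← e1]
    refine edgeInt_mono ((continuousOn_const.mul c1).add continuousOn_const)
      ((hfl.neg.sup continuousOn_const).mul (hj.mul continuousOn_const)) fun x hx => ?_
    obtain ⟨f, hf⟩ : ∃ f, f = flux ζ p x := ⟨_, rfl⟩
    obtain ⟨d, hd⟩ : ∃ d, d = v.fn p.1 x := ⟨_, rfl⟩
    have hfZ := abs_flux_le hZ hx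
    rw [← hf] at hfZ
    rw [← hf, ← hd]
    have y1 := mul_abs_mul_abs_le hκ (a := d) (b := a) (abs_nonneg f) hfZ
    have y2 : Z / (2 * κ) * a ^ 2 ≤ Z / κ * a ^ 2 :=
      mul_le_mul_of_nonneg_right (div_le_div_of_nonneg_left hZ0 hκ (by linarith)) (sq_nonneg _)
    have y3 : -(|f| * (|d| * |a|)) ≤ max (-f) 0 * (d * a) := by
      have e3 : 0 ≤ max (-f) 0 := le_max_right _ _
      have e4 : max (-f) 0 ≤ |f| := max_le (neg_le_abs f) (abs_nonneg f)
      have e5 : -(max (-f) 0 * (|d| * |a|)) ≤ max (-f) 0 * (d * a) := by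
        rw [← mul_neg, ← abs_mul]
        exact mul_le_mul_of_nonneg_left (neg_abs_le _) e3
      have e6 := mul_le_mul_of_nonneg_right e4 (show 0 ≤ |d| * |a| by positivity)
      linarith
    linarith
  have h5 := Finset.sum_le_sum h3
  have h6 := Finset.sum_le_sum h4
  rw [Finset.sum_sub_distrib, Finset.sum_neg_distrib, ← Finset.mul_sum] at h5 h6
  have h7 : 6 * Z / (κ * ρ ^ 2) * frozenSq ζ v = Z / κ * (6 / ρ ^ 2 * frozenSq ζ v) := by
    rw [← mul_assoc, div_mul_div_comm, mul_comm Z 6]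
  rw [h7]
  linarith

/-- On each triangle h_T² ≤ 2|T|/ρ² and |ζ·∇v| ≤ Z|∇v|, so the values of the test function are
controlled by the broken gradient without loss in h_T. -/
theorem sum_sq_streamline_le {ζ : Plane → Plane} {Z : ℝ} (hZ : ∀ x ∈ closure Ω, ‖ζ x‖ ≤ Z)
    {ρ : ℝ} (hρ : 0 < ρ) (hreg : M.ShapeRegular ρ) (v : M.Vh) :
    ∑ j, (M.diamT j * conv ζ v j (M.vtx j 0)) ^ 2 ≤
      2 * Z ^ 2 / ρ ^ 2 * ∑ j, M.area j * ∑ i, (v j).linear (unitVec i) ^ 2 := by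
  rw [Finset.mul_sum]
  refine Finset.sum_le_sum fun j _ => ?_
  have hG : 0 ≤ ∑ i, (v j).linear (unitVec i) ^ 2 := Finset.sum_nonneg fun _ _ => sq_nonneg _
  have h1 : conv ζ v j (M.vtx j 0) ^ 2 ≤ Z ^ 2 * ∑ i, (v j).linear (unitVec i) ^ 2 := by
    refine (Finset.sum_mul_sq_le_sq_mul_sq _ _ _).trans ?_
    refine mul_le_mul_of_nonneg_right ?_ hG
    have h2 := normSq_plane (ζ (M.vtx j 0))
    rw [Fin.sum_univ_two, ← h2]
    exact pow_le_pow_left₀ (norm_nonneg _) (hZ _ (tri_subset_closure j (M.vtx_mem j 0))) 2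
  have h2 := mul_le_mul_of_nonneg_left h1 (sq_nonneg (M.diamT j))
  have h3 := mul_le_mul_of_nonneg_right (hreg.sq_le_area hρ j) (mul_nonneg (sq_nonneg Z) hG)
  rw [div_mul_eq_mul_div, le_div_iff₀ (by positivity)]
  have h4 := mul_le_mul_of_nonneg_left h2 (sq_nonneg ρ)
  linarith

/-! ### Linearity of the forms and quadratic estimates for the norms -/

theorem fn_add_smul (v w : M.Vh) (c : ℝ) (j : Fin M.n) (x : Plane) :
    (v + c • w).fn j x = v.fn j x + c * w.fn j x := rfl

theorem jump_add_smul (v w : M.Vh) (c : ℝ) (p : M.Side × M.Side) (x : Plane) :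
    jump (v + c • w).fn p x = jump v.fn p x + c * jump w.fn p x := by
  simp only [jump, fn_add_smul]; ring

theorem avg_add_smul (v w : M.Vh) (c : ℝ) (p : M.Side × M.Side) (x : Plane) :
    avg (v + c • w).fn p x = avg v.fn p x + c * avg w.fn p x := by
  simp only [avg, fn_add_smul]; ring

theorem trace_add_smul (s : Wind) (i : Fin 2) (v w : M.Vh) (c : ℝ) (p : M.Side × M.Side)
    (x : Plane) : trace s i (v + c • w).fn p x = trace s i v.fn p x + c * trace s i w.fn p x := by
  cases s <;> simp only [trace, fn_add_smul, avg_add_smul] <;> split_ifs <;> rfl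

theorem l2_add_smul_right {u : M.Broken} (hu : ∀ j, ContinuousOn (u j) (M.tri j)) (v w : M.Vh)
    (c : ℝ) : l2 u (v + c • w).fn = l2 u v.fn + c * l2 u w.fn := by
  rw [fn_add, fn_smul, l2_add_right (w' := c • w.fn) hu (fun j => continuousOn_fn v j _)
    (fun j => (continuousOn_fn w j _).const_smul c), l2_smul_right]

theorem partialFunctional₀_add_smul (s : Wind) (i : Fin 2) (v w φ : M.Vh) (c : ℝ) :
    partialFunctional₀ s i (v + c • w).fn φ =
      partialFunctional₀ s i v.fn φ + c * partialFunctional₀ s i w.fn φ := by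
  have h1 : l2 (v + c • w).fn (φ.dx i) = l2 v.fn (φ.dx i) + c * l2 w.fn (φ.dx i) := by
    rw [l2_comm, l2_add_smul_right (u := φ.dx i) (fun _ => continuousOn_const), l2_comm, l2_comm w.fn]
  have h2 : ∀ p ∈ M.intEdges,
      M.edgeInt p.1 (fun x => trace s i (v + c • w).fn p x * M.normal p.1 i * jump φ.fn p x) =
      M.edgeInt p.1 (fun x => trace s i v.fn p x * M.normal p.1 i * jump φ.fn p x)
        + c * M.edgeInt p.1 (fun x => trace s i w.fn p x * M.normal p.1 i * jump φ.fn p x) := by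
    intro p hp
    have hc : ∀ u : M.Vh, ContinuousOn (fun x => trace s i u.fn p x * M.normal p.1 i * jump φ.fn p x)
        (segment ℝ (M.pt₁ p.1) (M.pt₂ p.1)) := fun u =>
      ((trace_continuousOn (fun j => continuousOn_fn u j _) s i hp).mul continuousOn_const).mul
        (continuousOn_jump φ p _)
    have h := edgeInt_add_smul (hc v) (hc w) 1 c
    rw [one_mul] at h
    rw [← h]
    congr 1; ext x
    rw [trace_add_smul]; ring
  rw [partialFunctional₀, partialFunctional₀, partialFunctional₀, h1, Finset.sum_congr rfl h2,
    Finset.sum_add_distrib, ← Finset.mul_sum]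
  ring

theorem gradForm_comm (s : Wind) (v w : M.Vh) : gradForm s v w = gradForm s w v :=
  Finset.sum_congr rfl fun _ _ => l2_comm _ _

/-- By symmetry the sum moves into the first argument, where the defining relation of the discrete
derivative replaces it by a functional that is visibly linear in the function. -/
theorem gradForm_add_smul (s : Wind) (u v w : M.Vh) (c : ℝ) :
    gradForm s u (v + c • w) = gradForm s u v + c * gradForm s u w := by
  rw [gradForm_comm, gradForm_comm s u v, gradForm_comm s u w]
  simp only [gradForm, partial₀_eq, partialFunctional₀_add_smul, Finset.sum_add_distrib,
    Finset.mul_sum]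

theorem penalty_comm (σ : Sym2 Plane → ℝ) (v w : M.Vh) : penalty σ v w = penalty σ w v := by
  simp only [penalty, mul_assoc, mul_comm (jump v.fn _ _), mul_comm (v.fn _ _)]

theorem penalty_add_smul (σ : Sym2 Plane → ℝ) (u v w : M.Vh) (c : ℝ) :
    penalty σ u (v + c • w) = penalty σ u v + c * penalty σ u w := by
  have h1 : ∀ p ∈ M.intEdges, M.edgeInt p.1
      (fun x => σ (M.edge p.1) / M.len p.1 * jump u.fn p x * jump (v + c • w).fn p x) =
      M.edgeInt p.1 (fun x => σ (M.edge p.1) / M.len p.1 * jump u.fn p x * jump v.fn p x)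
      + c * M.edgeInt p.1 (fun x => σ (M.edge p.1) / M.len p.1 * jump u.fn p x * jump w.fn p x) := by
    intro p _
    have hc : ∀ g : M.Vh, ContinuousOn
        (fun x => σ (M.edge p.1) / M.len p.1 * jump u.fn p x * jump g.fn p x)
        (segment ℝ (M.pt₁ p.1) (M.pt₂ p.1)) := fun g =>
      (continuousOn_const.mul (continuousOn_jump u p _)).mul (continuousOn_jump g p _)
    have h := edgeInt_add_smul (hc v) (hc w) 1 c
    rw [one_mul] at h
    rw [← h]
    congr 1; ext x
    rw [jump_add_smul]; ring
  have h2 : ∀ p ∈ M.bdryEdges, M.edgeInt p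
      (fun x => σ (M.edge p) / M.len p * u.fn p.1 x * (v + c • w).fn p.1 x) =
      M.edgeInt p (fun x => σ (M.edge p) / M.len p * u.fn p.1 x * v.fn p.1 x)
      + c * M.edgeInt p (fun x => σ (M.edge p) / M.len p * u.fn p.1 x * w.fn p.1 x) := by
    intro p _
    have hc : ∀ g : M.Vh, ContinuousOn
        (fun x => σ (M.edge p) / M.len p * u.fn p.1 x * g.fn p.1 x)
        (segment ℝ (M.pt₁ p) (M.pt₂ p)) := fun g =>
      (continuousOn_const.mul (continuousOn_fn u _ _)).mul (continuousOn_fn g _ _)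
    have h := edgeInt_add_smul (hc v) (hc w) 1 c
    rw [one_mul] at h
    rw [← h]
    congr 1; ext x
    rw [fn_add_smul]; ring
  rw [penalty, penalty, penalty, Finset.sum_congr rfl h1, Finset.sum_congr rfl h2,
    Finset.sum_add_distrib, Finset.sum_add_distrib, ← Finset.mul_sum, ← Finset.mul_sum]
  ring

theorem formD_comm (σ : Sym2 Plane → ℝ) (v w : M.Vh) : formD σ v w = formD σ w v := by
  rw [formD, formD, gradForm_comm, gradForm_comm Wind.minus, penalty_comm]

theorem formD_add_smul (σ : Sym2 Plane → ℝ) (u v w : M.Vh) (c : ℝ) :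
    formD σ u (v + c • w) = formD σ u v + c * formD σ u w := by
  rw [formD, formD, formD, gradForm_add_smul, gradForm_add_smul, penalty_add_smul]
  ring

theorem formD_self (σ : Sym2 Plane → ℝ) (v : M.Vh) : formD σ v v = normDSq σ v := by
  have h1 : ∀ p ∈ M.intEdges, M.edgeInt p.1
      (fun x => σ (M.edge p.1) / M.len p.1 * jump v.fn p x * jump v.fn p x) =
      σ (M.edge p.1) / M.len p.1 * M.edgeInt p.1 (fun x => jump v.fn p x ^ 2) := by
    intro p _
    rw [← edgeInt_smul]
    congr 1; ext x; ring
  have h2 : ∀ p ∈ M.bdryEdges, M.edgeInt p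
      (fun x => σ (M.edge p) / M.len p * v.fn p.1 x * v.fn p.1 x) =
      σ (M.edge p) / M.len p * M.edgeInt p (fun x => v.fn p.1 x ^ 2) := by
    intro p _
    rw [← edgeInt_smul]
    congr 1; ext x; ring
  rw [formD, normDSq, penalty, Finset.sum_congr rfl h1, Finset.sum_congr rfl h2, gradForm, gradForm]

theorem normDSq_nonneg {σ : Sym2 Plane → ℝ} (hσ : ∀ p : M.Side, 0 ≤ σ (M.edge p)) (v : M.Vh) :
    0 ≤ normDSq σ v := by
  have := sum_gradTri_le σ hσ v
  have h0 : 0 ≤ ∑ j, gradTri v j := Finset.sum_nonneg fun j _ => gradTri_nonneg v j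
  linarith

theorem normDSq_add_smul (σ : Sym2 Plane → ℝ) (v w : M.Vh) (c : ℝ) :
    normDSq σ (v + c • w) = normDSq σ v + 2 * c * formD σ v w + c ^ 2 * normDSq σ w := by
  rw [← formD_self, formD_add_smul, formD_comm σ _ v, formD_comm σ _ w, formD_add_smul,
    formD_add_smul, formD_self, formD_self, formD_comm σ w v]
  ring

/-- Parallelogram law: add the nonnegative quantity with c replaced by -c. -/
theorem normDSq_add_smul_le {σ : Sym2 Plane → ℝ} (hσ : ∀ p : M.Side, 0 ≤ σ (M.edge p)) (v w : M.Vh)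
    (c : ℝ) : normDSq σ (v + c • w) ≤ 2 * normDSq σ v + 2 * c ^ 2 * normDSq σ w := by
  have h1 := normDSq_add_smul σ v w c
  have h2 := normDSq_add_smul σ v w (-c)
  have h3 := normDSq_nonneg hσ (v + -c • w)
  linarith

/-- Expand 0 ≤ ‖v + w‖_d²; this is the only lower bound of the diffusive cross term that is needed.
-/
theorem neg_le_formD {σ : Sym2 Plane → ℝ} (hσ : ∀ p : M.Side, 0 ≤ σ (M.edge p)) (v w : M.Vh) :
    -(1 / 2 * (normDSq σ v + normDSq σ w)) ≤ formD σ v w := by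
  have h2 := normDSq_add_smul σ v w 1
  have h3 := normDSq_nonneg hσ (v + (1 : ℝ) • w)
  linarith

/-- Linearity is read off from the form after integration by parts, which no longer contains
discrete derivatives. -/
theorem formUpw_add_smul (hΩ : IsConvexPolygon Ω) {ζ : Plane → Plane}
    (hζ : ∀ i, MemW1Inf Ω (fun x => ζ x i)) (hζc : ContinuousOn ζ (closure Ω)) {γ : Plane → ℝ}
    (hγ : MemLp γ ⊤ (volume.restrict Ω)) (u v w : M.Vh) (c : ℝ) :
    formUpw ζ γ u (v + c • w) = formUpw ζ γ u v + c * formUpw ζ γ u w := by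
  have h1 : ∀ p ∈ M.intEdges, M.edgeInt p.1 (fun x =>
        1 / 2 * |flux ζ p.1 x| * (jump u.fn p x * jump (v + c • w).fn p x)
          - flux ζ p.1 x * (jump u.fn p x * avg (v + c • w).fn p x)) =
      M.edgeInt p.1 (fun x => 1 / 2 * |flux ζ p.1 x| * (jump u.fn p x * jump v.fn p x)
          - flux ζ p.1 x * (jump u.fn p x * avg v.fn p x))
      + c * M.edgeInt p.1 (fun x => 1 / 2 * |flux ζ p.1 x| * (jump u.fn p x * jump w.fn p x)
          - flux ζ p.1 x * (jump u.fn p x * avg w.fn p x)) := by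
    intro p _
    have hfl := continuousOn_flux hζc p.1
    have hc : ∀ g : M.Vh, ContinuousOn (fun x =>
        1 / 2 * |flux ζ p.1 x| * (jump u.fn p x * jump g.fn p x)
          - flux ζ p.1 x * (jump u.fn p x * avg g.fn p x))
        (segment ℝ (M.pt₁ p.1) (M.pt₂ p.1)) := fun g =>
      ((continuousOn_const.mul hfl.abs).mul
        ((continuousOn_jump u p _).mul (continuousOn_jump g p _))).sub
        (hfl.mul ((continuousOn_jump u p _).mul (continuousOn_avg g p _)))
    have h := edgeInt_add_smul (hc v) (hc w) 1 c
    rw [one_mul] at h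
    rw [← h]
    congr 1; ext x
    rw [jump_add_smul, avg_add_smul]; ring
  have h2 : ∀ p ∈ M.bdryEdges, M.edgeInt p (fun x =>
        max (-flux ζ p x) 0 * (u.fn p.1 x * (v + c • w).fn p.1 x)) =
      M.edgeInt p (fun x => max (-flux ζ p x) 0 * (u.fn p.1 x * v.fn p.1 x))
      + c * M.edgeInt p (fun x => max (-flux ζ p x) 0 * (u.fn p.1 x * w.fn p.1 x)) := by
    intro p _
    have hc : ∀ g : M.Vh, ContinuousOn (fun x => max (-flux ζ p x) 0 * (u.fn p.1 x * g.fn p.1 x))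
        (segment ℝ (M.pt₁ p) (M.pt₂ p)) := fun g =>
      ((continuousOn_flux hζc p).neg.sup continuousOn_const).mul
        ((continuousOn_fn u _ _).mul (continuousOn_fn g _ _))
    have h := edgeInt_add_smul (hc v) (hc w) 1 c
    rw [one_mul] at h
    rw [← h]
    congr 1; ext x
    rw [fn_add_smul]; ring
  have h3 : l2 (fun j x => γ x * u.fn j x) (v + c • w).fn =
      l2 (fun j x => γ x * u.fn j x) v.fn + c * l2 (fun j x => γ x * u.fn j x) w.fn := by
    simp only [l2]
    rw [Finset.mul_sum, ← Finset.sum_add_distrib]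
    refine Finset.sum_congr rfl fun j _ => ?_
    have hi : ∀ g : M.Vh, IntegrableOn (fun x => γ x * u.fn j x * g.fn j x) (M.tri j) := fun g => by
      have := integrableOn_mul_of_memLp hΩ hγ
        ((continuousOn_fn u j (M.tri j)).mul (continuousOn_fn g j (M.tri j)))
      simpa only [Pi.mul_apply, ← mul_assoc] using this
    rw [← integral_const_mul, ← integral_add (hi v) ((hi w).const_mul c)]
    congr 1; ext x
    rw [fn_add_smul]; ring
  rw [formUpw_eq hΩ hζ hζc hγ, formUpw_eq hΩ hζ hζc hγ, formUpw_eq hΩ hζ hζc hγ, h3,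
    l2_add_smul_right (fun j => continuousOn_conv hζc u j), Finset.sum_congr rfl h1,
    Finset.sum_congr rfl h2, Finset.sum_add_distrib, Finset.sum_add_distrib, ← Finset.mul_sum,
    ← Finset.mul_sum]
  ring

theorem formA_add_smul (hΩ : IsConvexPolygon Ω) {ζ : Plane → Plane}
    (hζ : ∀ i, MemW1Inf Ω (fun x => ζ x i)) (hζc : ContinuousOn ζ (closure Ω)) {γ : Plane → ℝ}
    (hγ : MemLp γ ⊤ (volume.restrict Ω)) (ε : ℝ) (σ : Sym2 Plane → ℝ) (u v w : M.Vh) (c : ℝ) :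
    formA ε σ ζ γ u (v + c • w) = formA ε σ ζ γ u v + c * formA ε σ ζ γ u w := by
  rw [formA, formA, formA, formD_add_smul, formUpw_add_smul hΩ hζ hζc hγ]
  ring

theorem integral_sq_add_smul_le {j : Fin M.n} {f g : Plane → ℝ} (hf : ContinuousOn f (M.tri j))
    (hg : ContinuousOn g (M.tri j)) (c : ℝ) : ∫ x in M.tri j, (f x + c * g x) ^ 2 ≤
      2 * (∫ x in M.tri j, f x ^ 2) + 2 * c ^ 2 * ∫ x in M.tri j, g x ^ 2 := by
  have i1 : IntegrableOn (fun x => 2 * f x ^ 2) (M.tri j) :=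
    (integrableOn_tri (hf.pow 2)).const_mul 2
  have i2 : IntegrableOn (fun x => 2 * c ^ 2 * g x ^ 2) (M.tri j) :=
    (integrableOn_tri (hg.pow 2)).const_mul (2 * c ^ 2)
  rw [← integral_const_mul, ← integral_const_mul, ← integral_add i1 i2]
  refine integral_mono (integrableOn_tri ((hf.add (continuousOn_const.mul hg)).pow 2)) (i1.add i2)
    fun x => ?_
  simp only
  nlinarith [sq_nonneg (f x - c * g x)]

theorem edgeInt_sq_add_smul_le {p : M.Side} {r f g : Plane → ℝ}
    (hr : ContinuousOn r (segment ℝ (M.pt₁ p) (M.pt₂ p))) (hr0 : ∀ x, 0 ≤ r x)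
    (hf : ContinuousOn f (segment ℝ (M.pt₁ p) (M.pt₂ p)))
    (hg : ContinuousOn g (segment ℝ (M.pt₁ p) (M.pt₂ p))) (c : ℝ) :
    M.edgeInt p (fun x => r x * (f x + c * g x) ^ 2) ≤
      2 * M.edgeInt p (fun x => r x * f x ^ 2) + 2 * c ^ 2 * M.edgeInt p (fun x => r x * g x ^ 2) := by
  have c1 := hr.mul (hf.pow 2)
  have c2 := hr.mul (hg.pow 2)
  have h := edgeInt_add_smul c1 c2 2 (2 * c ^ 2)
  refine (edgeInt_mono (hr.mul ((hf.add (continuousOn_const.mul hg)).pow 2))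
    ((continuousOn_const.mul c1).add (continuousOn_const.mul c2)) fun x _ => ?_).trans_eq h
  simp only [Pi.add_apply, Pi.mul_apply, Pi.pow_apply]
  nlinarith [mul_nonneg (hr0 x) (sq_nonneg (f x - c * g x))]

theorem streamSq_add_smul_le {ζ : Plane → Plane} (hζc : ContinuousOn ζ (closure Ω)) (v w : M.Vh)
    (c : ℝ) : streamSq ζ (v + c • w) ≤ 2 * streamSq ζ v + 2 * c ^ 2 * streamSq ζ w := by
  rw [streamSq, streamSq, streamSq, Finset.mul_sum, Finset.mul_sum, ← Finset.sum_add_distrib]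
  refine Finset.sum_le_sum fun j _ => ?_
  have h := mul_le_mul_of_nonneg_left (integral_sq_add_smul_le (continuousOn_conv hζc v j)
    (continuousOn_conv hζc w j) c) (M.diamT_pos j).le
  have e : ∀ x, conv ζ (v + c • w) j x = conv ζ v j x + c * conv ζ w j x := fun x => by
    rw [conv, conv, conv, Finset.mul_sum, ← Finset.sum_add_distrib]
    refine Finset.sum_congr rfl fun i _ => ?_
    change ζ x i * ((v j).linear (unitVec i) + c * (w j).linear (unitVec i)) =
      ζ x i * (v j).linear (unitVec i) + c * (ζ x i * (w j).linear (unitVec i))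
    ring
  simp only [e]
  linarith

theorem normUpwSq_add_smul_le {ζ : Plane → Plane} (hζc : ContinuousOn ζ (closure Ω)) (v w : M.Vh)
    (c : ℝ) : normUpwSq ζ (v + c • w) ≤ 2 * normUpwSq ζ v + 2 * c ^ 2 * normUpwSq ζ w := by
  have h1 : l2 (v + c • w).fn (v + c • w).fn ≤ 2 * l2 v.fn v.fn + 2 * c ^ 2 * l2 w.fn w.fn := by
    simp only [l2, ← sq]
    rw [Finset.mul_sum, Finset.mul_sum, ← Finset.sum_add_distrib]
    exact Finset.sum_le_sum fun j _ =>
      integral_sq_add_smul_le (continuousOn_fn v j _) (continuousOn_fn w j _) c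
  have hr : ∀ p : M.Side, ContinuousOn (fun x => 1 / 2 * |inner ℝ (ζ x) (M.normal p)|)
      (segment ℝ (M.pt₁ p) (M.pt₂ p)) := fun p =>
    continuousOn_const.mul (continuousOn_flux hζc p).abs
  have h2 := Finset.sum_le_sum fun (p : M.Side) (_ : p ∈ M.bdryEdges) =>
    edgeInt_sq_add_smul_le (hr p) (fun x => by positivity)
      (continuousOn_fn v p.1 _) (continuousOn_fn w p.1 _) c
  have h3 := Finset.sum_le_sum fun (p : M.Side × M.Side) (_ : p ∈ M.intEdges) =>
    edgeInt_sq_add_smul_le (hr p.1) (fun x => by positivity)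
      (continuousOn_jump v p _) (continuousOn_jump w p _) c
  rw [Finset.sum_add_distrib, ← Finset.mul_sum, ← Finset.mul_sum] at h2 h3
  simp only [normUpwSq, normARSq, fn_add_smul, jump_add_smul]
  linarith

theorem l2_self_le_normUpwSq (ζ : Plane → Plane) (v : M.Vh) : l2 v.fn v.fn ≤ normUpwSq ζ v := by
  have h2 : 0 ≤ ∑ p ∈ M.intEdges, M.edgeInt p.1
      (fun x => 1 / 2 * |inner ℝ (ζ x) (M.normal p.1)| * jump v.fn p x ^ 2) :=
    Finset.sum_nonneg fun p _ => edgeInt_nonneg fun x _ => by positivity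
  have h3 : 0 ≤ ∑ p ∈ M.bdryEdges, M.edgeInt p
      (fun x => 1 / 2 * |inner ℝ (ζ x) (M.normal p)| * v.fn p.1 x ^ 2) :=
    Finset.sum_nonneg fun p _ => edgeInt_nonneg fun x _ => by positivity
  rw [normUpwSq, normARSq]
  linarith

theorem l2_self_nonneg (v : M.Vh) : 0 ≤ l2 v.fn v.fn :=
  Finset.sum_nonneg fun _ _ => integral_nonneg fun _ => mul_self_nonneg _

/-! ### The inf-sup estimate -/

/-- The properties of the streamline test function. -/
theorem exists_streamline_bounds {Ω : Set Plane} (hΩ : IsConvexPolygon Ω) {ζ : Plane → Plane}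
    (hζ : ∀ i, MemW1Inf Ω (fun x => ζ x i)) (hζc : ContinuousOn ζ (closure Ω)) {γ : Plane → ℝ}
    (hγ : MemLp γ ⊤ (volume.restrict Ω)) {ρ : ℝ} (hρ : 0 < ρ) {σmin : ℝ} (σmax : ℝ)
    (hσmin : 0 < σmin) :
    ∃ C : ℝ, 0 < C ∧ ∀ M : Triangulation Ω, M.ShapeRegular ρ → ∀ σ : Sym2 Plane → ℝ,
      (∀ p : M.Side, 0 ≤ σ (M.edge p) ∧ σ (M.edge p) ≤ σmax) →
      (M.AtMostOneBoundaryEdge ∨ ∀ p : M.Side, σmin ≤ σ (M.edge p)) → ∀ v : M.Vh,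
      1 / 2 * streamSq ζ v - C * normUpwSq ζ v ≤ formUpw ζ γ v (streamline ζ v) ∧
      normUpwSq ζ (streamline ζ v) ≤ C * (streamSq ζ v + normUpwSq ζ v) ∧
      normDSq σ (streamline ζ v) ≤ C * normDSq σ v := by
  obtain ⟨C₀, hC₀, hgrad⟩ := exists_sum_grad_le ρ σmin hρ hσmin
  obtain ⟨Γ, hΓ0, hΓ⟩ := exists_ae_bound hγ
  have hcpt : IsCompact (closure Ω) := hΩ.isBounded.isCompact_closure
  obtain ⟨Z, hZ0, hZ⟩ : ∃ Z, 0 < Z ∧ ∀ x ∈ closure Ω, ‖ζ x‖ ≤ Z := by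
    obtain ⟨Z, hZ⟩ := hcpt.exists_bound_of_continuousOn hζc
    exact ⟨max Z 1, by positivity, fun x hx => (hZ x hx).trans (le_max_left _ _)⟩
  obtain ⟨L, hL⟩ : ∃ L : ℝ, ∀ i, ∀ x ∈ closure Ω, ∀ y ∈ closure Ω,
      |ζ x i - ζ y i| ≤ L * dist x y := by
    choose K hK using fun i => exists_lipschitzOnWith hΩ.isOpen hΩ.convex hΩ.isBounded (hζ i)
      (continuousOn_coord hζc i)
    refine ⟨∑ i, K i, fun i x hx y hy => ?_⟩
    have h1 := (hK i).dist_le_mul x hx y hy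
    rw [Real.dist_eq] at h1
    refine h1.trans (mul_le_mul_of_nonneg_right ?_ dist_nonneg)
    exact Finset.single_le_sum (f := fun i => (K i : ℝ)) (fun i _ => (K i).2) (Finset.mem_univ i)
  obtain ⟨D, hD0, hD⟩ : ∃ D : ℝ, 0 ≤ D ∧ ∀ (M : Triangulation Ω) j, M.diamT j ≤ D :=
    ⟨Metric.diam (closure Ω), Metric.diam_nonneg, fun M j =>
      Metric.diam_mono (tri_subset_closure j) hcpt.isBounded⟩
  -- Chosen so that the edge terms use exactly an eighth of the frozen term. With the eighth taken
  -- by the reaction, a quarter remains out of the available half.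
  obtain ⟨κ, hκ⟩ : ∃ κ, κ = 48 * Z / ρ ^ 2 := ⟨_, rfl⟩
  have hκ0 : 0 < κ := by rw [hκ]; positivity
  obtain ⟨c₁, hc₁⟩ : ∃ c, c = 72 * L ^ 2 * D / ρ ^ 2 + 2 * Γ ^ 2 * D := ⟨_, rfl⟩
  obtain ⟨c₂, hc₂⟩ : ∃ c, c = D + 6 * Z / ρ ^ 2 := ⟨_, rfl⟩
  obtain ⟨c₃, hc₃⟩ : ∃ c, c = 288 * L ^ 2 * D / ρ ^ 2 := ⟨_, rfl⟩
  obtain ⟨c₄, hc₄⟩ : ∃ c, c = (1728 / ρ ^ 2 + 12 * |σmax|) * (2 * Z ^ 2 / ρ ^ 2 * C₀) := ⟨_, rfl⟩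
  have h₁ : 0 ≤ c₁ := by rw [hc₁]; positivity
  have h₂ : 0 ≤ c₂ := by rw [hc₂]; positivity
  have h₃ : 0 ≤ c₃ := by rw [hc₃]; positivity
  have h₄ : 0 ≤ c₄ := by rw [hc₄]; positivity
  have h₂₃ : 0 ≤ c₂ * c₃ := mul_nonneg h₂ h₃
  -- A single constant serves all three bounds: c₁ and κ for the lower bound, c₂ and c₃ for the
  -- upwind norm, c₄ for the diffusive norm. The remaining summands are nonnegative slack.
  refine ⟨c₁ + κ + 2 * c₂ + c₂ * c₃ + c₄, by positivity, fun M hreg σ hσ hor v => ?_⟩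
  have hP := l2_self_nonneg v
  have hPP := l2_self_le_normUpwSq ζ v
  have hP' := hP.trans hPP
  have hS := streamSq_nonneg ζ v
  have hd := normDSq_nonneg (fun p => (hσ p).1) v
  refine ⟨?_, ?_, ?_⟩
  · have a1 := le_l2_conv_streamline hζc hL hρ hreg (hD M) v
    have a2 := le_l2_reaction_streamline hΩ ζ hγ hΓ (hD M) v
    have a3 := le_edge_terms_streamline hΩ hζc hZ hρ hreg hZ0.le hκ0 v
    have a4 : 6 * Z / (κ * ρ ^ 2) = 1 / 8 := by rw [hκ]; field_simp; norm_num
    rw [a4] at a3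
    have a5 : normUpwSq ζ v = l2 v.fn v.fn
        + (∑ p ∈ M.intEdges, M.edgeInt p.1 (fun x => 1 / 2 * |flux ζ p.1 x| * jump v.fn p x ^ 2)
        + ∑ p ∈ M.bdryEdges, M.edgeInt p (fun x => 1 / 2 * |flux ζ p x| * v.fn p.1 x ^ 2)) := by
      rw [normUpwSq, normARSq]
      simp only [flux]
      ring
    have a6 : κ * (∑ p ∈ M.intEdges, M.edgeInt p.1
          (fun x => 1 / 2 * |flux ζ p.1 x| * jump v.fn p x ^ 2)
        + ∑ p ∈ M.bdryEdges, M.edgeInt p (fun x => 1 / 2 * |flux ζ p x| * v.fn p.1 x ^ 2)) ≤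
        κ * normUpwSq ζ v := mul_le_mul_of_nonneg_left (by linarith) hκ0.le
    have a7 := mul_le_mul_of_nonneg_left hPP h₁
    have a8 := frozenSq_nonneg ζ v
    have a9 : 0 ≤ (2 * c₂ + c₂ * c₃ + c₄) * normUpwSq ζ v := mul_nonneg (by positivity) hP'
    rw [formUpw_eq hΩ hζ hζc hγ]
    have a10 : c₁ * l2 v.fn v.fn = 72 * L ^ 2 * D / ρ ^ 2 * l2 v.fn v.fn
      + 2 * Γ ^ 2 * D * l2 v.fn v.fn := by rw [hc₁]; ring
    linarith
  · have a1 := normUpwSq_streamline_le hΩ hζc hZ hρ hreg (hD M) hZ0.le v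
    have a2 := frozenSq_le hζc hL hρ hreg (hD M) v
    rw [← hc₂] at a1
    rw [← hc₃] at a2
    have a3 := mul_le_mul_of_nonneg_left a2 h₂
    have a4 := mul_le_mul_of_nonneg_left hPP h₂₃
    have a5 : 0 ≤ (c₁ + κ + c₂ * c₃ + c₄) * streamSq ζ v := mul_nonneg (by positivity) hS
    have a6 : 0 ≤ (c₁ + κ + 2 * c₂ + c₄) * normUpwSq ζ v := mul_nonneg (by positivity) hP'
    linarith
  · have a1 := normDSq_piecewiseConst_le hΩ hρ hreg hσ
      fun j => M.diamT j * conv ζ v j (M.vtx j 0)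
    have a2 := sum_sq_streamline_le hZ hρ hreg v
    have a3 := hgrad hΩ M hreg σ (fun p => (hσ p).1) hor v
    have b1 : 0 ≤ 2 * Z ^ 2 / ρ ^ 2 := by positivity
    have b2 : 0 ≤ 1728 / ρ ^ 2 + 12 * |σmax| := by positivity
    have a4 := mul_le_mul_of_nonneg_left (a2.trans (mul_le_mul_of_nonneg_left a3 b1)) b2
    have a5 : 0 ≤ (c₁ + κ + 2 * c₂ + c₂ * c₃) * normDSq σ v := mul_nonneg (by positivity) hd
    have a6 : c₄ * normDSq σ v = (1728 / ρ ^ 2 + 12 * |σmax|) *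
      (2 * Z ^ 2 / ρ ^ 2 * (C₀ * normDSq σ v)) := by rw [hc₄]; ring
    change normDSq σ (streamline ζ v) ≤ _ at a1
    linarith

theorem normSharp_eq {Ω : Set Plane} {M : Triangulation Ω} (ε : ℝ) (σ : Sym2 Plane → ℝ)
    (ζ : Plane → Plane) (v : M.Vh) :
    normSharp ε σ ζ v = √(ε * normDSq σ v + normUpwSq ζ v + streamSq ζ v) := rfl

/-- The inf-sup estimate, with an explicit test function. -/
theorem exists_infSup {Ω : Set Plane} (hΩ : IsConvexPolygon Ω) {ζ : Plane → Plane}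
    (hζ : ∀ i, MemW1Inf Ω (fun x => ζ x i)) (hζc : ContinuousOn ζ (closure Ω)) {γ : Plane → ℝ}
    (hγ : MemLp γ ⊤ (volume.restrict Ω)) {γ₀ : ℝ} (hγ₀ : 0 < γ₀)
    (hγζ : ∀ᵐ x ∂(volume.restrict Ω), γ₀ ≤ γ x - 1 / 2 * weakDiv Ω ζ x)
    {ρ : ℝ} (hρ : 0 < ρ) {σmin : ℝ} (σmax : ℝ) (hσmin : 0 < σmin) :
    ∃ C : ℝ, 0 < C ∧ ∀ ε : ℝ, 0 < ε → ∀ M : Triangulation Ω, M.ShapeRegular ρ →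
      ∀ σ : Sym2 Plane → ℝ, (∀ p : M.Side, 0 ≤ σ (M.edge p) ∧ σ (M.edge p) ≤ σmax) →
      (M.AtMostOneBoundaryEdge ∨ ∀ p : M.Side, σmin ≤ σ (M.edge p)) → ∀ v : M.Vh, v ≠ 0 →
      ∃ w : M.Vh, w ≠ 0 ∧
        C * normSharp ε σ ζ v ≤ formA ε σ ζ γ v w / normSharp ε σ ζ w := by
  obtain ⟨C, hC, hst⟩ := exists_streamline_bounds hΩ hζ hζc hγ hρ σmax hσmin
  obtain ⟨m, hm⟩ : ∃ m, m = min γ₀ 1 := ⟨_, rfl⟩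
  have hm0 : 0 < m := hm ▸ lt_min hγ₀ one_pos
  have hm1 : m ≤ 1 := hm ▸ min_le_right _ _
  -- With 2δ(1 + C) = m, half of the coercivity constant m covers the loss δC in the upwind norm,
  -- and the diffusive loss δ(1 + C)/2 = m/4 is at most 1/4. What remains is at least δ/2 times each
  -- part of the norm.
  obtain ⟨δ, hδ⟩ : ∃ δ, δ = m / (2 * (1 + C)) := ⟨_, rfl⟩
  have hδ0 : 0 < δ := by rw [hδ]; positivity
  have hδm : 2 * δ * (1 + C) = m := by rw [hδ]; field_simp
  have hδC : 0 < δ * C := mul_pos hδ0 hC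
  -- The factor δ/2 is the lower bound of the form, and √(2(1 + C)) bounds the norm of w by that of
  -- v.
  refine ⟨δ / 2 / √(2 * (1 + C)), by positivity, fun ε hε M hreg σ hσ hor v hv => ?_⟩
  obtain ⟨z, hz⟩ : ∃ z, z = streamline ζ v := ⟨_, rfl⟩
  obtain ⟨b1, b2, b3⟩ := hst M hreg σ hσ hor v
  have b4 : streamSq ζ z = 0 := hz ▸ streamSq_streamline ζ v
  rw [← hz] at b1 b2 b3
  have hσ0 := fun p => (hσ p).1
  have hl0 : 0 < l2 v.fn v.fn :=
    (l2_self_nonneg v).lt_of_ne fun h => hv (eq_zero_of_l2_self h.symm)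
  have hP : 0 < normUpwSq ζ v := hl0.trans_le (l2_self_le_normUpwSq ζ v)
  have hS := streamSq_nonneg ζ v
  have hd := normDSq_nonneg hσ0 v
  have hdz := normDSq_nonneg hσ0 z
  have hεd := mul_nonneg hε.le hd
  have hA : δ / 2 * (ε * normDSq σ v + normUpwSq ζ v + streamSq ζ v) ≤
      formA ε σ ζ γ v (v + δ • z) := by
    rw [formA_add_smul hΩ hζ hζc hγ, formA, formA, formD_self]
    have e1 := le_formUpw_self hΩ hζ hζc hγ hγζ v
    rw [← hm] at e1
    have e2 := neg_le_formD hσ0 v z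
    have e3 : -(1 / 2 * (1 + C) * normDSq σ v) ≤ formD σ v z := by linarith
    have e4 := mul_le_mul_of_nonneg_left e3 (mul_pos hδ0 hε).le
    have e5 := mul_le_mul_of_nonneg_left b1 hδ0.le
    have e6 : δ * ε * -(1 / 2 * (1 + C) * normDSq σ v) = -(m / 4 * (ε * normDSq σ v)) := by
      rw [← hδm]; ring
    have e7 : m * normUpwSq ζ v = 2 * δ * normUpwSq ζ v + 2 * (δ * C * normUpwSq ζ v) := by
      rw [← hδm]; ring
    have e8 : m / 4 * (ε * normDSq σ v) ≤ 1 / 4 * (ε * normDSq σ v) :=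
      mul_le_mul_of_nonneg_right (by linarith) hεd
    have e9 : δ / 2 * (ε * normDSq σ v) ≤ 1 / 4 * (ε * normDSq σ v) :=
      mul_le_mul_of_nonneg_right (by linarith) hεd
    have e10 := mul_pos hδ0 hP
    have e11 := mul_pos hδC hP
    linarith
  have hN : 0 < ε * normDSq σ v + normUpwSq ζ v + streamSq ζ v := by positivity
  have hW : ε * normDSq σ (v + δ • z) + normUpwSq ζ (v + δ • z) + streamSq ζ (v + δ • z) ≤
      2 * (1 + C) * (ε * normDSq σ v + normUpwSq ζ v + streamSq ζ v) := by
    have e1 := mul_le_mul_of_nonneg_left (normDSq_add_smul_le hσ0 v z δ) hε.le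
    have e2 := normUpwSq_add_smul_le hζc v z δ
    have e3 := streamSq_add_smul_le hζc v z δ
    rw [b4] at e3
    have hδ1 : δ ^ 2 ≤ 1 := by
      have : δ ≤ 1 := by linarith
      nlinarith
    have e4 : δ ^ 2 * normUpwSq ζ z ≤ C * (streamSq ζ v + normUpwSq ζ v) := by
      refine (mul_le_of_le_one_left ?_ hδ1).trans b2
      exact (l2_self_nonneg z).trans (l2_self_le_normUpwSq ζ z)
    have e5 : δ ^ 2 * normDSq σ z ≤ C * normDSq σ v :=
      (mul_le_of_le_one_left hdz hδ1).trans b3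
    have e6 := mul_le_mul_of_nonneg_left e5 hε.le
    linarith
  have hApos : 0 < formA ε σ ζ γ v (v + δ • z) := (by positivity : 0 < δ / 2 *
    (ε * normDSq σ v + normUpwSq ζ v + streamSq ζ v)).trans_le hA
  -- The form is linear in its second argument and positive at w, so w cannot vanish; this does not
  -- require comparing z with v.
  have hw : v + δ • z ≠ 0 := by
    intro h0
    have h1 := formA_add_smul hΩ hζ hζc hγ ε σ v (v + δ • z) (v + δ • z) (-1)
    have h2 : v + δ • z + (-1 : ℝ) • (v + δ • z) = v + δ • z := by simp [h0]
    rw [h2] at h1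
    linarith
  refine ⟨v + δ • z, hw, ?_⟩
  have hWpos : 0 < ε * normDSq σ (v + δ • z) + normUpwSq ζ (v + δ • z) + streamSq ζ (v + δ • z) := by
    have e1 := mul_nonneg hε.le (normDSq_nonneg hσ0 (v + δ • z))
    have e2 : 0 < l2 (v + δ • z).fn (v + δ • z).fn :=
      (l2_self_nonneg _).lt_of_ne fun h => hw (eq_zero_of_l2_self h.symm)
    have e3 := l2_self_le_normUpwSq ζ (v + δ • z)
    have e4 := streamSq_nonneg ζ (v + δ • z)
    linarith
  obtain ⟨N, hNe⟩ : ∃ N, N = ε * normDSq σ v + normUpwSq ζ v + streamSq ζ v := ⟨_, rfl⟩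
  rw [normSharp_eq, normSharp_eq, le_div_iff₀ (Real.sqrt_pos.2 hWpos)]
  rw [← hNe] at hA hW hN ⊢
  have f1 := Real.sqrt_le_sqrt hW
  rw [Real.sqrt_mul (by positivity)] at f1
  have f2 : 0 < √(2 * (1 + C)) := Real.sqrt_pos.2 (by positivity)
  calc _ ≤ δ / 2 / √(2 * (1 + C)) * √N * (√(2 * (1 + C)) * √N) :=
        mul_le_mul_of_nonneg_left f1 (by positivity)
    _ = δ / 2 * (√N * √N) := by field_simp
    _ = δ / 2 * N := by rw [Real.mul_self_sqrt hN.le]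
    _ ≤ _ := hA

theorem exists_ne_zero {Ω : Set Plane} (hΩ : IsConvexPolygon Ω) (M : Triangulation Ω) :
    ∃ w : M.Vh, w ≠ 0 := by
  obtain ⟨x, hx⟩ := hΩ.1
  have h := subset_closure hx
  rw [← M.cover, mem_iUnion] at h
  obtain ⟨j, -⟩ := h
  refine ⟨fun _ => AffineMap.const ℝ Plane 1, fun h => ?_⟩
  have := congrArg (fun v : M.Vh => v j 0) h
  simp at this

theorem formA_zero_left {Ω : Set Plane} (hΩ : IsConvexPolygon Ω) {M : Triangulation Ω}
    {ζ : Plane → Plane} (hζ : ∀ i, MemW1Inf Ω (fun x => ζ x i)) (hζc : ContinuousOn ζ (closure Ω))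
    {γ : Plane → ℝ} (hγ : MemLp γ ⊤ (volume.restrict Ω)) (ε : ℝ) (σ : Sym2 Plane → ℝ) (w : M.Vh) :
    formA ε σ ζ γ 0 w = 0 := by
  have h1 : formD σ 0 w = 0 := by
    have := formD_add_smul σ w 0 0 (-1)
    rw [smul_zero, add_zero] at this
    rw [formD_comm]
    linarith
  have h2 : ∀ j x, (0 : M.Vh).fn j x = 0 := fun _ _ => rfl
  have h3 : conv ζ (0 : M.Vh) = 0 := by
    funext j x
    simp [conv, Vh.dx]
  rw [formA, h1, formUpw_eq hΩ hζ hζc hγ, h3]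
  simp [h2, jump, l2, edgeInt_zero]

theorem normSharp_zero {Ω : Set Plane} {M : Triangulation Ω} (ε : ℝ) (σ : Sym2 Plane → ℝ)
    (ζ : Plane → Plane) : normSharp ε σ ζ (0 : M.Vh) = 0 := by
  have hd : normDSq σ (0 : M.Vh) = 0 := by
    have := formD_add_smul σ (0 : M.Vh) 0 0 (-1)
    rw [smul_zero, add_zero] at this
    rw [← formD_self]
    linarith
  have hf : ∀ j x, (0 : M.Vh).fn j x = 0 := fun _ _ => rfl
  rw [normSharp_eq, hd]
  simp [normUpwSq, normARSq, streamSq, conv, Vh.dx, l2, hf, jump, edgeInt_zero]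

end Triangulation
end DWDG

theorem mainTheorem5 (Ω : Set DWDG.Plane) (hΩ : DWDG.IsConvexPolygon Ω)
    (ζ : DWDG.Plane → DWDG.Plane) (hζ : ∀ i, DWDG.MemW1Inf Ω (fun x => ζ x i))
    (hζc : ContinuousOn ζ (closure Ω))
    (γ : DWDG.Plane → ℝ) (hγ : DWDG.MemW1Inf Ω γ)
    (hγ_nonneg : ∀ᵐ x ∂(MeasureTheory.volume.restrict Ω), 0 ≤ γ x)
    (γ₀ : ℝ) (hγ₀ : 0 < γ₀)
    (hγζ : ∀ᵐ x ∂(MeasureTheory.volume.restrict Ω), γ₀ ≤ γ x - 1 / 2 * DWDG.weakDiv Ω ζ x)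
    (ρ : ℝ) (hρ : 0 < ρ) (σmin σmax : ℝ) (hσmin : 0 < σmin) :
    ∃ C : ℝ, 0 < C ∧
      ∀ (ε : ℝ), 0 < ε →
      ∀ (M : DWDG.Triangulation Ω), M.ShapeRegular ρ →
      ∀ (σ : Sym2 DWDG.Plane → ℝ), (∀ p : M.Side, 0 ≤ σ (M.edge p) ∧ σ (M.edge p) ≤ σmax) →
      (M.AtMostOneBoundaryEdge ∨ ∀ p : M.Side, σmin ≤ σ (M.edge p)) →
      ∀ v : M.Vh,
        ((C * DWDG.Triangulation.normSharp ε σ ζ v : ℝ) : EReal) ≤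
          ⨆ w : {w : M.Vh // w ≠ 0},
            ((DWDG.Triangulation.formA ε σ ζ γ v w.1 /
              DWDG.Triangulation.normSharp ε σ ζ w.1 : ℝ) : EReal) := by
  obtain ⟨C, hC, h⟩ := DWDG.Triangulation.exists_infSup hΩ hζ hζc hγ.1 hγ₀ hγζ hρ σmax hσmin
  refine ⟨C, hC, fun ε hε M hreg σ hσ hor v => ?_⟩
  obtain ⟨w, hw, hle⟩ : ∃ w : M.Vh, w ≠ 0 ∧ C * DWDG.Triangulation.normSharp ε σ ζ v ≤
      DWDG.Triangulation.formA ε σ ζ γ v w / DWDG.Triangulation.normSharp ε σ ζ w := by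
    -- For v = 0 both sides vanish, but some nonzero w is still needed, since a supremum over the
    -- empty set would be -∞. It exists because a nonempty Ω requires at least one triangle.
    by_cases hv : v = 0
    · obtain ⟨w, hw⟩ := DWDG.Triangulation.exists_ne_zero hΩ M
      refine ⟨w, hw, ?_⟩
      rw [hv, DWDG.Triangulation.formA_zero_left hΩ hζ hζc hγ.1, zero_div]
      rw [DWDG.Triangulation.normSharp_zero, mul_zero]
    · exact h ε hε M hreg σ hσ hor v hv
  refine (EReal.coe_le_coe_iff.2 hle).trans ?_
  exact le_iSup (fun w : {w : M.Vh // w ≠ 0} => ((DWDG.Triangulation.formA ε σ ζ γ v w.1 /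
    DWDG.Triangulation.normSharp ε σ ζ w.1 : ℝ) : EReal)) ⟨w, hw⟩
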